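/- Let $n\ge 1$. For each prime power $p^v$ ($v\ge 1$) let $A_{p^v}\subset(\mathbf Z/p^v\mathbf Z)^n$ be an arbitrary (possibly empty) set. For an integer $q\ge 1$ let $A_q\subset(\mathbf Z/q\mathbf Z)^n$ be the set of $x$ with $x \bmod p^v\in A_{p^v}$ for all prime powers $p^v$ exactly dividing $q$, and let $\rho(q)=|A_q|$. Let $\mathcal Q$ be the set of $q\ge 1$ with $\rho(q)\ge 1$, and, for $k\ge 1$, let $\mathcal Q_k(x)$ be the set of $q\in\mathcal Q$ with $q\le x$ having exactly $k$ distinct prime factors. For $q\in\mathcal Q$ let $\Delta_q=\frac1{\rho(q)}\sum_{a\in A_q}\delta_{\{a/q\}}$, a probability measure on $(\mathbf R/\mathbf Z)^n$, and let $$\mathrm{disc}(\Delta_q)=\sup_B|\Delta_q(B)-\mathrm{vol}(B)|,$$ where $B$ runs over the boxes in $(\mathbf R/\mathbf Z)^n$, i.e. the images of the products of $n$ closed intervals of $\mathbf R$ of length at most $1$. For a prime $p\in\mathcal Q$ let $\lambda(p)=\max_H|H\cap A_p|$, where $H$ runs over the affine hyperplanes $\{x\in(\mathbf Z/p\mathbf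 Z)^n: h_1x_1+\dots+h_nx_n=a\}$ with $a\in\mathbf Z/p\mathbf Z$ and $h\in(\mathbf Z/p\mathbf Z)^n$, $h\ne0$. Put $$\mathcal P(x)=3+\sum_{\substack{p\le x\\ p\in\mathcal Q}}\frac1p,\qquad \widetilde{\mathcal P}(x)=3+\sum_{\substack{p\le x\\ p\in\mathcal Q}}\frac1p\Big(\frac{\lambda(p)}{\rho(p)}\Big)^{1/2},$$ with $p$ running over primes. **Proposition 5.1.** Suppose that $\alpha>0$ and $x_0\ge2$ are such that $\sum_{p\le x,\ \rho(p)\ge1}\log p\ge\alpha x$ for all $x\ge x_0$, and let $x$ be large enough in terms of $\alpha$ and $x_0$ only. Let $k\ge1$ be an integer. The following holds, with implied constants depending only on $n$. (1) If $k\le\mathcal P(x)$, then $\mathcal Q_k(x)$ is non-empty and $$\frac1{|\mathcal Q_k(x)|}\sum_{q\in\mathcal Q_k(x)}\mathrm{disc}(\Delta_q)\ll\frac{k^{6+n}}{\alpha}\Big(\Big(\frac{\widetilde{\mathcal P}(x)}{\mathcal P(x)}\Big)^{\frac{k-1}3}+e^{-k/2}\Big(\frac k{\mathcal P(x)}\Big)^{\frac{k-1}2}\Big).$$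 (2) If $\mathcal P(x)<k\le\exp(\sqrt{\log\log x})$, then $\mathcal Q_k(x)$ is non-empty and $$\frac1{|\mathcal Q_k(x)|}\sum_{q\in\mathcal Q_k(x)}\mathrm{disc}(\Delta_q)\ll\frac1\alpha\exp\Big(\frac{(6+n)k\log k}{\mathcal P(x)}\Big)\Big(e^{-k/3}+\Big(\frac{\widetilde{\mathcal P}(x)}{\mathcal P(x)}\Big)^{\frac k{3(1+\log(k/\mathcal P(x)))}}\Big).$$ -/

import Mathlib

open MeasureTheory
open scoped ENNReal

noncomputable section

namespace CRTSets

/-- A family of sets `A_m ⊆ (ℤ/mℤ)^n`. Only the members whose index `m` is a prime power are ever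
used, so this is a free choice of one set `A_{p^v}` for each prime power `p^v`. -/
abbrev Family (n : ℕ) : Type := ∀ m : ℕ, Set (Fin n → ZMod m)

variable {n : ℕ}

/-- The set `A_q ⊆ (ℤ/qℤ)^n` of all `x` with `x mod p^v ∈ A_{p^v}` for all `p^v` exactly
dividing `q`. -/
def crtSet (A : Family n) (q : ℕ) : Set (Fin n → ZMod q) :=
  {x | ∀ p ∈ q.primeFactors,
    (fun i => ZMod.castHom (Nat.ordProj_dvd q p) (ZMod (p ^ q.factorization p)) (x i)) ∈
      A (p ^ q.factorization p)}

/-- `ρ(q) = |A_q|`. -/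
def rho (A : Family n) (q : ℕ) : ℕ := (crtSet A q).ncard

/-- The affine hyperplane `h_1 x_1 + ⋯ + h_n x_n = a` in `(ℤ/qℤ)^n`. -/
def hyperplane (q : ℕ) (h : Fin n → ZMod q) (a : ZMod q) : Set (Fin n → ZMod q) :=
  {x | ∑ i, h i * x i = a}

/-- `λ(p)`: the maximum of `|H ∩ A_p|` over all affine hyperplanes `H` (with nonzero coefficient
vector). -/
def lam (A : Family n) (p : ℕ) : ℕ :=
  sSup {N : ℕ | ∃ h : Fin n → ZMod p, h ≠ 0 ∧ ∃ a : ZMod p,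
    N = (hyperplane p h a ∩ crtSet A p).ncard}

/-- `𝒬_k(x)`: the positive integers `q ≤ x` with `ρ(q) ≥ 1` and exactly `k` distinct prime
factors. -/
def Qk (A : Family n) (k : ℕ) (x : ℝ) : Finset ℕ :=
  (Finset.Icc 1 ⌊x⌋₊).filter fun q => 1 ≤ rho A q ∧ q.primeFactors.card = k

/-- The primes `p ≤ x` with `ρ(p) ≥ 1`. -/
def primesQ (A : Family n) (x : ℝ) : Finset ℕ :=
  (Finset.Icc 1 ⌊x⌋₊).filter fun p => p.Prime ∧ 1 ≤ rho A p

/-- The density assumption, with constants `α` and `x₀`: for all `x ≥ x₀`, the sum of `log p` over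
the primes `p ≤ x` with `ρ(p) ≥ 1` is at least `α x`. -/
def DensityAssumption (A : Family n) (α x₀ : ℝ) : Prop :=
  ∀ x : ℝ, x₀ ≤ x → α * x ≤ ∑ p ∈ primesQ A x, Real.log p

/-- `𝒫(x) = 3 + ∑ 1/p`, over the primes `p ≤ x` in `𝒬`. -/
def calP (A : Family n) (x : ℝ) : ℝ := ∑ p ∈ primesQ A x, 1 / (p : ℝ) + 3

/-- `𝒫̃(x) = 3 + ∑ (λ(p)/ρ(p))^{1/2}/p`, over the primes `p ≤ x` in `𝒬`. -/
def calPtilde (A : Family n) (x : ℝ) : ℝ :=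
  ∑ p ∈ primesQ A x, 1 / (p : ℝ) * Real.sqrt ((lam A p : ℝ) / (rho A p : ℝ)) + 3

/-- The class of `{a/q}` in `(ℝ/ℤ)^n`. -/
def fracPoint (q : ℕ) (a : Fin n → ZMod q) : Fin n → UnitAddCircle :=
  fun i => ((((a i).val : ℝ) / (q : ℝ) : ℝ) : UnitAddCircle)

/-- The measure `Δ_q = ρ(q)⁻¹ ∑_{a ∈ A_q} δ_{{a/q}}` on `(ℝ/ℤ)^n`. -/
def Delta (A : Family n) (q : ℕ) : Measure (Fin n → UnitAddCircle) :=
  (rho A q : ℝ≥0∞)⁻¹ • Measure.sum fun a : crtSet A q => Measure.dirac (fracPoint q a.1)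

/-- Boxes in `(ℝ/ℤ)^n`: images of closed boxes in `ℝ^n` with all side lengths at most `1`. -/
def IsBox (B : Set (Fin n → UnitAddCircle)) : Prop :=
  ∃ a b : Fin n → ℝ, (∀ i, a i ≤ b i ∧ b i - a i ≤ 1) ∧
    B = (fun (t : Fin n → ℝ) (i : Fin n) => (t i : UnitAddCircle)) '' Set.Icc a b

/-- The box discrepancy of a measure `μ` on `(ℝ/ℤ)^n`. -/
def disc (μ : Measure (Fin n → UnitAddCircle)) : ℝ :=
  sSup {d : ℝ | ∃ B : Set (Fin n → UnitAddCircle), IsBox B ∧ d = |μ.real B - volume.real B|}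

/-- The average of the discrepancies of the measures `Δ_q` over `q ∈ 𝒬_k(x)`. -/
def avgDisc (A : Family n) (k : ℕ) (x : ℝ) : ℝ :=
  (∑ q ∈ Qk A k x, disc (Delta A q)) / ((Qk A k x).card : ℝ)

end CRTSets

end

noncomputable section

namespace CRTSets

variable {n : ℕ}

/-! Write `q = r s`, where `r` collects the prime powers of primes at most `Z` and `s` those of
larger primes. By the Erdős–Turán inequality, `disc (Δ_q)` is at most a constant times `δ` plus the
sum of the normalised Weyl sums `|W_q(h)|` over nonzero `|h_i| ≤ N`, weighted by `∏ max(1,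
|h_i|)⁻¹`, where `N = δ⁻³`. The Chinese remainder theorem gives `W_{rs}(h) = W_r(s⁻¹ h) W_s(r⁻¹ h)`,
and the second factor is bounded by 1. What remains depends on `s` only through its class modulo
`r`.

Selberg's sieve bounds the number of rough `s ≤ X / r` in any class modulo `r` by a constant times
`X / (r φ(r) log Z)` in the relevant range. Hence `|W_r(s⁻¹ h)|` may be replaced by its average over
the unit multiples of `h`. That average is multiplicative in `r`, at most 1, and at a prime `p` not
dividing all of `h` at most `(λ(p)/ρ(p))^{1/2}`, by Plancherel and Cauchy–Schwarz. If `s` has `j`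
prime factors, summing over `r` with `k - j` prime factors gives `(𝒫̃ + S)^{k-j} / (k-j)!`, where
`S` absorbs proper prime powers and the primes dividing `h`. Moreover `Z^j ≤ X`, so `j ≤ log X / log
Z`.

This fails only for `q ≤ √X` and for `r > X^{1/3}`. The latter are rare: Rankin's trick with weight
`r^{10 / log Z}`, combined with a Hardy–Ramanujan argument, saves `exp(-(10/3) log X / log Z)`. In
the other direction, `|𝒬_k(X)|` is bounded below by counting products of `k - 1` small primes and
one large prime. The density hypothesis supplies the large one, and elementary symmetric sums give
about `α (X / log X) σ^{k-1} / (k-1)!` with `σ = 𝒫 - O(1) - (3/2) log k`.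

Dividing the two bounds gives `exists_avgDisc_le`, with two free parameters: `u`, about `log X / log
Z`, and `v`, about `log (1/δ)`. If `k ≤ 𝒫`, both are `16 - a`, with `e^a` the size of the claimed
bound, and an interpolation between the extreme values of `j` bounds the sum. If `k > 𝒫`, one takes
`v = k` and `u = k θ / 10` with `θ = min(1, log(𝒫/𝒫̃) / (1 + log(k/𝒫)))`. The threshold for `x`
depends only on `α` and `x₀`, because the constants before the final choice are absolute or depend
on `n` alone. -/

/-! ### Sums over primes and prime powers, by partial summation from Chebyshev bounds. -/

theorem sum_mul_le_of_partial_sums_le {c : ℕ → ℝ} {f f' F : ℝ → ℝ} {x y B : ℝ} (hy : 0 ≤ y)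
    (hyx : y ≤ x) (hf : ∀ t ∈ Set.Icc y x, HasDerivAt f (f' t) t)
    (hF : ∀ t ∈ Set.Icc y x, HasDerivAt F (f t) t)
    (hf' : ContinuousOn f' (Set.Icc y x)) (hneg : ∀ t ∈ Set.Icc y x, f' t ≤ 0)
    (hpos : ∀ t ∈ Set.Icc y x, 0 ≤ f t)
    (h0 : 0 ≤ ∑ k ∈ Finset.Icc 0 ⌊y⌋₊, c k)
    (hB : ∀ t ∈ Set.Icc y x, ∑ k ∈ Finset.Icc 0 ⌊t⌋₊, c k ≤ B * t) :
    ∑ k ∈ Finset.Ioc ⌊y⌋₊ ⌊x⌋₊, f k * c k ≤ B * (y * f y + F x - F y) := by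
  have hd : ∀ t ∈ Set.Icc y x, deriv f t = f' t := fun t ht => (hf t ht).deriv
  have hint : IntegrableOn (deriv f) (Set.Icc y x) :=
    (hf'.congr hd).integrableOn_Icc
  rw [sum_mul_eq_sub_sub_integral_mul c hy hyx (fun t ht => (hf t ht).differentiableAt) hint]
  have hI1 : IntegrableOn (fun t => deriv f t * ∑ k ∈ Finset.Icc 0 ⌊t⌋₊, c k) (Set.Ioc y x) :=
    (integrableOn_mul_sum_Icc c hy hint).mono_set Set.Ioc_subset_Icc_self
  have hI2 : IntegrableOn (fun t => f' t * (B * t)) (Set.Ioc y x) :=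
    ((hf'.mul (by fun_prop)).integrableOn_Icc).mono_set Set.Ioc_subset_Icc_self
  have key : ∫ t in Set.Ioc y x, f' t * (B * t)
      ≤ ∫ t in Set.Ioc y x, deriv f t * ∑ k ∈ Finset.Icc 0 ⌊t⌋₊, c k := by
    refine setIntegral_mono_on hI2 hI1 measurableSet_Ioc fun t ht => ?_
    have ht' := Set.Ioc_subset_Icc_self ht
    rw [hd t ht']
    exact mul_le_mul_of_nonpos_left (hB t ht') (hneg t ht')
  -- Since `F' = f`, the function `t f(t) - F(t)` is an antiderivative of `t f'(t)`; this is the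
  -- only role of `F`.
  have hcalc : ∫ t in Set.Ioc y x, f' t * (B * t) = B * (x * f x - F x) - B * (y * f y - F y) := by
    rw [← intervalIntegral.integral_of_le hyx]
    refine intervalIntegral.integral_eq_sub_of_hasDerivAt
      (f := fun t => B * (t * f t - F t)) (fun t ht => ?_) ?_
    · rw [Set.uIcc_of_le hyx] at ht
      have := (((hasDerivAt_id t).mul (hf t ht)).sub (hF t ht)).const_mul B
      refine this.congr_deriv ?_
      simp only [id]; ring
    · rw [intervalIntegrable_iff_integrableOn_Ioc_of_le hyx]; exact hI2
  have hx1 := mul_le_mul_of_nonneg_left (hB x (Set.right_mem_Icc.2 hyx)) (hpos x (Set.right_mem_Icc.2 hyx))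
  have hy1 := mul_nonneg (hpos y (Set.left_mem_Icc.2 hyx)) h0
  linarith

/-- The partial sum up to `y` enters Abel summation with a negative sign, so a lower bound for it is
useless. It therefore stays in the statement, to be bounded from above by the user. -/
theorem le_sum_mul_of_le_partial_sums {c : ℕ → ℝ} {f f' F : ℝ → ℝ} {x y B : ℝ} (hy : 0 ≤ y)
    (hyx : y ≤ x) (hf : ∀ t ∈ Set.Icc y x, HasDerivAt f (f' t) t)
    (hF : ∀ t ∈ Set.Icc y x, HasDerivAt F (f t) t)
    (hf' : ContinuousOn f' (Set.Icc y x)) (hneg : ∀ t ∈ Set.Icc y x, f' t ≤ 0)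
    (hpos : ∀ t ∈ Set.Icc y x, 0 ≤ f t)
    (hB : ∀ t ∈ Set.Icc y x, B * t ≤ ∑ k ∈ Finset.Icc 0 ⌊t⌋₊, c k) :
    B * (y * f y + F x - F y) - f y * ∑ k ∈ Finset.Icc 0 ⌊y⌋₊, c k ≤
      ∑ k ∈ Finset.Ioc ⌊y⌋₊ ⌊x⌋₊, f k * c k := by
  have hd : ∀ t ∈ Set.Icc y x, deriv f t = f' t := fun t ht => (hf t ht).deriv
  have hint : IntegrableOn (deriv f) (Set.Icc y x) :=
    (hf'.congr hd).integrableOn_Icc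
  rw [sum_mul_eq_sub_sub_integral_mul c hy hyx (fun t ht => (hf t ht).differentiableAt) hint]
  have hI1 : IntegrableOn (fun t => deriv f t * ∑ k ∈ Finset.Icc 0 ⌊t⌋₊, c k) (Set.Ioc y x) :=
    (integrableOn_mul_sum_Icc c hy hint).mono_set Set.Ioc_subset_Icc_self
  have hI2 : IntegrableOn (fun t => f' t * (B * t)) (Set.Ioc y x) :=
    ((hf'.mul (by fun_prop)).integrableOn_Icc).mono_set Set.Ioc_subset_Icc_self
  have key : ∫ t in Set.Ioc y x, deriv f t * ∑ k ∈ Finset.Icc 0 ⌊t⌋₊, c k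
      ≤ ∫ t in Set.Ioc y x, f' t * (B * t) := by
    refine setIntegral_mono_on hI1 hI2 measurableSet_Ioc fun t ht => ?_
    have ht' := Set.Ioc_subset_Icc_self ht
    rw [hd t ht']
    exact mul_le_mul_of_nonpos_left (hB t ht') (hneg t ht')
  have hcalc : ∫ t in Set.Ioc y x, f' t * (B * t) = B * (x * f x - F x) - B * (y * f y - F y) := by
    rw [← intervalIntegral.integral_of_le hyx]
    refine intervalIntegral.integral_eq_sub_of_hasDerivAt
      (f := fun t => B * (t * f t - F t)) (fun t ht => ?_) ?_
    · rw [Set.uIcc_of_le hyx] at ht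
      have := (((hasDerivAt_id t).mul (hf t ht)).sub (hF t ht)).const_mul B
      refine this.congr_deriv ?_
      simp only [id]; ring
    · rw [intervalIntegrable_iff_integrableOn_Ioc_of_le hyx]; exact hI2
  have hx1 := mul_le_mul_of_nonneg_left (hB x (Set.right_mem_Icc.2 hyx)) (hpos x (Set.right_mem_Icc.2 hyx))
  linarith

theorem hasDerivAt_inv_mul_log {t : ℝ} (ht : 1 < t) :
    HasDerivAt (fun t : ℝ => (t * Real.log t)⁻¹) (-(Real.log t + 1) / (t * Real.log t) ^ 2) t := by
  have h0 : t ≠ 0 := by linarith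
  have hl : 0 < Real.log t := Real.log_pos ht
  have h1 : HasDerivAt (fun t : ℝ => t * Real.log t) (Real.log t + 1) t := by
    refine ((hasDerivAt_id t).mul (Real.hasDerivAt_log h0)).congr_deriv ?_
    simp [h0]
  exact h1.inv (mul_pos (by linarith) hl).ne'

theorem hasDerivAt_log_log {t : ℝ} (ht : 1 < t) :
    HasDerivAt (fun t : ℝ => Real.log (Real.log t)) ((t * Real.log t)⁻¹) t := by
  have h0 : t ≠ 0 := by linarith
  have hl : 0 < Real.log t := Real.log_pos ht
  have := (Real.hasDerivAt_log h0).log hl.ne'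
  refine this.congr_deriv ?_
  field_simp

theorem continuousOn_deriv_inv_mul_log {x y : ℝ} (hy : 1 < y) :
    ContinuousOn (fun t : ℝ => -(Real.log t + 1) / (t * Real.log t) ^ 2) (Set.Icc y x) := by
  intro t ht
  have h1 : 1 < t := hy.trans_le ht.1
  have h0 : t ≠ 0 := by linarith
  have hl : 0 < Real.log t := Real.log_pos h1
  have : (t * Real.log t) ^ 2 ≠ 0 := by positivity
  apply ContinuousAt.continuousWithinAt
  fun_prop (disch := assumption)

/-- The indicator of a set of primes weighted by the logarithm. -/
noncomputable def logWeight (S : Set ℕ) (n : ℕ) : ℝ := by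
  classical exact if n.Prime ∧ n ∈ S then Real.log n else 0

theorem logWeight_nonneg (S : Set ℕ) (n : ℕ) : 0 ≤ logWeight S n := by
  unfold logWeight; split_ifs <;> positivity

theorem sum_logWeight_le (S : Set ℕ) {t : ℝ} (ht : 0 ≤ t) :
    ∑ k ∈ Finset.Icc 0 ⌊t⌋₊, logWeight S k ≤ Real.log 4 * t := by
  refine le_trans ?_ (Chebyshev.theta_le_log4_mul_x ht)
  rw [Chebyshev.theta_eq_sum_Icc, Finset.sum_filter]
  refine Finset.sum_le_sum fun n _ => ?_
  unfold logWeight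
  split_ifs <;> first | rfl | positivity | (exfalso; tauto)

/-- The weight `(t log t)⁻¹` has antiderivative `log log t`, so summation against it turns bounds
for sums of `log p` into bounds for sums of `1/p`. -/
theorem inv_mul_log_mul_logWeight (n : ℕ) (S : Set ℕ) [DecidablePred (· ∈ S)] :
    ((n : ℝ) * Real.log n)⁻¹ * logWeight S n = if n.Prime ∧ n ∈ S then 1 / (n : ℝ) else 0 := by
  unfold logWeight
  split_ifs with h
  · have h2 : (1 : ℝ) < n := by exact_mod_cast h.1.one_lt
    have : 0 < Real.log n := Real.log_pos h2
    field_simp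
  · simp

/-- The factor `log 4`, instead of Mertens' 1, is the price of using only `θ(t) ≤ (log 4) t`. It is
harmless: later it suffices that `(21/20) log 4 < 3/2`. -/
theorem sum_inv_primes_Ioc_le {x y : ℝ} (hy : 1 < y) (hyx : y ≤ x) :
    ∑ p ∈ (Finset.Ioc ⌊y⌋₊ ⌊x⌋₊).filter Nat.Prime, 1 / (p : ℝ) ≤
      Real.log 4 * (Real.log (Real.log x) - Real.log (Real.log y) + 1 / Real.log y) := by
  classical
  have h := sum_mul_le_of_partial_sums_le (c := logWeight Set.univ)
    (f := fun t => (t * Real.log t)⁻¹) (B := Real.log 4) (by linarith : 0 ≤ y) hyx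
    (fun t ht => hasDerivAt_inv_mul_log (hy.trans_le ht.1))
    (fun t ht => hasDerivAt_log_log (hy.trans_le ht.1))
    (continuousOn_deriv_inv_mul_log hy) (fun t ht => ?_) (fun t ht => ?_)
    (Finset.sum_nonneg fun _ _ => logWeight_nonneg _ _)
    (fun t ht => sum_logWeight_le _ (by linarith [ht.1]))
  · simp only [inv_mul_log_mul_logWeight] at h
    rw [Finset.sum_filter]
    simp only [Set.mem_univ, and_true] at h
    refine h.trans (le_of_eq ?_)
    have : Real.log y ≠ 0 := (Real.log_pos hy).ne'
    field_simp
    ring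
  · have : 0 < Real.log t := Real.log_pos (hy.trans_le ht.1)
    rw [neg_div]
    have : 0 ≤ (Real.log t + 1) / (t * Real.log t) ^ 2 := by positivity
    linarith
  · have : 0 < Real.log t := Real.log_pos (hy.trans_le ht.1)
    have : 0 < t := by linarith [ht.1]
    positivity

theorem sum_log_div_primes_le {x : ℝ} (hx : 1 ≤ x) :
    ∑ p ∈ (Finset.Icc 1 ⌊x⌋₊).filter Nat.Prime, Real.log p / (p : ℝ) ≤
      Real.log 4 * (1 + Real.log x) := by
  classical
  have h := sum_mul_le_of_partial_sums_le (c := logWeight Set.univ)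
    (f := fun t => t⁻¹) (f' := fun t => -(t^2)⁻¹) (F := Real.log) (B := Real.log 4)
    (y := 1) zero_le_one hx
    (fun t ht => hasDerivAt_inv (by linarith [ht.1] : t ≠ 0))
    (fun t ht => Real.hasDerivAt_log (by linarith [ht.1] : t ≠ 0))
    (fun t ht => ?_) (fun t ht => ?_) (fun t ht => ?_)
    (Finset.sum_nonneg fun _ _ => logWeight_nonneg _ _)
    (fun t ht => sum_logWeight_le _ (by linarith [ht.1]))
  · refine le_trans (le_of_eq ?_) (h.trans (le_of_eq (by simp)))
    rw [Finset.sum_filter, ← Finset.add_sum_Ioc_eq_sum_Icc]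
    · rw [if_neg Nat.not_prime_one, zero_add]
      simp only [Nat.floor_one]
      refine Finset.sum_congr rfl fun n _ => ?_
      simp only [logWeight, Set.mem_univ, and_true]
      split_ifs <;> simp [div_eq_inv_mul]
    · exact Nat.le_floor (by simpa using hx)
  · have : t ^ 2 ≠ 0 := by have := ht.1; positivity
    apply ContinuousAt.continuousWithinAt
    fun_prop (disch := assumption)
  · have : 0 ≤ (t ^ 2)⁻¹ := by positivity
    linarith
  · have := ht.1
    positivity

theorem sum_primes_Icc_eq (f : ℕ → ℝ) {x y : ℝ} (hy : 1 ≤ y) (hyx : y ≤ x) (Q : ℕ → Prop)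
    [DecidablePred Q] :
    ∑ p ∈ (Finset.Icc 1 ⌊x⌋₊).filter Q, f p =
      ∑ p ∈ (Finset.Icc 1 ⌊y⌋₊).filter Q, f p +
        ∑ p ∈ (Finset.Ioc ⌊y⌋₊ ⌊x⌋₊).filter Q, f p := by
  have h := Nat.floor_mono hyx
  rw [← Finset.sum_union]
  · rw [← Finset.filter_union]
    congr 2
    ext n
    have : 1 ≤ ⌊y⌋₊ := Nat.le_floor (by simpa using hy)
    simp only [Finset.mem_union, Finset.mem_Icc, Finset.mem_Ioc]
    omega
  · refine Finset.disjoint_filter_filter ?_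
    rw [Finset.disjoint_left]
    intro n
    simp only [Finset.mem_Icc, Finset.mem_Ioc]
    omega

theorem exists_sum_inv_primes_le : ∃ C : ℝ, 0 < C ∧ ∀ x : ℝ, 2 ≤ x →
    ∑ p ∈ (Finset.Icc 1 ⌊x⌋₊).filter Nat.Prime, 1 / (p : ℝ) ≤
      Real.log 4 * Real.log (Real.log x) + C := by
  refine ⟨1 / 2 + Real.log 4 * (- Real.log (Real.log 2) + 1 / Real.log 2), ?_, fun x hx => ?_⟩
  · have h2 : 0 < Real.log 2 := Real.log_pos (by norm_num)
    have : Real.log (Real.log 2) ≤ 0 :=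
      Real.log_nonpos h2.le (by linarith [Real.log_two_lt_d9])
    have h4 : 0 < Real.log 4 := Real.log_pos (by norm_num)
    have : 0 ≤ - Real.log (Real.log 2) + 1 / Real.log 2 := by
      have : 0 < 1 / Real.log 2 := by positivity
      linarith
    positivity
  · rw [sum_primes_Icc_eq _ (by norm_num : (1 : ℝ) ≤ 2) hx]
    have h := sum_inv_primes_Ioc_le (by norm_num : (1 : ℝ) < 2) hx
    have : (Finset.Icc 1 ⌊(2 : ℝ)⌋₊).filter Nat.Prime = {2} := by
      rw [show ⌊(2 : ℝ)⌋₊ = 2 from Nat.floor_ofNat 2]; decide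
    rw [this, Finset.sum_singleton]
    push_cast
    nlinarith

/-- Primes up to `T` are bounded by the sum over all primes up to `T`. Beyond `T` there are at most
`log M / log 2 ≤ T / log 2` prime factors, each contributing less than `1/T`. -/
theorem exists_sum_inv_primeFactors_le : ∃ C : ℝ, 0 < C ∧ ∀ T : ℝ, 2 ≤ T → ∀ M : ℕ, M ≠ 0 →
    Real.log M ≤ T → ∑ p ∈ M.primeFactors, 1 / (p : ℝ) ≤
      Real.log 4 * Real.log (Real.log T) + C := by
  obtain ⟨C, hC, h⟩ := exists_sum_inv_primes_le
  have h2 : 0 < Real.log 2 := Real.log_pos (by norm_num)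
  refine ⟨C + 1 / Real.log 2, by positivity, fun T hT M hM hMT => ?_⟩
  have hT0 : 0 < T := by linarith
  rw [← Finset.sum_filter_add_sum_filter_not _ (fun p : ℕ => (p : ℝ) ≤ T)]
  have h1 : ∑ p ∈ M.primeFactors.filter (fun p : ℕ => (p : ℝ) ≤ T), 1 / (p : ℝ) ≤
      Real.log 4 * Real.log (Real.log T) + C := by
    refine le_trans (Finset.sum_le_sum_of_subset_of_nonneg ?_ fun _ _ _ => by positivity) (h T hT)
    intro p
    simp only [Finset.mem_filter, Finset.mem_Icc, Nat.mem_primeFactors]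
    rintro ⟨⟨hp, -⟩, hpT⟩
    exact ⟨⟨hp.one_le, Nat.le_floor hpT⟩, hp⟩
  have hcard : (M.primeFactors.card : ℝ) * Real.log 2 ≤ T := by
    refine le_trans ?_ hMT
    rw [← Real.log_pow]
    refine Real.log_le_log (by positivity) ?_
    have : 2 ^ M.primeFactors.card ≤ M := by
      calc 2 ^ M.primeFactors.card ≤ ∏ p ∈ M.primeFactors, p :=
            Finset.pow_card_le_prod _ _ _ fun p hp => (Nat.prime_of_mem_primeFactors hp).two_le
        _ ≤ M := Nat.le_of_dvd (Nat.pos_of_ne_zero hM) (Nat.prod_primeFactors_dvd M)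
    exact_mod_cast this
  have h3 : ∑ p ∈ M.primeFactors.filter (fun p : ℕ => ¬ (p : ℝ) ≤ T), 1 / (p : ℝ) ≤ 1 / Real.log 2 := by
    calc _ ≤ ∑ p ∈ M.primeFactors.filter (fun p : ℕ => ¬ (p : ℝ) ≤ T), 1 / T := by
          refine Finset.sum_le_sum fun p hp => ?_
          have := (Finset.mem_filter.1 hp).2
          exact one_div_le_one_div_of_le hT0 (by linarith)
      _ ≤ ∑ p ∈ M.primeFactors, 1 / T :=
          Finset.sum_le_sum_of_subset_of_nonneg (Finset.filter_subset _ _)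
            fun _ _ _ => by positivity
      _ = M.primeFactors.card / T := by simp [div_eq_mul_inv]
      _ ≤ _ := by rw [div_le_div_iff₀ hT0 h2]; linarith
  linarith

/-- For `r = a² b³`, the power `r^{-5/8}` splits as `a^{-5/4} b^{-15/8}`, a product of two
convergent series. Taking 5/8 rather than 1 leaves room for Rankin factors `r^δ` with `δ ≤ 1/8` and
for a logarithm. -/
theorem exists_sum_rpow_powerful_le : ∃ C : ℝ, 0 < C ∧ ∀ S : Finset ℕ,
    (∀ r ∈ S, ∃ a b : ℕ, 0 < a ∧ 0 < b ∧ r = a ^ 2 * b ^ 3) →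
      ∑ r ∈ S, (r : ℝ) ^ (-(5 / 8) : ℝ) ≤ C := by
  have hs1 : Summable fun a : ℕ => (a : ℝ) ^ (-(5 / 4) : ℝ) :=
    Real.summable_nat_rpow.2 (by norm_num)
  have hs2 : Summable fun a : ℕ => (a : ℝ) ^ (-(15 / 8) : ℝ) :=
    Real.summable_nat_rpow.2 (by norm_num)
  refine ⟨(∑' a : ℕ, (a : ℝ) ^ (-(5 / 4) : ℝ)) * (∑' a : ℕ, (a : ℝ) ^ (-(15 / 8) : ℝ)) + 1,
    ?_, fun S hS => ?_⟩
  · have h1 : 0 ≤ ∑' a : ℕ, (a : ℝ) ^ (-(5 / 4) : ℝ) := tsum_nonneg fun _ => by positivity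
    have h2 : 0 ≤ ∑' a : ℕ, (a : ℝ) ^ (-(15 / 8) : ℝ) := tsum_nonneg fun _ => by positivity
    positivity
  · choose! a b ha hb hab using hS
    calc ∑ r ∈ S, (r : ℝ) ^ (-(5 / 8) : ℝ)
        = ∑ r ∈ S, (a r : ℝ) ^ (-(5 / 4) : ℝ) * (b r : ℝ) ^ (-(15 / 8) : ℝ) := by
          refine Finset.sum_congr rfl fun r hr => ?_
          conv_lhs => rw [hab r hr]
          push_cast
          rw [Real.mul_rpow (by positivity) (by positivity), ← Real.rpow_natCast,
            ← Real.rpow_natCast, ← Real.rpow_mul (by positivity), ← Real.rpow_mul (by positivity)]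
          norm_num
      _ ≤ ∑ x ∈ S.image a ×ˢ S.image b,
            (x.1 : ℝ) ^ (-(5 / 4) : ℝ) * (x.2 : ℝ) ^ (-(15 / 8) : ℝ) := by
          rw [← Finset.sum_image (s := S) (g := fun r => (a r, b r))
            (f := fun x : ℕ × ℕ => (x.1 : ℝ) ^ (-(5 / 4) : ℝ) * (x.2 : ℝ) ^ (-(15 / 8) : ℝ))]
          · refine Finset.sum_le_sum_of_subset_of_nonneg ?_ fun _ _ _ => by positivity
            intro x hx
            obtain ⟨r, hr, rfl⟩ := Finset.mem_image.1 hx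
            exact Finset.mem_product.2 ⟨Finset.mem_image_of_mem _ hr, Finset.mem_image_of_mem _ hr⟩
          · intro r hr s hs h
            simp only [Prod.mk.injEq] at h
            rw [hab r hr, hab s hs, h.1, h.2]
      _ = (∑ x ∈ S.image a, (x : ℝ) ^ (-(5 / 4) : ℝ)) *
            ∑ x ∈ S.image b, (x : ℝ) ^ (-(15 / 8) : ℝ) := by
          rw [Finset.sum_mul_sum, Finset.sum_product]
      _ ≤ (∑' a : ℕ, (a : ℝ) ^ (-(5 / 4) : ℝ)) * (∑' a : ℕ, (a : ℝ) ^ (-(15 / 8) : ℝ)) := by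
          refine mul_le_mul (hs1.sum_le_tsum _ fun _ _ => by positivity)
            (hs2.sum_le_tsum _ fun _ _ => by positivity)
            (Finset.sum_nonneg fun _ _ => by positivity) (tsum_nonneg fun _ => by positivity)
      _ ≤ _ := by linarith

theorem isPrimePow_not_prime_eq {r : ℕ} (hr : IsPrimePow r) (hp : ¬ r.Prime) :
    ∃ a b : ℕ, 0 < a ∧ 0 < b ∧ r = a ^ 2 * b ^ 3 := by
  obtain ⟨p, k, hpp, hk, rfl⟩ := (isPrimePow_nat_iff _).1 hr
  have hk1 : k ≠ 1 := by rintro rfl; simp [hpp] at hp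
  rcases Nat.even_or_odd' k with ⟨c, rfl | rfl⟩
  · exact ⟨p ^ c, 1, pow_pos hpp.pos _, one_pos, by ring⟩
  · obtain ⟨d, rfl⟩ : ∃ d, c = d + 1 := ⟨c - 1, by omega⟩
    exact ⟨p ^ d, p, pow_pos hpp.pos _, hpp.pos, by ring⟩

theorem exists_calP_le : ∃ C : ℝ, 0 < C ∧ ∀ x : ℝ, 2 ≤ x →
    ∀ (n : ℕ) (A : Family n), calP A x ≤ Real.log 4 * Real.log (Real.log x) + C := by
  obtain ⟨C, hC, h⟩ := exists_sum_inv_primes_le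
  refine ⟨C + 3, by positivity, fun x hx n A => ?_⟩
  unfold calP primesQ
  have : ∑ p ∈ (Finset.Icc 1 ⌊x⌋₊).filter (fun p => p.Prime ∧ 1 ≤ rho A p), 1 / (p : ℝ) ≤
      ∑ p ∈ (Finset.Icc 1 ⌊x⌋₊).filter Nat.Prime, 1 / (p : ℝ) := by
    refine Finset.sum_le_sum_of_subset_of_nonneg ?_ fun _ _ _ => by positivity
    exact Finset.monotone_filter_right _ fun p _ hp => hp.1
  linarith [h x hx]

/-- Partial summation of the density hypothesis over the primes beyond `x₀`. The subtracted `log 4 /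
log x₀` bounds the boundary term at `x₀`, below which nothing is assumed. -/
theorem le_calP {A : Family n} {α x₀ x : ℝ} (hx₀ : 2 ≤ x₀) (hx : x₀ ≤ x)
    (h : DensityAssumption A α x₀) :
    α * (Real.log (Real.log x) - Real.log (Real.log x₀)) + 3 - Real.log 4 / Real.log x₀
        + α / Real.log x₀ ≤ calP A x := by
  classical
  have h1 : 1 < x₀ := by linarith
  have hl : 0 < Real.log x₀ := Real.log_pos h1
  set S : Set ℕ := {p | 1 ≤ rho A p} with hS
  have h := le_sum_mul_of_le_partial_sums (c := logWeight S)
    (f := fun t => (t * Real.log t)⁻¹) (B := α) (by linarith : 0 ≤ x₀) hx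
    (fun t ht => hasDerivAt_inv_mul_log (h1.trans_le ht.1))
    (fun t ht => hasDerivAt_log_log (h1.trans_le ht.1))
    (continuousOn_deriv_inv_mul_log h1) (fun t ht => ?_) (fun t ht => ?_)
    (fun t ht => ?_)
  · simp only [inv_mul_log_mul_logWeight] at h
    have h2 : ∑ k ∈ Finset.Ioc ⌊x₀⌋₊ ⌊x⌋₊, (if Nat.Prime k ∧ k ∈ S then 1 / (k : ℝ) else 0) ≤
        ∑ p ∈ primesQ A x, 1 / (p : ℝ) := by
      rw [← Finset.sum_filter]
      refine Finset.sum_le_sum_of_subset_of_nonneg ?_ fun _ _ _ => by positivity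
      intro p
      simp only [primesQ, Finset.mem_filter, Finset.mem_Ioc, Finset.mem_Icc]
      rintro ⟨⟨h1, h2⟩, h3, h4⟩
      exact ⟨⟨h3.one_le, h2⟩, h3, h4⟩
    have h3 : (x₀ * Real.log x₀)⁻¹ * ∑ k ∈ Finset.Icc 0 ⌊x₀⌋₊, logWeight S k ≤
        Real.log 4 / Real.log x₀ := by
      refine (mul_le_mul_of_nonneg_left (sum_logWeight_le S (by linarith)) (by positivity)).trans
        (le_of_eq ?_)
      have : x₀ ≠ 0 := by linarith
      field_simp
    have h4 : α * (x₀ * (x₀ * Real.log x₀)⁻¹) = α / Real.log x₀ := by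
      have : x₀ ≠ 0 := by linarith
      field_simp
    unfold calP
    simp only [mul_add, mul_sub] at h ⊢
    rw [h4] at h
    linarith
  · have : 0 < Real.log t := Real.log_pos (h1.trans_le ht.1)
    rw [neg_div]
    have : 0 ≤ (Real.log t + 1) / (t * Real.log t) ^ 2 := by positivity
    linarith
  · have : 0 < Real.log t := Real.log_pos (h1.trans_le ht.1)
    have : 0 < t := by linarith [ht.1]
    positivity
  · refine (h t ht.1).trans (le_of_eq ?_)
    rw [primesQ, Finset.sum_filter, ← Finset.add_sum_Ioc_eq_sum_Icc (a := 0) (Nat.zero_le _)]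
    simp only [logWeight, hS, Set.mem_ofPred_eq, Nat.not_prime_zero, false_and, if_false, zero_add]
    rfl

/-! ### Selberg's upper bound sieve in arithmetic progressions. -/

/-- The squarefree integers up to `Z` that are coprime to `q`. -/
def sieveRange (q Z : ℕ) : Finset ℕ := (Finset.Icc 1 Z).filter fun d => Squarefree d ∧ d.Coprime q

theorem mem_sieveRange_of_dvd {q Z d r : ℕ} (hr : r ∈ sieveRange q Z) (h : d ∣ r) :
    d ∈ sieveRange q Z := by
  simp only [sieveRange, Finset.mem_filter, Finset.mem_Icc] at hr ⊢
  exact ⟨⟨Nat.pos_of_dvd_of_pos h hr.1.1, (Nat.le_of_dvd hr.1.1 h).trans hr.1.2⟩,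
    hr.2.1.squarefree_of_dvd h, Nat.Coprime.of_dvd_left h hr.2.2⟩

theorem pos_of_mem_sieveRange {q Z d : ℕ} (hd : d ∈ sieveRange q Z) : 0 < d := by
  simp only [sieveRange, Finset.mem_filter, Finset.mem_Icc] at hd
  exact hd.1.1

theorem one_mem_sieveRange {q Z : ℕ} (hZ : 1 ≤ Z) : 1 ∈ sieveRange q Z := by
  simp [sieveRange, hZ]

theorem sum_moebius_div_divisors (t : ℕ) :
    ∑ e ∈ t.divisors, (ArithmeticFunction.moebius (t / e) : ℝ) = if t = 1 then 1 else 0 := by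
  rw [Nat.sum_div_divisors t (fun e => (ArithmeticFunction.moebius e : ℝ))]
  have := congrArg (fun f : ArithmeticFunction ℤ => f t) ArithmeticFunction.moebius_mul_coe_zeta
  simp only [ArithmeticFunction.coe_mul_zeta_apply, ArithmeticFunction.one_apply] at this
  exact_mod_cast this

/-- Möbius inversion between `s` and `r`. It survives the truncation because `sieveRange` is closed
under divisors. -/
theorem sum_moebius_between {q Z s r : ℕ} (hr : r ∈ sieveRange q Z) (hs : 0 < s) :
    ∑ d ∈ sieveRange q Z, (if s ∣ d then if d ∣ r then
      (ArithmeticFunction.moebius (r / d) : ℝ) else 0 else 0) = if r = s then 1 else 0 := by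
  have hr0 := pos_of_mem_sieveRange hr
  by_cases hsr : s ∣ r
  · obtain ⟨t, rfl⟩ := hsr
    have ht : t ≠ 0 := by rintro rfl; simp at hr0
    have h1 : (if s * t = s then (1 : ℝ) else 0) = if t = 1 then 1 else 0 := by
      congr 1; simp [hs.ne']
    rw [h1, ← sum_moebius_div_divisors t]
    rw [← Finset.sum_subset (s₁ := t.divisors.image (s * ·)) (s₂ := sieveRange q Z)]
    · rw [Finset.sum_image fun a _ b _ h => Nat.eq_of_mul_eq_mul_left hs h]
      refine Finset.sum_congr rfl fun e he => ?_
      rw [if_pos (dvd_mul_right _ _), if_pos (Nat.mul_dvd_mul_left s (Nat.dvd_of_mem_divisors he)),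
        Nat.mul_div_mul_left _ _ hs]
    · intro d hd
      obtain ⟨e, he, rfl⟩ := Finset.mem_image.1 hd
      exact mem_sieveRange_of_dvd hr (Nat.mul_dvd_mul_left s (Nat.dvd_of_mem_divisors he))
    · intro d _ hd
      by_cases h1 : s ∣ d
      · by_cases h2 : d ∣ s * t
        · exfalso
          obtain ⟨e, rfl⟩ := h1
          exact hd (Finset.mem_image_of_mem _
            (Nat.mem_divisors.2 ⟨Nat.dvd_of_mul_dvd_mul_left hs h2, ht⟩))
        · rw [if_pos h1, if_neg h2]
      · rw [if_neg h1]
  · rw [if_neg (by rintro rfl; exact hsr dvd_rfl)]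
    refine Finset.sum_eq_zero fun d _ => ?_
    split_ifs with h1 h2
    · exact absurd (h1.trans h2) hsr
    · rfl
    · rfl

/-- The normalising sum of the sieve. -/
def sieveMass (q Z : ℕ) : ℝ := ∑ r ∈ sieveRange q Z, 1 / (r : ℝ)

theorem sieveMass_pos {q Z : ℕ} (hZ : 1 ≤ Z) : 0 < sieveMass q Z :=
  Finset.sum_pos (fun r hr => by have := pos_of_mem_sieveRange hr; positivity)
    ⟨1, one_mem_sieveRange hZ⟩

/-- The diagonalised sieve weights. -/
def sieveDiag (q Z r : ℕ) : ℝ := ArithmeticFunction.moebius r / (r * sieveMass q Z)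

/-- The sieve weights. -/
def sieveWeight (q Z d : ℕ) : ℝ :=
  d * ∑ r ∈ sieveRange q Z, if d ∣ r then
    (ArithmeticFunction.moebius (r / d) : ℝ) * sieveDiag q Z r else 0

/-- This normalisation makes the Selberg square equal to 1 on the sifted integers; the division by
`sieveMass` is chosen to achieve it. -/
theorem sieveWeight_one {q Z : ℕ} (hZ : 1 ≤ Z) : sieveWeight q Z 1 = 1 := by
  have hG := sieveMass_pos (q := q) hZ
  unfold sieveWeight sieveDiag
  simp only [Nat.cast_one, one_mul, one_dvd, if_true, Nat.div_one]
  have : ∀ r ∈ sieveRange q Z, (ArithmeticFunction.moebius r : ℝ) *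
      ((ArithmeticFunction.moebius r : ℝ) / (r * sieveMass q Z)) =
        1 / (r : ℝ) * (sieveMass q Z)⁻¹ := by
    intro r hr
    have h0 := pos_of_mem_sieveRange hr
    have h1 : Squarefree r := (Finset.mem_filter.1 hr).2.1
    have h2 : (ArithmeticFunction.moebius r : ℝ) ^ 2 = 1 := by
      exact_mod_cast ArithmeticFunction.moebius_sq_eq_one_of_squarefree h1
    rw [← mul_div_assoc, ← sq, h2]
    field_simp
  rw [Finset.sum_congr rfl this, ← Finset.sum_mul]
  exact mul_inv_cancel₀ hG.ne'

theorem abs_moebius_cast_le (m : ℕ) : |(ArithmeticFunction.moebius m : ℝ)| ≤ 1 := by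
  exact_mod_cast ArithmeticFunction.abs_moebius_le_one (n := m)

theorem abs_sieveWeight_le {q Z d : ℕ} (hZ : 1 ≤ Z) : |sieveWeight q Z d| ≤ d := by
  have hG := sieveMass_pos (q := q) hZ
  unfold sieveWeight
  rw [abs_mul, Nat.abs_cast]
  refine mul_le_of_le_one_right (by positivity) ?_
  refine (Finset.abs_sum_le_sum_abs _ _).trans ?_
  have : ∀ r ∈ sieveRange q Z, |if d ∣ r then
      (ArithmeticFunction.moebius (r / d) : ℝ) * sieveDiag q Z r else 0| ≤
        1 / (r : ℝ) * (sieveMass q Z)⁻¹ := by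
    intro r hr
    have h0 := pos_of_mem_sieveRange hr
    split_ifs
    · unfold sieveDiag
      rw [abs_mul, abs_div, abs_of_pos (by positivity : (0 : ℝ) < r * sieveMass q Z)]
      calc _ ≤ 1 * (1 / (r * sieveMass q Z)) := by
            gcongr
            · exact abs_moebius_cast_le _
            · exact abs_moebius_cast_le _
        _ = _ := by field_simp
    · rw [abs_zero]; positivity
  refine (Finset.sum_le_sum this).trans ?_
  rw [← Finset.sum_mul]
  exact (mul_inv_cancel₀ hG.ne').le

theorem sum_sieveWeight_div {q Z s : ℕ} (hs : s ∈ sieveRange q Z) :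
    ∑ d ∈ sieveRange q Z, (if s ∣ d then sieveWeight q Z d / d else 0) = sieveDiag q Z s := by
  have hs0 := pos_of_mem_sieveRange hs
  have h1 : ∀ d ∈ sieveRange q Z, (if s ∣ d then sieveWeight q Z d / d else 0) =
      ∑ r ∈ sieveRange q Z, sieveDiag q Z r * (if s ∣ d then if d ∣ r then
        (ArithmeticFunction.moebius (r / d) : ℝ) else 0 else 0) := by
    intro d hd
    have := pos_of_mem_sieveRange hd
    split_ifs with h
    · unfold sieveWeight
      rw [mul_div_cancel_left₀ _ (by positivity)]
      refine Finset.sum_congr rfl fun r _ => ?_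
      split_ifs <;> ring
    · simp
  rw [Finset.sum_congr rfl h1, Finset.sum_comm]
  simp_rw [← Finset.mul_sum]
  rw [Finset.sum_congr rfl fun r hr => by rw [sum_moebius_between hr hs0]]
  simp [hs]

/-- Writing `gcd(d, e)` as the sum of `φ(s)` over common divisors diagonalises the form into `∑ φ(s)
y_s²`, and `φ(s) ≤ s` with `|y_s| ≤ 1/(s G)` bounds it by `1/G`. The optimal choice has `y_s`
proportional to `μ(s)/φ(s)`; using `μ(s)/s` instead makes `G` a plain sum of `1/r`. -/
theorem sieve_quadratic_form_le {q Z : ℕ} (hZ : 1 ≤ Z) :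
    ∑ d ∈ sieveRange q Z, ∑ e ∈ sieveRange q Z,
      sieveWeight q Z d * sieveWeight q Z e / (d.lcm e : ℝ) ≤ 1 / sieveMass q Z := by
  have hG := sieveMass_pos (q := q) hZ
  have h1 : ∀ d ∈ sieveRange q Z, ∀ e ∈ sieveRange q Z,
      sieveWeight q Z d * sieveWeight q Z e / (d.lcm e : ℝ) =
        ∑ s ∈ sieveRange q Z, (s.totient : ℝ) * ((if s ∣ d then sieveWeight q Z d / d else 0) *
          (if s ∣ e then sieveWeight q Z e / e else 0)) := by
    intro d hd e he
    have hd0 := pos_of_mem_sieveRange hd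
    have he0 := pos_of_mem_sieveRange he
    have hg : 0 < d.gcd e := Nat.gcd_pos_of_pos_left _ hd0
    have h2 : (d.lcm e : ℝ) = d * e / (d.gcd e : ℝ) := by
      rw [eq_div_iff (by positivity)]
      have := Nat.gcd_mul_lcm d e
      rw [mul_comm]; exact_mod_cast this
    have h3 : ((d.gcd e : ℕ) : ℝ) = ∑ s ∈ (d.gcd e).divisors, (s.totient : ℝ) := by
      exact_mod_cast (Nat.sum_totient (d.gcd e)).symm
    rw [← Finset.sum_subset (s₁ := (d.gcd e).divisors)]
    · have : ∀ s ∈ (d.gcd e).divisors, (s.totient : ℝ) *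
          ((if s ∣ d then sieveWeight q Z d / d else 0) *
          (if s ∣ e then sieveWeight q Z e / e else 0)) =
            s.totient * (sieveWeight q Z d / d * (sieveWeight q Z e / e)) := by
        intro s hs
        have := Nat.dvd_of_mem_divisors hs
        rw [if_pos (this.trans (Nat.gcd_dvd_left _ _)), if_pos (this.trans (Nat.gcd_dvd_right _ _))]
      rw [Finset.sum_congr rfl this, ← Finset.sum_mul, ← h3, h2]
      field_simp
    · intro s hs
      exact mem_sieveRange_of_dvd hd ((Nat.dvd_of_mem_divisors hs).trans (Nat.gcd_dvd_left _ _))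
    · intro s _ hs
      split_ifs with h4 h5
      · exact absurd (Nat.mem_divisors.2 ⟨Nat.dvd_gcd h4 h5, hg.ne'⟩) hs
      all_goals simp
  calc _ = ∑ d ∈ sieveRange q Z, ∑ e ∈ sieveRange q Z, ∑ s ∈ sieveRange q Z,
        (s.totient : ℝ) * ((if s ∣ d then sieveWeight q Z d / d else 0) *
          (if s ∣ e then sieveWeight q Z e / e else 0)) :=
        Finset.sum_congr rfl fun d hd => Finset.sum_congr rfl fun e he => h1 d hd e he
    _ = ∑ s ∈ sieveRange q Z, (s.totient : ℝ) * sieveDiag q Z s ^ 2 := by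
        rw [Finset.sum_congr rfl fun d _ => Finset.sum_comm, Finset.sum_comm]
        refine Finset.sum_congr rfl fun s hs => ?_
        rw [sq, ← sum_sieveWeight_div hs, Finset.sum_mul_sum, Finset.mul_sum]
        refine Finset.sum_congr rfl fun d _ => ?_
        rw [Finset.mul_sum]
    _ ≤ ∑ s ∈ sieveRange q Z, 1 / (s : ℝ) * (1 / sieveMass q Z ^ 2) := by
        refine Finset.sum_le_sum fun s hs => ?_
        have h0 := pos_of_mem_sieveRange hs
        have h2 : (s.totient : ℝ) ≤ s := by exact_mod_cast Nat.totient_le s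
        have h3 : (ArithmeticFunction.moebius s : ℝ) ^ 2 ≤ 1 := by
          rw [← sq_abs]; exact pow_le_one₀ (abs_nonneg _) (abs_moebius_cast_le s)
        unfold sieveDiag
        rw [div_pow]
        calc _ ≤ (s : ℝ) * (1 / (s * sieveMass q Z) ^ 2) := by gcongr
          _ = _ := by field_simp
    _ = 1 / sieveMass q Z := by
        rw [← Finset.sum_mul]
        change sieveMass q Z * _ = _
        field_simp

/-- The Chinese remainder theorem merges the two conditions into one class modulo `q d`, and the
count is a difference of two floors. -/
theorem abs_card_modEq_dvd_sub_le {q d b M : ℕ} (hq : 0 < q) (hd : 0 < d) (h : d.Coprime q) :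
    |(((Finset.Ioc 0 M).filter fun m => m ≡ b [MOD q] ∧ d ∣ m).card : ℝ) - M / (q * d)| ≤ 1 := by
  obtain ⟨c, hc1, hc2⟩ := Nat.chineseRemainder h.symm b 0
  have h1 : ((Finset.Ioc 0 M).filter fun m => m ≡ b [MOD q] ∧ d ∣ m) =
      (Finset.Ioc 0 M).filter fun m => m ≡ c [MOD (q * d)] := by
    refine Finset.filter_congr fun m _ => ?_
    rw [← Nat.modEq_and_modEq_iff_modEq_mul h.symm, ← Nat.modEq_zero_iff_dvd]
    exact ⟨fun h => ⟨h.1.trans hc1.symm, h.2.trans hc2.symm⟩,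
      fun h => ⟨h.1.trans hc1, h.2.trans hc2⟩⟩
  have hqd : 0 < q * d := Nat.mul_pos hq hd
  have h2 := Nat.Ioc_filter_modEq_card 0 M hqd c
  rw [h1]
  set K := ((Finset.Ioc 0 M).filter fun m => m ≡ c [MOD (q * d)]).card
  set r : ℚ := ((q * d : ℕ) : ℚ) with hr
  have hr0 : 0 < r := by rw [hr]; exact_mod_cast hqd
  have e1 := Int.floor_le (((M : ℚ) - c) / r)
  have e2 := Int.lt_floor_add_one (((M : ℚ) - c) / r)
  have e3 := Int.floor_le ((((0 : ℕ) : ℚ) - c) / r)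
  have e4 := Int.lt_floor_add_one ((((0 : ℕ) : ℚ) - c) / r)
  have e5 : ((M : ℚ) - c) / r - (((0 : ℕ) : ℚ) - c) / r = M / r := by
    rw [← sub_div]; simp
  have e6 : (0 : ℚ) ≤ M / r := by positivity
  have e7 : 0 ≤ ⌊((M : ℚ) - c) / r⌋ - ⌊(((0 : ℕ) : ℚ) - c) / r⌋ := by
    rw [sub_nonneg]; exact Int.floor_mono (by linarith)
  rw [max_eq_left e7] at h2
  have h3 : (K : ℚ) = ⌊((M : ℚ) - c) / r⌋ - ⌊(((0 : ℕ) : ℚ) - c) / r⌋ := by exact_mod_cast h2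
  have h4 : |(K : ℚ) - M / (q * d)| ≤ 1 := by
    have : (M : ℚ) / (q * d) = M / r := by rw [hr]; push_cast; rfl
    rw [this, h3, abs_le]
    constructor <;> linarith
  have h5 : ((|(K : ℚ) - M / (q * d)| : ℚ) : ℝ) ≤ ((1 : ℚ) : ℝ) := by exact_mod_cast h4
  push_cast at h5
  exact h5

-- A sifted integer is divisible by no `d > 1` of the range, so the square of the weighted divisor
-- sum is 1 there and nonnegative elsewhere. Opening the square gives the quadratic form plus an
-- error of at most `Z²` for each of at most `Z²` pairs, whence `Z⁴`.
open Classical in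
theorem card_sifted_le_mass {q b M Z : ℕ} (hq : 0 < q) (hZ : 1 ≤ Z) :
    (((Finset.Ioc 0 M).filter fun m => m ≡ b [MOD q] ∧
      ∀ p, p.Prime → p ≤ Z → ¬ p ∣ q → ¬ p ∣ m).card : ℝ) ≤
        M / (q * sieveMass q Z) + (Z : ℝ) ^ 4 := by
  set T := (Finset.Ioc 0 M).filter fun m => m ≡ b [MOD q] with hT
  set w := sieveWeight q Z
  have h1 : (((Finset.Ioc 0 M).filter fun m => m ≡ b [MOD q] ∧
      ∀ p, p.Prime → p ≤ Z → ¬ p ∣ q → ¬ p ∣ m).card : ℝ) ≤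
        ∑ m ∈ T, (∑ d ∈ sieveRange q Z, if d ∣ m then w d else 0) ^ 2 := by
    rw [Finset.card_eq_sum_ones, Nat.cast_sum]
    calc _ ≤ ∑ m ∈ (Finset.Ioc 0 M).filter fun m => m ≡ b [MOD q] ∧
          ∀ p, p.Prime → p ≤ Z → ¬ p ∣ q → ¬ p ∣ m,
          (∑ d ∈ sieveRange q Z, if d ∣ m then w d else 0) ^ 2 := by
          refine Finset.sum_le_sum fun m hm => ?_
          have hm := (Finset.mem_filter.1 hm).2.2
          rw [Finset.sum_eq_single_of_mem 1 (one_mem_sieveRange hZ)]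
          · simp [w, sieveWeight_one hZ]
          · intro d hd hd1
            rw [if_neg]
            intro hdm
            simp only [sieveRange, Finset.mem_filter, Finset.mem_Icc] at hd
            have hp := Nat.minFac_prime hd1
            have hpd := Nat.minFac_dvd d
            refine hm _ hp ((Nat.le_of_dvd hd.1.1 hpd).trans hd.1.2) (fun hpq => ?_)
              (hpd.trans hdm)
            exact Nat.not_coprime_of_dvd_of_dvd hp.one_lt hpd hpq hd.2.2
      _ ≤ _ := by
          refine Finset.sum_le_sum_of_subset_of_nonneg ?_ fun _ _ _ => sq_nonneg _
          exact Finset.monotone_filter_right _ fun m _ hm => hm.1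
  refine h1.trans ?_
  have h2 : ∑ m ∈ T, (∑ d ∈ sieveRange q Z, if d ∣ m then w d else 0) ^ 2 =
      ∑ d ∈ sieveRange q Z, ∑ e ∈ sieveRange q Z, w d * w e *
        (((Finset.Ioc 0 M).filter fun m => m ≡ b [MOD q] ∧ d.lcm e ∣ m).card : ℝ) := by
    simp_rw [sq, Finset.sum_mul_sum]
    rw [Finset.sum_comm]
    refine Finset.sum_congr rfl fun d _ => ?_
    rw [Finset.sum_comm]
    refine Finset.sum_congr rfl fun e _ => ?_
    rw [← Finset.filter_filter, Finset.card_eq_sum_ones, Nat.cast_sum, Finset.mul_sum,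
      Finset.sum_filter (fun m => d.lcm e ∣ m)]
    refine Finset.sum_congr rfl fun m _ => ?_
    simp only [Nat.lcm_dvd_iff]
    split_ifs <;> simp_all
  rw [h2]
  have h3 : ∀ d ∈ sieveRange q Z, ∀ e ∈ sieveRange q Z, w d * w e *
        (((Finset.Ioc 0 M).filter fun m => m ≡ b [MOD q] ∧ d.lcm e ∣ m).card : ℝ) ≤
      M / q * (w d * w e / (d.lcm e : ℝ)) + (Z : ℝ) * Z := by
    intro d hd e he
    have hd0 := pos_of_mem_sieveRange hd
    have he0 := pos_of_mem_sieveRange he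
    have hl : 0 < d.lcm e := Nat.lcm_pos hd0 he0
    have hdc := (Finset.mem_filter.1 hd).2.2
    have hec := (Finset.mem_filter.1 he).2.2
    have hdZ : (d : ℝ) ≤ Z := by exact_mod_cast (Finset.mem_Icc.1 (Finset.mem_filter.1 hd).1).2
    have heZ : (e : ℝ) ≤ Z := by exact_mod_cast (Finset.mem_Icc.1 (Finset.mem_filter.1 he).1).2
    have hlc : (d.lcm e).Coprime q := Nat.Coprime.of_dvd_left (Nat.lcm_dvd_mul d e) (hdc.mul_left hec)
    have hcard := abs_card_modEq_dvd_sub_le (b := b) (M := M) hq hl hlc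
    set K := (((Finset.Ioc 0 M).filter fun m => m ≡ b [MOD q] ∧ d.lcm e ∣ m).card : ℝ)
    have hw : |w d * w e| ≤ Z * Z := by
      rw [abs_mul]
      exact mul_le_mul ((abs_sieveWeight_le hZ).trans hdZ) ((abs_sieveWeight_le hZ).trans heZ)
        (abs_nonneg _) (by positivity)
    have : w d * w e * K = M / q * (w d * w e / (d.lcm e : ℝ)) +
        w d * w e * (K - M / (q * (d.lcm e : ℕ))) := by
      field_simp; ring
    rw [this]
    refine add_le_add le_rfl ?_
    calc w d * w e * (K - M / (q * (d.lcm e : ℕ))) ≤ |w d * w e * (K - M / (q * (d.lcm e : ℕ)))| := le_abs_self _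
      _ = |w d * w e| * |(K - M / (q * (d.lcm e : ℕ)))| := abs_mul _ _
      _ ≤ Z * Z * 1 := by gcongr
      _ = _ := by ring
  have hcardR : ((sieveRange q Z).card : ℝ) ≤ Z := by
    have : (sieveRange q Z).card ≤ Z := (Finset.card_filter_le _ _).trans (by simp)
    exact_mod_cast this
  calc _ ≤ ∑ d ∈ sieveRange q Z, ∑ e ∈ sieveRange q Z,
        (M / q * (w d * w e / (d.lcm e : ℝ)) + (Z : ℝ) * Z) :=
        Finset.sum_le_sum fun d hd => Finset.sum_le_sum fun e he => h3 d hd e he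
    _ = M / q * (∑ d ∈ sieveRange q Z, ∑ e ∈ sieveRange q Z, w d * w e / (d.lcm e : ℝ)) +
        (sieveRange q Z).card * ((sieveRange q Z).card * ((Z : ℝ) * Z)) := by
        simp only [Finset.sum_add_distrib, Finset.mul_sum, Finset.sum_const, nsmul_eq_mul]
    _ ≤ M / q * (1 / sieveMass q Z) + Z * (Z * ((Z : ℝ) * Z)) := by
        gcongr
        exact sieve_quadratic_form_le hZ
    _ = _ := by field_simp

/-- Every `m` is `b² a` with `a` squarefree, and `a = gcd(a, q) c` with `c` coprime to `q`. Summing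
over `b` costs `ζ(2) < 2`, summing over the squarefree divisors of `q` costs the Euler product, and
`c` ranges over the sieve range. -/
theorem harmonic_le_sieveMass {q : ℕ} (hq : 0 < q) (Z : ℕ) :
    ∑ m ∈ Finset.Icc 1 Z, 1 / (m : ℝ) ≤
      2 * (∏ p ∈ q.primeFactors, (1 + 1 / (p : ℝ))) * sieveMass q Z := by
  have hex : ∀ m ∈ Finset.Icc 1 Z, ∃ x : ℕ × Finset ℕ × ℕ,
      x ∈ Finset.Icc 1 Z ×ˢ (q.primeFactors.powerset ×ˢ sieveRange q Z) ∧
      m = x.1 ^ 2 * ((∏ p ∈ x.2.1, p) * x.2.2) := by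
    intro m hm
    have hm := Finset.mem_Icc.1 hm
    obtain ⟨a, b, ha, hb, hab, hsq⟩ := Nat.sq_mul_squarefree_of_pos hm.1
    have hgs : Squarefree (a.gcd q) := hsq.squarefree_of_dvd (Nat.gcd_dvd_left _ _)
    obtain ⟨c, hc⟩ := Nat.gcd_dvd_left a q
    have hc0 : 0 < c := Nat.pos_of_ne_zero (by rintro rfl; simp at hc; omega)
    have hcs : Squarefree c := hsq.squarefree_of_dvd ⟨_, by rw [mul_comm]; exact hc⟩
    have hcop : (a.gcd q).Coprime c := Nat.coprime_of_squarefree_mul (hc ▸ hsq)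
    have hcq : c.Coprime q := by
      rw [Nat.coprime_iff_gcd_eq_one]
      have h1 : c.gcd q ∣ a.gcd q :=
        Nat.gcd_dvd_gcd_of_dvd_left q ⟨_, by rw [mul_comm]; exact hc⟩
      exact Nat.eq_one_of_dvd_coprimes hcop h1 (Nat.gcd_dvd_left _ _)
    have hbm : b ≤ m := by
      rw [← hab]; nlinarith [Nat.pos_of_ne_zero hb.ne']
    have hcm : c ≤ m := by
      have : c ∣ m := by rw [← hab, hc]; exact ⟨b ^ 2 * a.gcd q, by ring⟩
      exact Nat.le_of_dvd hm.1 this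
    refine ⟨(b, (a.gcd q).primeFactors, c), ?_, ?_⟩
    · simp only [Finset.mem_product, Finset.mem_Icc, Finset.mem_powerset, sieveRange,
        Finset.mem_filter]
      exact ⟨⟨hb, by omega⟩, Nat.primeFactors_mono (Nat.gcd_dvd_right _ _) hq.ne',
        ⟨hc0, by omega⟩, hcs, hcq⟩
    · simp only
      rw [Nat.prod_primeFactors_of_squarefree hgs, ← hc, hab]
  choose! φ hφ1 hφ2 using hex
  have hterm : ∀ m ∈ Finset.Icc 1 Z, 1 / (m : ℝ) =
      1 / ((φ m).1 : ℝ) ^ 2 * ((∏ p ∈ (φ m).2.1, 1 / (p : ℝ)) * (1 / ((φ m).2.2 : ℝ))) := by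
    intro m hm
    conv_lhs => rw [hφ2 m hm]
    push_cast
    simp only [one_div, Finset.prod_inv_distrib]
    rw [mul_inv, mul_inv]
  rw [Finset.sum_congr rfl hterm,
    ← Finset.sum_image (s := Finset.Icc 1 Z) (g := φ) (f := fun x : ℕ × Finset ℕ × ℕ =>
      1 / (x.1 : ℝ) ^ 2 * ((∏ p ∈ x.2.1, 1 / (p : ℝ)) * (1 / (x.2.2 : ℝ))))
      (fun a ha b hb h => by
        rw [hφ2 a ha, hφ2 b hb, h])]
  calc _ ≤ ∑ x ∈ Finset.Icc 1 Z ×ˢ (q.primeFactors.powerset ×ˢ sieveRange q Z),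
        1 / (x.1 : ℝ) ^ 2 * ((∏ p ∈ x.2.1, 1 / (p : ℝ)) * (1 / (x.2.2 : ℝ))) := by
        refine Finset.sum_le_sum_of_subset_of_nonneg ?_ fun _ _ _ => by positivity
        intro x hx
        obtain ⟨m, hm, rfl⟩ := Finset.mem_image.1 hx
        exact hφ1 m hm
    _ = (∑ b ∈ Finset.Icc 1 Z, 1 / (b : ℝ) ^ 2) *
        ((∏ p ∈ q.primeFactors, (1 + 1 / (p : ℝ))) * sieveMass q Z) := by
        rw [Finset.prod_one_add, sieveMass, Finset.sum_mul_sum, ← Finset.sum_product',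
          Finset.sum_mul_sum, ← Finset.sum_product']
    _ ≤ 2 * ((∏ p ∈ q.primeFactors, (1 + 1 / (p : ℝ))) * sieveMass q Z) := by
        have h0 : 0 ≤ sieveMass q Z := Finset.sum_nonneg fun _ _ => by positivity
        have h1 : 0 ≤ ∏ p ∈ q.primeFactors, (1 + 1 / (p : ℝ)) :=
          Finset.prod_nonneg fun _ _ => by positivity
        gcongr
        have h2 := hasSum_zeta_two
        have h3 : ∑ b ∈ Finset.Icc 1 Z, 1 / (b : ℝ) ^ 2 ≤ Real.pi ^ 2 / 6 := by
          rw [← h2.tsum_eq]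
          exact h2.summable.sum_le_tsum _ fun _ _ => by positivity
        have h4 := Real.pi_lt_d2
        nlinarith [Real.pi_pos]
    _ = _ := by ring

/-- Since `φ(q) ∏ (1 + 1/p) = q ∏ (1 - 1/p²) ≤ q`, discarding the primes of `q` from the sieve costs
only the factor `φ(q)/q`, which turns `M/q` into `M/φ(q)` in the final bound. -/
theorem totient_mul_log_le {q : ℕ} (hq : 0 < q) {Z : ℕ} (hZ : 1 ≤ Z) :
    (q.totient : ℝ) * Real.log Z ≤ 2 * q * sieveMass q Z := by
  have h1 : Real.log Z ≤ ∑ m ∈ Finset.Icc 1 Z, 1 / (m : ℝ) := by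
    have h := log_add_one_le_harmonic Z
    rw [harmonic_eq_sum_Icc] at h
    push_cast at h
    simp only [one_div]
    refine le_trans (Real.log_le_log (by exact_mod_cast hZ) (by linarith)) h
  have h2 := h1.trans (harmonic_le_sieveMass hq Z)
  have h3 : (q.totient : ℝ) * ∏ p ∈ q.primeFactors, (1 + 1 / (p : ℝ)) ≤ q := by
    have h := Nat.totient_eq_mul_prod_factors q
    have h' : (q.totient : ℝ) = q * ∏ p ∈ q.primeFactors, (1 - (p : ℝ)⁻¹) := by
      have := congrArg (fun t : ℚ => (t : ℝ)) h
      push_cast at this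
      exact this
    rw [h', mul_assoc, ← Finset.prod_mul_distrib]
    refine mul_le_of_le_one_right (by positivity) ?_
    refine Finset.prod_le_one (fun p hp => ?_) fun p hp => ?_
    all_goals
      have : (1 : ℝ) ≤ p := by exact_mod_cast (Nat.prime_of_mem_primeFactors hp).one_le
      have h5 : (p : ℝ)⁻¹ ≤ 1 := inv_le_one_of_one_le₀ this
      have h6 : 0 ≤ (p : ℝ)⁻¹ := by positivity
      rw [one_div]
    · exact mul_nonneg (by linarith) (by linarith)
    · nlinarith
  have h4 := (sieveMass_pos (q := q) hZ).le
  calc _ ≤ (q.totient : ℝ) * (2 * (∏ p ∈ q.primeFactors, (1 + 1 / (p : ℝ))) * sieveMass q Z) := by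
        gcongr
    _ = 2 * ((q.totient : ℝ) * (∏ p ∈ q.primeFactors, (1 + 1 / (p : ℝ)))) * sieveMass q Z := by
        ring
    _ ≤ _ := by gcongr

open Classical in
theorem card_sifted_le {q b M Z : ℕ} (hq : 0 < q) (hZ : 2 ≤ Z) :
    (((Finset.Ioc 0 M).filter fun m => m ≡ b [MOD q] ∧
      ∀ p, p.Prime → p ≤ Z → ¬ p ∣ q → ¬ p ∣ m).card : ℝ) ≤
        2 * M / (q.totient * Real.log Z) + (Z : ℝ) ^ 4 := by
  refine (card_sifted_le_mass hq (by omega)).trans ?_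
  have hl : 0 < Real.log Z := Real.log_pos (by exact_mod_cast hZ)
  have ht : (0 : ℝ) < q.totient := by exact_mod_cast Nat.totient_pos.2 hq
  have hG := sieveMass_pos (q := q) (by omega : 1 ≤ Z)
  have h := totient_mul_log_le hq (by omega : 1 ≤ Z)
  gcongr ?_ + _
  rw [div_le_div_iff₀ (by positivity) (by positivity)]
  calc (M : ℝ) * (q.totient * Real.log Z) ≤ M * (2 * q * sieveMass q Z) := by gcongr
    _ = _ := by ring

/-! ### Chinese remainder structure and Weyl sums. -/

/-- `A_q` as a finite set. -/
def crtFinset (A : Family n) (q : ℕ) [NeZero q] : Finset (Fin n → ZMod q) :=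
  (Set.toFinite (crtSet A q)).toFinset

@[simp] theorem mem_crtFinset {A : Family n} {q : ℕ} [NeZero q] {x : Fin n → ZMod q} :
    x ∈ crtFinset A q ↔ x ∈ crtSet A q := by simp [crtFinset]

theorem card_crtFinset (A : Family n) (q : ℕ) [NeZero q] : (crtFinset A q).card = rho A q :=
  (Set.ncard_eq_toFinset_card _ _).symm

/-- Reduction of vectors modulo a divisor. -/
def redVec {q d : ℕ} (h : d ∣ q) (x : Fin n → ZMod q) : Fin n → ZMod d :=
  fun i => ZMod.castHom h (ZMod d) (x i)

theorem redVec_redVec {q d e : ℕ} (h : d ∣ q) (h' : e ∣ d) (x : Fin n → ZMod q) :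
    redVec h' (redVec h x) = redVec (h'.trans h) x := by
  funext i
  exact congrFun (congrArg DFunLike.coe (ZMod.castHom_comp h' h)) (x i)

theorem mem_crtSet_iff {A : Family n} {q : ℕ} {x : Fin n → ZMod q} :
    x ∈ crtSet A q ↔ ∀ p ∈ q.primeFactors, ∀ e (he : p ^ e ∣ q), q.factorization p = e →
      redVec he x ∈ A (p ^ e) := by
  constructor
  · rintro h p hp e he rfl
    exact h p hp
  · intro h p hp
    exact h p hp _ (Nat.ordProj_dvd q p) rfl

theorem mem_crtSet_mul_iff {A : Family n} {r s : ℕ} (hr : r ≠ 0) (hs : s ≠ 0) (h : r.Coprime s)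
    {x : Fin n → ZMod (r * s)} : x ∈ crtSet A (r * s) ↔
      redVec (dvd_mul_right r s) x ∈ crtSet A r ∧ redVec (dvd_mul_left s r) x ∈ crtSet A s := by
  have hfr : ∀ p ∈ r.primeFactors, (r * s).factorization p = r.factorization p := fun p hp =>
    Nat.factorization_eq_of_coprime_left h (by simpa using hp)
  have hfs : ∀ p ∈ s.primeFactors, (r * s).factorization p = s.factorization p := fun p hp => by
    rw [mul_comm]
    exact Nat.factorization_eq_of_coprime_left h.symm (by simpa using hp)
  simp only [mem_crtSet_iff, Nat.primeFactors_mul hr hs, Finset.mem_union]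
  constructor
  · intro H
    refine ⟨fun p hp e he hpe => ?_, fun p hp e he hpe => ?_⟩
    · rw [redVec_redVec]
      exact H p (Or.inl hp) e _ ((hfr p hp).trans hpe)
    · rw [redVec_redVec]
      exact H p (Or.inr hp) e _ ((hfs p hp).trans hpe)
  · rintro ⟨H1, H2⟩ p (hp | hp) e he hpe
    · have hpe' := (hfr p hp).symm.trans hpe
      have := H1 p hp e (hpe' ▸ Nat.ordProj_dvd r p) hpe'
      rwa [redVec_redVec] at this
    · have hpe' := (hfs p hp).symm.trans hpe
      have := H2 p hp e (hpe' ▸ Nat.ordProj_dvd s p) hpe'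
      rwa [redVec_redVec] at this

theorem chineseRemainder_fst {r s : ℕ} (h : r.Coprime s) (x : ZMod (r * s)) :
    (ZMod.chineseRemainder h x).1 = ZMod.castHom (dvd_mul_right r s) (ZMod r) x :=
  congrFun (congrArg DFunLike.coe (RingHom.ext_zmod
    ((RingHom.fst _ _).comp (ZMod.chineseRemainder h : ZMod (r * s) →+* ZMod r × ZMod s))
    (ZMod.castHom (dvd_mul_right r s) (ZMod r)))) x

theorem chineseRemainder_snd {r s : ℕ} (h : r.Coprime s) (x : ZMod (r * s)) :
    (ZMod.chineseRemainder h x).2 = ZMod.castHom (dvd_mul_left s r) (ZMod s) x :=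
  congrFun (congrArg DFunLike.coe (RingHom.ext_zmod
    ((RingHom.snd _ _).comp (ZMod.chineseRemainder h : ZMod (r * s) →+* ZMod r × ZMod s))
    (ZMod.castHom (dvd_mul_left s r) (ZMod s)))) x

/-- For coprime `r` and `s`, the pair of reductions identifies `A_{rs}` with `A_r × A_s`. Every
multiplicativity statement below rests on this. -/
theorem sum_crtFinset_mul (A : Family n) {r s : ℕ} [NeZero r] [NeZero s] (h : r.Coprime s)
    (F : (Fin n → ZMod r) → ℂ) (G : (Fin n → ZMod s) → ℂ) :
    ∑ x ∈ crtFinset A (r * s), F (redVec (dvd_mul_right r s) x) * G (redVec (dvd_mul_left s r) x) =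
      (∑ x ∈ crtFinset A r, F x) * ∑ y ∈ crtFinset A s, G y := by
  rw [Finset.sum_mul_sum, ← Finset.sum_product']
  refine Finset.sum_bij
    (fun x _ => (redVec (dvd_mul_right r s) x, redVec (dvd_mul_left s r) x)) ?_ ?_ ?_ ?_
  · intro x hx
    rw [mem_crtFinset, mem_crtSet_mul_iff (NeZero.ne r) (NeZero.ne s) h] at hx
    simpa using hx
  · intro x _ y _ hxy
    simp only [Prod.mk.injEq] at hxy
    funext i
    apply (ZMod.chineseRemainder h).injective
    refine Prod.ext ?_ ?_
    · rw [chineseRemainder_fst, chineseRemainder_fst]; exact congrFun hxy.1 i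
    · rw [chineseRemainder_snd, chineseRemainder_snd]; exact congrFun hxy.2 i
  · rintro ⟨y, z⟩ hyz
    simp only [Finset.mem_product, mem_crtFinset] at hyz
    have h1 : redVec (dvd_mul_right r s)
        (fun i => (ZMod.chineseRemainder h).symm (y i, z i)) = y := by
      funext i
      rw [redVec, ← chineseRemainder_fst h, RingEquiv.apply_symm_apply]
    have h2 : redVec (dvd_mul_left s r)
        (fun i => (ZMod.chineseRemainder h).symm (y i, z i)) = z := by
      funext i
      rw [redVec, ← chineseRemainder_snd h, RingEquiv.apply_symm_apply]
    refine ⟨fun i => (ZMod.chineseRemainder h).symm (y i, z i), ?_, by rw [h1, h2]⟩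
    rw [mem_crtFinset, mem_crtSet_mul_iff (NeZero.ne r) (NeZero.ne s) h, h1, h2]
    exact hyz
  · intro x _; rfl

theorem rho_mul (A : Family n) {r s : ℕ} (hr : r ≠ 0) (hs : s ≠ 0) (h : r.Coprime s) :
    rho A (r * s) = rho A r * rho A s := by
  have : NeZero r := ⟨hr⟩
  have : NeZero s := ⟨hs⟩
  have := sum_crtFinset_mul A h (fun _ => 1) (fun _ => 1)
  simp only [mul_one, Finset.sum_const, card_crtFinset, nsmul_eq_mul] at this
  exact_mod_cast this

theorem rho_one (A : Family n) : rho A 1 = 1 := by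
  have : crtSet A 1 = Set.univ := by
    ext x; simp [crtSet]
  rw [rho, this, Set.ncard_univ, Nat.card_unique]

theorem one_le_rho_of_mul (A : Family n) {r s : ℕ} (hr : r ≠ 0) (hs : s ≠ 0) (h : r.Coprime s) :
    1 ≤ rho A (r * s) ↔ 1 ≤ rho A r ∧ 1 ≤ rho A s := by
  rw [rho_mul A hr hs h]
  constructor
  · intro H
    exact ⟨Nat.pos_of_ne_zero (by rintro h0; simp [h0] at H),
      Nat.pos_of_ne_zero (by rintro h0; simp [h0] at H)⟩
  · rintro ⟨h1, h2⟩
    exact Nat.mul_pos h1 h2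

/-- The normalised Weyl sum. -/
def weyl (A : Family n) (q : ℕ) [NeZero q] (h : Fin n → ZMod q) : ℂ :=
  (rho A q : ℂ)⁻¹ * ∑ a ∈ crtFinset A q, ZMod.stdAddChar (∑ i, h i * a i)

theorem norm_weyl_le_one (A : Family n) (q : ℕ) [NeZero q] (h : Fin n → ZMod q) :
    ‖weyl A q h‖ ≤ 1 := by
  unfold weyl
  rw [norm_mul, norm_inv, Complex.norm_natCast]
  have : ‖∑ a ∈ crtFinset A q, (ZMod.stdAddChar (∑ i, h i * a i) : ℂ)‖ ≤ rho A q := by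
    refine (norm_sum_le _ _).trans ?_
    simp [AddChar.norm_apply, card_crtFinset]
  exact inv_mul_le_one_of_le₀ this (by positivity)

/-- A Bézout relation `u r + v s = 1` gives `1/(rs) = v/r + u/s`, where `v` inverts `s` modulo `r`
and `u` inverts `r` modulo `s`. -/
theorem stdAddChar_mul {r s : ℕ} [NeZero r] [NeZero s] (h : r.Coprime s) (x : ZMod (r * s)) :
    (ZMod.stdAddChar x : ℂ) =
      ZMod.stdAddChar ((s : ZMod r)⁻¹ * ZMod.castHom (dvd_mul_right r s) (ZMod r) x) *
      ZMod.stdAddChar ((r : ZMod s)⁻¹ * ZMod.castHom (dvd_mul_left s r) (ZMod s) x) := by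
  obtain ⟨j, rfl⟩ := ZMod.intCast_surjective x
  obtain ⟨u, v, huv⟩ := (Nat.isCoprime_iff_coprime.2 h)
  have h1 : ((s : ZMod r)⁻¹) = ((v : ℤ) : ZMod r) := by
    have h3 : (s : ZMod r) * (s : ZMod r)⁻¹ = 1 := ZMod.coe_mul_inv_eq_one s h.symm
    have h2 : ((v : ℤ) : ZMod r) * (s : ZMod r) = 1 := by
      have := congrArg (fun t : ℤ => (t : ZMod r)) huv
      simpa using this
    calc _ = (((v : ℤ) : ZMod r) * (s : ZMod r)) * (s : ZMod r)⁻¹ := by rw [h2, one_mul]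
      _ = _ := by rw [mul_assoc, h3, mul_one]
  have h1' : ((r : ZMod s)⁻¹) = ((u : ℤ) : ZMod s) := by
    have h3 : (r : ZMod s) * (r : ZMod s)⁻¹ = 1 := ZMod.coe_mul_inv_eq_one r h
    have h2 : ((u : ℤ) : ZMod s) * (r : ZMod s) = 1 := by
      have := congrArg (fun t : ℤ => (t : ZMod s)) huv
      simpa using this
    calc _ = (((u : ℤ) : ZMod s) * (r : ZMod s)) * (r : ZMod s)⁻¹ := by rw [h2, one_mul]
      _ = _ := by rw [mul_assoc, h3, mul_one]
  rw [h1, h1', map_intCast (ZMod.castHom (dvd_mul_right r s) (ZMod r)),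
    map_intCast (ZMod.castHom (dvd_mul_left s r) (ZMod s)), ← Int.cast_mul, ← Int.cast_mul, ZMod.stdAddChar_coe,
    ZMod.stdAddChar_coe, ZMod.stdAddChar_coe, ← Complex.exp_add]
  congr 1
  have hr : (r : ℂ) ≠ 0 := by exact_mod_cast NeZero.ne r
  have hs : (s : ℂ) ≠ 0 := by exact_mod_cast NeZero.ne s
  have huv' : (u : ℂ) * r + v * s = 1 := by exact_mod_cast huv
  push_cast
  field_simp
  linear_combination (-(j : ℂ)) * huv'

theorem weyl_mul (A : Family n) {r s : ℕ} [NeZero r] [NeZero s] (h : r.Coprime s)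
    (c : Fin n → ZMod (r * s)) :
    weyl A (r * s) c = weyl A r (fun i => (s : ZMod r)⁻¹ * redVec (dvd_mul_right r s) c i) *
      weyl A s (fun i => (r : ZMod s)⁻¹ * redVec (dvd_mul_left s r) c i) := by
  unfold weyl
  rw [rho_mul A (NeZero.ne r) (NeZero.ne s) h, mul_mul_mul_comm, ← sum_crtFinset_mul A h]
  push_cast
  rw [mul_inv]
  congr 1
  refine Finset.sum_congr rfl fun x _ => ?_
  rw [stdAddChar_mul h, map_sum, map_sum, Finset.mul_sum, Finset.mul_sum]
  simp only [redVec, map_mul, mul_assoc]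

/-- All cancellation is taken from the factor at `r`; after this step `s` matters only through its
class modulo `r`, over which the sieve can average. -/
theorem norm_weyl_mul_le (A : Family n) {r s : ℕ} [NeZero r] [NeZero s] (h : r.Coprime s)
    (c : Fin n → ℤ) :
    ‖weyl A (r * s) (fun i => (c i : ZMod (r * s)))‖ ≤
      ‖weyl A r (fun i => (s : ZMod r)⁻¹ * (c i : ZMod r))‖ := by
  rw [weyl_mul A h, norm_mul]
  simp only [redVec, map_intCast]
  exact mul_le_of_le_one_right (norm_nonneg _) (norm_weyl_le_one _ _ _)

/-- The sum of the Weyl sums over the unit multiples of a frequency. -/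
def unitSum (A : Family n) (c : Fin n → ℤ) (q : ℕ) : ℝ :=
  if hq : q = 0 then 0 else
    haveI : NeZero q := ⟨hq⟩
    ∑ b : (ZMod q)ˣ, ‖weyl A q (fun i => (b : ZMod q) * (c i : ZMod q))‖

theorem unitSum_eq (A : Family n) (c : Fin n → ℤ) (q : ℕ) [NeZero q] :
    unitSum A c q = ∑ b : (ZMod q)ˣ, ‖weyl A q (fun i => (b : ZMod q) * (c i : ZMod q))‖ := by
  rw [unitSum, dif_neg (NeZero.ne q)]

theorem unitSum_nonneg (A : Family n) (c : Fin n → ℤ) (q : ℕ) : 0 ≤ unitSum A c q := by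
  unfold unitSum
  split_ifs
  · rfl
  · exact Finset.sum_nonneg fun _ _ => norm_nonneg _

theorem unitSum_le (A : Family n) (c : Fin n → ℤ) (q : ℕ) : unitSum A c q ≤ q.totient := by
  by_cases hq : q = 0
  · simp [unitSum, hq]
  · have : NeZero q := ⟨hq⟩
    rw [unitSum_eq]
    refine (Finset.sum_le_sum fun b _ => norm_weyl_le_one _ _ _).trans ?_
    simp [ZMod.card_units_eq_totient]

/-- Single Weyl sums are multiplicative only up to the twists by `s⁻¹` and `r⁻¹`. These twists
permute the units, so they disappear once one sums over all unit multiples. -/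
theorem unitSum_mul (A : Family n) (c : Fin n → ℤ) {r s : ℕ} (h : r.Coprime s) :
    unitSum A c (r * s) = unitSum A c r * unitSum A c s := by
  by_cases hr : r = 0
  · simp [unitSum, hr]
  by_cases hs : s = 0
  · simp [unitSum, hs]
  have : NeZero r := ⟨hr⟩
  have : NeZero s := ⟨hs⟩
  rw [unitSum_eq, unitSum_eq, unitSum_eq]
  set us := ZMod.unitOfCoprime s h.symm with hus
  set ur := ZMod.unitOfCoprime r h with hur
  rw [← Equiv.sum_comp (Equiv.mulLeft us⁻¹)
      (fun b : (ZMod r)ˣ => ‖weyl A r (fun i => (b : ZMod r) * (c i : ZMod r))‖),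
    ← Equiv.sum_comp (Equiv.mulLeft ur⁻¹)
      (fun b : (ZMod s)ˣ => ‖weyl A s (fun i => (b : ZMod s) * (c i : ZMod s))‖),
    Finset.sum_mul_sum, ← Fintype.sum_prod_type']
  set E : (ZMod (r * s))ˣ ≃ (ZMod r)ˣ × (ZMod s)ˣ :=
    ((Units.mapEquiv (ZMod.chineseRemainder h).toMulEquiv).trans MulEquiv.prodUnits).toEquiv
    with hE
  rw [← Equiv.sum_comp E]
  refine Finset.sum_congr rfl fun b _ => ?_
  have e1 : ((E b).1 : ZMod r) = ZMod.castHom (dvd_mul_right r s) (ZMod r) (b : ZMod (r * s)) := by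
    rw [← chineseRemainder_fst h]; rfl
  have e2 : ((E b).2 : ZMod s) = ZMod.castHom (dvd_mul_left s r) (ZMod s) (b : ZMod (r * s)) := by
    rw [← chineseRemainder_snd h]; rfl
  have e3 : ((us⁻¹ : (ZMod r)ˣ) : ZMod r) = (s : ZMod r)⁻¹ := by
    rw [← ZMod.inv_coe_unit, hus, ZMod.coe_unitOfCoprime]
  have e4 : ((ur⁻¹ : (ZMod s)ˣ) : ZMod s) = (r : ZMod s)⁻¹ := by
    rw [← ZMod.inv_coe_unit, hur, ZMod.coe_unitOfCoprime]
  rw [weyl_mul A h, norm_mul]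
  simp only [Equiv.coe_mulLeft, Units.val_mul, e1, e2, e3, e4, redVec, map_mul, map_intCast,
    mul_assoc]

/-- The average of the Weyl sums over the unit multiples of a frequency. -/
def unitAvg (A : Family n) (c : Fin n → ℤ) (q : ℕ) : ℝ := unitSum A c q / q.totient

theorem unitAvg_nonneg (A : Family n) (c : Fin n → ℤ) (q : ℕ) : 0 ≤ unitAvg A c q :=
  div_nonneg (unitSum_nonneg _ _ _) (by positivity)

theorem unitAvg_le_one (A : Family n) (c : Fin n → ℤ) (q : ℕ) : unitAvg A c q ≤ 1 :=
  div_le_one_of_le₀ (unitSum_le _ _ _) (by positivity)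

theorem unitAvg_mul (A : Family n) (c : Fin n → ℤ) {r s : ℕ} (h : r.Coprime s) :
    unitAvg A c (r * s) = unitAvg A c r * unitAvg A c s := by
  unfold unitAvg
  rw [unitSum_mul A c h, Nat.totient_mul h]
  push_cast
  rw [mul_div_mul_comm]

theorem weyl_zero (A : Family n) (q : ℕ) [NeZero q] (h : 1 ≤ rho A q) :
    weyl A q (fun _ => 0) = 1 := by
  have : (rho A q : ℂ) ≠ 0 := by exact_mod_cast (by omega : rho A q ≠ 0)
  simp [weyl, card_crtFinset, this]

theorem lam_le_rho (A : Family n) (p : ℕ) [NeZero p] : lam A p ≤ rho A p := by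
  refine csSup_le' ?_
  rintro N ⟨h, -, a, rfl⟩
  exact Set.ncard_le_ncard Set.inter_subset_right (Set.toFinite _)

theorem card_hyperplane_le_lam (A : Family n) (p : ℕ) [NeZero p] (h : Fin n → ZMod p)
    (hh : h ≠ 0) (a : ZMod p) : (hyperplane p h a ∩ crtSet A p).ncard ≤ lam A p := by
  refine le_csSup ⟨rho A p, ?_⟩ ⟨h, hh, a, rfl⟩
  rintro N ⟨h, -, a, rfl⟩
  exact Set.ncard_le_ncard Set.inter_subset_right (Set.toFinite _)

/-- Plancherel: opening the square and summing over `b` leaves `p` times the number of pairs with `c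
· a = c · a'`. For fixed `a`, the admissible `a'` lie on one hyperplane, hence number at most
`λ(p)`. -/
theorem sum_norm_weyl_sq_le (A : Family n) (p : ℕ) [NeZero p] (c : Fin n → ZMod p) (hc : c ≠ 0)
    (hρ : 1 ≤ rho A p) :
    ∑ b : ZMod p, ‖weyl A p (fun i => b * c i)‖ ^ 2 ≤ p * ((lam A p : ℝ) / rho A p) := by
  classical
  set S := crtFinset A p
  set t : (Fin n → ZMod p) → ZMod p := fun a => ∑ i, c i * a i with ht
  have h1 : ∀ b : ZMod p, ((‖weyl A p (fun i => b * c i)‖ ^ 2 : ℝ) : ℂ) =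
      ((rho A p : ℂ)⁻¹) ^ 2 * ∑ a ∈ S, ∑ a' ∈ S, ZMod.stdAddChar (b * (t a - t a')) := by
    intro b
    have e : ∀ a : Fin n → ZMod p, ∑ i, b * c i * a i = b * t a := by
      intro a; rw [ht, Finset.mul_sum]; simp only [mul_assoc]
    push_cast
    rw [← Complex.mul_conj']
    unfold weyl
    simp only [e, map_mul, map_inv₀, Complex.conj_natCast, map_sum]
    rw [mul_mul_mul_comm, ← sq, Finset.sum_mul_sum]
    congr 1
    refine Finset.sum_congr rfl fun a _ => Finset.sum_congr rfl fun a' _ => ?_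
    rw [← AddChar.map_neg_eq_conj, ← AddChar.map_add_eq_mul]
    congr 1; ring
  have h2 : ((∑ b : ZMod p, ‖weyl A p (fun i => b * c i)‖ ^ 2 : ℝ) : ℂ) =
      ((((rho A p : ℝ)⁻¹) ^ 2 * ∑ a ∈ S, ((S.filter fun a' => t a' = t a).card : ℝ) * p : ℝ) : ℂ) := by
    push_cast
    have h1' := fun b => h1 b
    push_cast at h1'
    simp_rw [h1']
    rw [← Finset.mul_sum, Finset.sum_comm]
    congr 1
    refine Finset.sum_congr rfl fun a _ => ?_
    rw [Finset.sum_comm]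
    simp_rw [AddChar.sum_mulShift _ (ZMod.isPrimitive_stdAddChar p), ZMod.card]
    rw [Finset.card_filter]
    push_cast
    rw [Finset.sum_mul]
    refine Finset.sum_congr rfl fun a' _ => ?_
    by_cases hh : t a' = t a
    · simp [hh]
    · have : ¬ t a - t a' = 0 := fun h => hh (sub_eq_zero.1 h).symm
      simp [hh, this]
  have h3 := Complex.ofReal_injective h2
  rw [h3]
  have hρ' : (0 : ℝ) < rho A p := by exact_mod_cast hρ
  have h4 : ∀ a ∈ S, ((S.filter fun a' => t a' = t a).card : ℝ) * p ≤ lam A p * p := by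
    intro a _
    gcongr
    refine le_trans (le_of_eq ?_) (card_hyperplane_le_lam A p c hc (t a))
    rw [Set.ncard_eq_toFinset_card']
    congr 1
    ext x
    simp only [Finset.mem_filter, Set.mem_toFinset, Set.mem_inter_iff, S, mem_crtFinset]
    exact and_comm
  calc _ ≤ ((rho A p : ℝ)⁻¹) ^ 2 * ∑ a ∈ S, (lam A p * p : ℝ) := by
        exact mul_le_mul_of_nonneg_left (Finset.sum_le_sum h4) (by positivity)
    _ = _ := by
        rw [Finset.sum_const, nsmul_eq_mul, card_crtFinset]
        field_simp

/-- The term `b = 0` of the second moment equals 1, and `p L - 1 ≤ (p - 1) L` because `L = λ(p)/ρ(p)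
≤ 1`. Cauchy–Schwarz over the `p - 1` units then gives `√L` with no loss of constant. -/
theorem unitAvg_prime_le (A : Family n) (c : Fin n → ℤ) {p : ℕ} (hp : p.Prime)
    (hc : ∃ i, ¬ (p : ℤ) ∣ c i) (hρ : 1 ≤ rho A p) :
    unitAvg A c p ≤ Real.sqrt ((lam A p : ℝ) / rho A p) := by
  have : NeZero p := ⟨hp.ne_zero⟩
  have : Fact p.Prime := ⟨hp⟩
  set c' : Fin n → ZMod p := fun i => (c i : ZMod p)
  have hc' : c' ≠ 0 := by
    obtain ⟨i, hi⟩ := hc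
    intro h
    exact hi ((ZMod.intCast_zmod_eq_zero_iff_dvd _ _).1 (congrFun h i))
  have h1 := sum_norm_weyl_sq_le A p c' hc' hρ
  set L : ℝ := (lam A p : ℝ) / rho A p
  have hρ' : (0 : ℝ) < rho A p := by exact_mod_cast hρ
  have hL : L ≤ 1 := div_le_one_of_le₀ (by exact_mod_cast lam_le_rho A p) hρ'.le
  have hL0 : 0 ≤ L := by positivity
  have h2 : ∑ b : (ZMod p)ˣ, ‖weyl A p (fun i => (b : ZMod p) * c' i)‖ ^ 2 + 1 ≤ p * L := by
    refine le_trans (le_of_eq ?_) h1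
    rw [← Finset.sum_erase_add _ _ (Finset.mem_univ (0 : ZMod p))]
    congr 1
    · symm
      refine Finset.sum_bij' (fun b hb => Units.mk0 b (Finset.ne_of_mem_erase hb))
        (fun u _ => (u : ZMod p)) ?_ ?_ ?_ ?_ ?_
      · simp
      · intro u _; simp
      · intro b _; rfl
      · intro u _; ext; rfl
      · intro b _; rfl
    · simp [weyl_zero A p hρ]
  have hp1 : (1 : ℝ) < p := by exact_mod_cast hp.one_lt
  have htot : (p.totient : ℝ) = p - 1 := by
    rw [Nat.totient_prime hp, Nat.cast_sub hp.one_le]; simp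
  refine Real.le_sqrt_of_sq_le ?_
  unfold unitAvg
  rw [unitSum_eq, div_pow, htot, div_le_iff₀ (by nlinarith)]
  calc (∑ b : (ZMod p)ˣ, ‖weyl A p (fun i => (b : ZMod p) * c' i)‖) ^ 2
      ≤ (Finset.univ : Finset (ZMod p)ˣ).card *
          ∑ b : (ZMod p)ˣ, ‖weyl A p (fun i => (b : ZMod p) * c' i)‖ ^ 2 := sq_sum_le_card_mul_sum_sq
    _ ≤ (p - 1) * ((p - 1) * L) := by
        rw [Finset.card_univ, ZMod.card_units_eq_totient, htot]
        gcongr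
        nlinarith
    _ = _ := by ring

theorem unitAvg_eq_prod (A : Family n) (c : Fin n → ℤ) {q : ℕ} (hq : q ≠ 0) :
    unitAvg A c q = ∏ p ∈ q.primeFactors, unitAvg A c (p ^ q.factorization p) := by
  have h1 : unitAvg A c 1 = 1 := by
    have : (fun i => (((1 : (ZMod 1)ˣ) : ZMod 1) * (c i : ZMod 1))) = fun _ => 0 := by
      funext i; exact Subsingleton.elim _ _
    rw [unitAvg, unitSum_eq, Fintype.sum_subsingleton _ 1, this,
      weyl_zero A 1 (rho_one A).ge]
    simp
  rw [Nat.multiplicative_factorization (unitAvg A c) (fun x y h => unitAvg_mul A c h) h1 hq]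
  rfl

/-! ### The Fejér kernel and the Erdős–Turán inequality for boxes. -/

/-- The complex exponential `exp (2πix)`. -/
def expCircle (x : ℝ) : ℂ := Complex.exp (2 * Real.pi * Complex.I * x)

theorem expCircle_add (x y : ℝ) : expCircle (x + y) = expCircle x * expCircle y := by
  unfold expCircle; rw [← Complex.exp_add]; push_cast; ring_nf

theorem norm_expCircle (x : ℝ) : ‖expCircle x‖ = 1 := by
  unfold expCircle
  rw [show 2 * (Real.pi : ℂ) * Complex.I * x = ((2 * Real.pi * x : ℝ) : ℂ) * Complex.I by
    push_cast; ring]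
  exact Complex.norm_exp_ofReal_mul_I _

theorem conj_expCircle (x : ℝ) : (starRingEnd ℂ) (expCircle x) = expCircle (-x) := by
  unfold expCircle
  rw [← Complex.exp_conj]
  congr 1
  simp [Complex.conj_ofReal, map_ofNat]

theorem continuous_expCircle : Continuous expCircle := by
  unfold expCircle; fun_prop

theorem expCircle_int (m : ℤ) : expCircle m = 1 := by
  unfold expCircle
  rw [show 2 * (Real.pi : ℂ) * Complex.I * ((m : ℝ) : ℂ) = m * (2 * Real.pi * Complex.I) by
    push_cast; ring]
  exact Complex.exp_int_mul_two_pi_mul_I m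

theorem integral_expCircle {m : ℤ} (hm : m ≠ 0) (a b : ℝ) :
    ∫ y in a..b, expCircle (m * y) =
      (expCircle (m * b) - expCircle (m * a)) / (2 * Real.pi * Complex.I * m) := by
  have hc : (2 * Real.pi * Complex.I * m : ℂ) ≠ 0 := by
    have : (m : ℂ) ≠ 0 := by exact_mod_cast hm
    have := Real.pi_ne_zero
    simp [*]
  have := integral_exp_mul_complex (a := a) (b := b) hc
  have e : ∀ y : ℝ, expCircle (m * y) = Complex.exp (2 * Real.pi * Complex.I * m * y) := by
    intro y; unfold expCircle; push_cast; ring_nf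
  simp_rw [e]
  exact this

theorem norm_integral_expCircle_le {m : ℤ} (hm : m ≠ 0) (a b : ℝ) :
    ‖∫ y in a..b, expCircle (m * y)‖ ≤ 1 / |(m : ℝ)| := by
  rw [integral_expCircle hm, norm_div]
  have hm' : 0 < |(m : ℝ)| := abs_pos.2 (by exact_mod_cast hm)
  have h1 : ‖(2 * Real.pi * Complex.I * m : ℂ)‖ = 2 * Real.pi * |(m : ℝ)| := by
    simp [abs_of_pos Real.pi_pos]
  rw [h1, div_le_div_iff₀ (by have := Real.pi_pos; positivity) hm']
  have h2 : ‖expCircle (m * b) - expCircle (m * a)‖ ≤ 2 := by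
    refine (norm_sub_le _ _).trans ?_
    rw [norm_expCircle, norm_expCircle]; norm_num
  have := Real.pi_gt_three
  nlinarith

/-- The Fejér kernel. -/
def fejer (N : ℕ) (s : ℝ) : ℝ := ‖∑ j ∈ Finset.range N, expCircle (j * s)‖ ^ 2 / N

theorem fejer_nonneg (N : ℕ) (s : ℝ) : 0 ≤ fejer N s := by unfold fejer; positivity

theorem continuous_fejer (N : ℕ) : Continuous (fejer N) := by
  unfold fejer
  have := continuous_expCircle
  fun_prop

theorem fejer_eq (N : ℕ) (s : ℝ) : (fejer N s : ℂ) =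
    ∑ x ∈ Finset.range N ×ˢ Finset.range N,
      (N : ℂ)⁻¹ * expCircle ((((x.1 : ℤ) - x.2 : ℤ) : ℝ) * s) := by
  unfold fejer
  rw [Complex.ofReal_div, Complex.ofReal_pow, Complex.ofReal_natCast, ← Complex.mul_conj', map_sum, Finset.sum_mul_sum, ← Finset.sum_product', div_eq_inv_mul,
    Finset.mul_sum]
  refine Finset.sum_congr rfl fun x _ => ?_
  rw [conj_expCircle, ← expCircle_add]
  push_cast
  ring_nf

/-- The Fourier coefficients of the Fejér kernel convolved with the indicator of `[a, b]`. -/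
def fejerCoeff (N : ℕ) (a b : ℝ) (m : ℤ) : ℂ :=
  (((Finset.range N ×ˢ Finset.range N).filter fun x => (x.1 : ℤ) - x.2 = m).card : ℂ) / N *
    ∫ y in a..b, expCircle (((-m : ℤ) : ℝ) * y)

theorem integral_fejer (N : ℕ) (a b t : ℝ) :
    ((∫ y in a..b, fejer N (t - y) : ℝ) : ℂ) =
      ∑ m ∈ Finset.Icc (-N : ℤ) N, fejerCoeff N a b m * expCircle (m * t) := by
  have hcont : ∀ m : ℤ, Continuous fun y : ℝ => expCircle (m * y) := fun m => by
    have := continuous_expCircle; fun_prop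
  rw [← intervalIntegral.integral_ofReal]
  simp_rw [fejer_eq]
  rw [intervalIntegral.integral_finsetSum]
  · rw [← Finset.sum_fiberwise_of_maps_to (t := Finset.Icc (-N : ℤ) N)
      (g := fun x : ℕ × ℕ => (x.1 : ℤ) - x.2)]
    · refine Finset.sum_congr rfl fun m _ => ?_
      have : ∀ x ∈ (Finset.range N ×ˢ Finset.range N).filter fun x => (x.1 : ℤ) - x.2 = m,
          (∫ y in a..b, (N : ℂ)⁻¹ * expCircle ((((x.1 : ℤ) - x.2 : ℤ) : ℝ) * (t - y))) =
            (N : ℂ)⁻¹ * ((∫ y in a..b, expCircle (((-m : ℤ) : ℝ) * y)) * expCircle (m * t)) := by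
        intro x hx
        have hx := (Finset.mem_filter.1 hx).2
        rw [hx, intervalIntegral.integral_const_mul, ← intervalIntegral.integral_mul_const]
        congr 2
        funext y
        rw [← expCircle_add]
        push_cast
        ring_nf
      rw [Finset.sum_congr rfl this, Finset.sum_const, nsmul_eq_mul, fejerCoeff]
      ring
    · intro x hx
      simp only [Finset.mem_product, Finset.mem_range] at hx
      simp only [Finset.mem_Icc]
      omega
  · intro x _
    apply Continuous.intervalIntegrable
    have := continuous_expCircle
    fun_prop

theorem norm_fejerCoeff_le {N : ℕ} {m : ℤ} (hm : m ≠ 0) (a b : ℝ) :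
    ‖fejerCoeff N a b m‖ ≤ 1 / |(m : ℝ)| := by
  unfold fejerCoeff
  have h1 := norm_integral_expCircle_le (neg_ne_zero.2 hm) a b
  rw [norm_mul]
  have h2 : ((Finset.range N ×ˢ Finset.range N).filter fun x => (x.1 : ℤ) - x.2 = m).card ≤ N := by
    calc _ ≤ (Finset.range N).card := by
          refine Finset.card_le_card_of_injOn (fun x => x.1) ?_ ?_
          · intro x hx
            simp only [Finset.coe_filter, Finset.mem_product] at hx
            exact hx.1.1
          · intro x hx y hy hxy
            simp only [Finset.coe_filter, Finset.mem_product] at hx hy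
            have hx := hx.2
            have hy := hy.2
            simp only at hxy
            ext
            · exact hxy
            · omega
      _ = N := Finset.card_range N
  have h3 : ‖(((Finset.range N ×ˢ Finset.range N).filter
      fun x => (x.1 : ℤ) - x.2 = m).card : ℂ) / N‖ ≤ 1 := by
    rw [norm_div, Complex.norm_natCast, Complex.norm_natCast]
    exact div_le_one_of_le₀ (by exact_mod_cast h2) (by positivity)
  refine (mul_le_of_le_one_left (norm_nonneg _) h3).trans ?_
  simpa using h1

theorem fejerCoeff_zero {N : ℕ} (hN : 0 < N) (a b : ℝ) :
    fejerCoeff N a b 0 = ((b - a : ℝ) : ℂ) := by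
  unfold fejerCoeff
  have h2 : ((Finset.range N ×ˢ Finset.range N).filter fun x => (x.1 : ℤ) - x.2 = 0) =
      (Finset.range N).diag := by
    ext x
    simp only [Finset.mem_filter, Finset.mem_product, Finset.mem_diag]
    constructor
    · rintro ⟨h, h'⟩; exact ⟨h.1, by omega⟩
    · rintro ⟨h, h'⟩; exact ⟨⟨h, h' ▸ h⟩, by omega⟩
  have hN' : (N : ℂ) ≠ 0 := by exact_mod_cast hN.ne'
  rw [h2, Finset.diag_card, Finset.card_range, div_self hN']
  simp [expCircle]

theorem fejerCoeff_period {N : ℕ} {m : ℤ} (hm : m ≠ 0) (a : ℝ) :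
    fejerCoeff N a (a + 1) m = 0 := by
  unfold fejerCoeff
  rw [integral_expCircle (neg_ne_zero.2 hm), mul_add, mul_one, expCircle_add, expCircle_int]
  simp

theorem integral_fejer_period {N : ℕ} (hN : 0 < N) (a t : ℝ) :
    ∫ y in a..(a + 1), fejer N (t - y) = 1 := by
  have h := integral_fejer N a (a + 1) t
  rw [Finset.sum_eq_single_of_mem 0 (by simp)] at h
  · rw [fejerCoeff_zero hN] at h
    simp only [Int.cast_zero, zero_mul, add_sub_cancel_left] at h
    have h0 : expCircle 0 = 1 := by simp [expCircle]
    rw [h0, mul_one] at h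
    exact_mod_cast h
  · intro m _ hm
    rw [fejerCoeff_period hm, zero_mul]

/-- The kernel is a squared geometric sum divided by `N`, and `|e(s) - 1| = 2 sin(πs) ≥ 4δ` by
concavity of the sine. -/
theorem fejer_le {N : ℕ} (hN : 0 < N) {δ s : ℝ} (hδ : 0 < δ) (h1 : δ ≤ s) (h2 : s ≤ 1 - δ) :
    fejer N s ≤ 1 / (4 * N * δ ^ 2) := by
  have hpi := Real.pi_pos
  have hsin : 2 * δ ≤ Real.sin (Real.pi * s) := by
    have hδ2 : δ ≤ 1 / 2 := by linarith
    rcases le_total s (1 / 2) with hs | hs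
    · have := Real.mul_le_sin (x := Real.pi * s) (by nlinarith) (by nlinarith)
      have e : 2 / Real.pi * (Real.pi * s) = 2 * s := by field_simp
      linarith
    · have := Real.mul_le_sin (x := Real.pi * (1 - s)) (by nlinarith) (by nlinarith)
      have e : 2 / Real.pi * (Real.pi * (1 - s)) = 2 * (1 - s) := by field_simp
      have e2 : Real.sin (Real.pi * (1 - s)) = Real.sin (Real.pi * s) := by
        rw [mul_sub, mul_one, Real.sin_pi_sub]
      linarith
  have hne : ‖expCircle s - 1‖ = 2 * Real.sin (Real.pi * s) := by
    have := Complex.norm_exp_I_mul_ofReal_sub_one (2 * Real.pi * s)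
    unfold expCircle
    rw [show 2 * (Real.pi : ℂ) * Complex.I * s = Complex.I * ((2 * Real.pi * s : ℝ) : ℂ) by
      push_cast; ring, this, show 2 * Real.pi * s / 2 = Real.pi * s by ring, Real.norm_eq_abs,
      abs_of_pos (by linarith)]
  have hlow : 4 * δ ≤ ‖expCircle s - 1‖ := by rw [hne]; linarith
  have hne1 : expCircle s ≠ 1 := by
    intro h
    rw [h, sub_self, norm_zero] at hlow
    linarith
  have hpow : ∀ j : ℕ, expCircle (j * s) = expCircle s ^ j := by
    intro j
    unfold expCircle
    rw [← Complex.exp_nat_mul]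
    push_cast; ring_nf
  have hsum : ‖∑ j ∈ Finset.range N, expCircle (j * s)‖ ≤ 1 / (2 * δ) := by
    simp_rw [hpow]
    rw [geom_sum_eq hne1, norm_div, div_le_div_iff₀ (by linarith) (by linarith)]
    have : ‖expCircle s ^ N - 1‖ ≤ 2 := by
      refine (norm_sub_le _ _).trans ?_
      rw [norm_pow, norm_expCircle]; norm_num
    nlinarith
  unfold fejer
  have hN' : (0 : ℝ) < N := by exact_mod_cast hN
  calc _ ≤ (1 / (2 * δ)) ^ 2 / N := by gcongr
    _ = _ := by field_simp; norm_num

/-- A trigonometric polynomial of degree at most `N` majorising the indicator of an arc. -/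
theorem exists_arc_majorant {N : ℕ} (hN : 0 < N) {δ : ℝ} (hδ : 0 < δ) (hδN : δ ^ 3 * N = 1)
    {a b : ℝ} (hab : a ≤ b) :
    ∃ (c : ℤ → ℂ) (v : ℝ), c 0 = v ∧ 0 ≤ v ∧ v ≤ (b - a) + 3 * δ ∧ (b - a ≤ 1 → v ≤ 4) ∧
      (∀ m : ℤ, m ≠ 0 → ‖c m‖ ≤ 1 / |(m : ℝ)|) ∧
      ∀ x : UnitAddCircle, ∃ r : ℝ, 0 ≤ r ∧
        ∑ m ∈ Finset.Icc (-N : ℤ) N, c m * fourier m x = r ∧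
        ((∃ t ∈ Set.Icc a b, (t : UnitAddCircle) = x) → 1 ≤ r) := by
  have hN' : (1 : ℝ) ≤ N := by exact_mod_cast hN
  have hδ1 : δ ≤ 1 := by
    by_contra h
    have : 1 < δ ^ 3 := one_lt_pow₀ (not_le.1 h) (by norm_num)
    nlinarith
  -- If the arc widened by `δ` on both sides covers the circle, the constant 1 is good enough.
  -- Otherwise the indicator of the widened arc is smoothed by the Fejér kernel.
  by_cases hlen : 1 ≤ b - a + 2 * δ
  · refine ⟨Pi.single 0 1, 1, by simp, zero_le_one, by linarith, fun _ => by norm_num, ?_, ?_⟩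
    · intro m hm
      rw [Pi.single_eq_of_ne hm]
      simp
    · intro x
      refine ⟨1, zero_le_one, ?_, fun _ => le_rfl⟩
      rw [Finset.sum_eq_single_of_mem 0 (by simp)]
      · simp
      · intro m _ hm
        rw [Pi.single_eq_of_ne hm, zero_mul]
  · push Not at hlen
    -- `τ` bounds the kernel at distance at least `δ` from the integers. The relation `δ³ N = 1`
    -- makes it `δ/4`, so the mean exceeds `b - a` by `2δ + δ/4 ≤ 3δ`.
    set τ : ℝ := 1 / (4 * N * δ ^ 2) with hτ
    have hτ0 : 0 < τ := by positivity
    have hτδ : τ = δ / 4 := by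
      rw [hτ, div_eq_div_iff (by positivity) (by norm_num)]
      nlinarith
    have hfour : ∀ (m : ℤ) (t : ℝ), (fourier m (t : UnitAddCircle) : ℂ) = expCircle (m * t) := by
      intro m t
      rw [fourier_coe_apply]
      unfold expCircle
      push_cast; ring_nf
    refine ⟨fun m => fejerCoeff N (a - δ) (b + δ) m + if m = 0 then (τ : ℂ) else 0,
      (b + δ - (a - δ)) + τ, ?_, ?_, ?_, ?_, ?_, ?_⟩
    · simp only [fejerCoeff_zero hN]; simp
    · linarith
    · linarith
    · intro; linarith
    · intro m hm
      simp only [hm, if_false, add_zero]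
      exact norm_fejerCoeff_le hm _ _
    · intro x
      have key : ∀ t : ℝ, ∑ m ∈ Finset.Icc (-N : ℤ) N,
          (fejerCoeff N (a - δ) (b + δ) m + if m = 0 then (τ : ℂ) else 0) *
            fourier m (t : UnitAddCircle) =
          (((∫ y in (a - δ)..(b + δ), fejer N (t - y)) + τ : ℝ) : ℂ) := by
        intro t
        simp_rw [add_mul, Finset.sum_add_distrib, hfour]
        rw [← integral_fejer]
        push_cast
        congr 1
        rw [Finset.sum_eq_single_of_mem 0 (by simp)]
        · simp [expCircle]
        · intro m _ hm; simp [hm]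
      have hnn : ∀ t : ℝ, 0 ≤ ∫ y in (a - δ)..(b + δ), fejer N (t - y) := fun t =>
        intervalIntegral.integral_nonneg (by linarith) fun y _ => fejer_nonneg _ _
      have hint : ∀ t u v : ℝ, IntervalIntegrable (fun y => fejer N (t - y)) volume u v := by
        intro t u v
        apply Continuous.intervalIntegrable
        have := continuous_fejer N
        fun_prop
      by_cases hx : ∃ t ∈ Set.Icc a b, (t : UnitAddCircle) = x
      · obtain ⟨t, ht, rfl⟩ := hx
        refine ⟨_, ?_, key t, fun _ => ?_⟩
        · have := hnn t; linarith
        -- Over a full period the kernel has mass 1, and the part outside the widened arc stays at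
        -- distance at least `δ` from `t` modulo 1. The missing mass is thus at most `τ`, which was
        -- added back.
        · have h1 := integral_fejer_period hN (a - δ) t
          have h2 := intervalIntegral.integral_add_adjacent_intervals
            (hint t (a - δ) (b + δ)) (hint t (b + δ) (a - δ + 1))
          have hb : ∀ y ∈ Set.Icc (b + δ) (a - δ + 1), fejer N (t - y) ≤ τ := by
            intro y hy
            have hper : fejer N (t - y) = fejer N (t - y + 1) := by
              unfold fejer
              congr 3
              refine Finset.sum_congr rfl fun j _ => ?_
              rw [mul_add, mul_one, expCircle_add]
              have := expCircle_int j
              push_cast at this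
              rw [this, mul_one]
            rw [hper]
            have h1 := ht.1; have h2 := ht.2; have h3 := hy.1; have h4 := hy.2
            exact fejer_le hN hδ (by linarith) (by linarith)
          have h3 : ∫ y in (b + δ)..(a - δ + 1), fejer N (t - y) ≤ τ := by
            calc _ ≤ ∫ y in (b + δ)..(a - δ + 1), τ :=
                  intervalIntegral.integral_mono_on (by linarith) (hint t _ _)
                    (by simp) hb
              _ = (a - δ + 1 - (b + δ)) * τ := by simp
              _ ≤ 1 * τ := by gcongr; linarith
              _ = τ := one_mul _
          linarith
      · obtain ⟨t, rfl⟩ := QuotientAddGroup.mk_surjective x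
        exact ⟨_, by have := hnn t; linarith, key t, fun h => absurd h hx⟩

/-- The weight `∏ max(1, |h_i|)`. -/
def freqWeight (h : Fin n → ℤ) : ℝ := ∏ i, max 1 |(h i : ℝ)|

theorem freqWeight_pos (h : Fin n → ℤ) : 0 < freqWeight h :=
  Finset.prod_pos fun _ _ => by positivity

/-- The frequencies in the box `[-N, N]^n`. -/
def freqBox (n N : ℕ) : Finset (Fin n → ℤ) := Fintype.piFinset fun _ => Finset.Icc (-N : ℤ) N

theorem prod_add_le {ι : Type*} (s : Finset ι) {l : ι → ℝ} {ε : ℝ} (hε : 0 ≤ ε) (hε3 : ε ≤ 3)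
    (h0 : ∀ i, 0 ≤ l i) (h1 : ∀ i, l i ≤ 1) :
    ∏ i ∈ s, (l i + ε) ≤ ∏ i ∈ s, l i + ε * 5 ^ s.card := by
  classical
  induction s using Finset.induction_on with
  | empty => simp [hε]
  | insert i s hi ih =>
    rw [Finset.prod_insert hi, Finset.prod_insert hi, Finset.card_insert_of_notMem hi, pow_succ]
    have hP : ∏ i ∈ s, l i ≤ 1 := Finset.prod_le_one (fun i _ => h0 i) fun i _ => h1 i
    have h5 : (1 : ℝ) ≤ 5 ^ s.card := one_le_pow₀ (by norm_num)
    calc (l i + ε) * ∏ j ∈ s, (l j + ε) ≤ (l i + ε) * (∏ j ∈ s, l j + ε * 5 ^ s.card) := by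
          have := h0 i
          gcongr
      _ = l i * ∏ j ∈ s, l j + ε * ∏ j ∈ s, l j + (l i + ε) * (ε * 5 ^ s.card) := by ring
      _ ≤ l i * ∏ j ∈ s, l j + ε * 5 ^ s.card + 4 * (ε * 5 ^ s.card) := by
          gcongr
          · exact hP.trans h5
          · have := h1 i; linarith
      _ = _ := by ring

/-- Upper bound for the proportion of points in a box of `(ℝ/ℤ)^n`. -/
theorem card_box_le {ι : Type*} (S : Finset ι) (x : ι → Fin n → UnitAddCircle)
    {N : ℕ} (hN : 0 < N) {δ : ℝ} (hδ : 0 < δ) (hδN : δ ^ 3 * N = 1) {a b : Fin n → ℝ}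
    (hab : ∀ i, a i ≤ b i) (hab1 : ∀ i, b i - a i ≤ 1) [DecidablePred fun s =>
      ∀ i, ∃ t ∈ Set.Icc (a i) (b i), (t : UnitAddCircle) = x s i] :
    ((S.filter fun s => ∀ i, ∃ t ∈ Set.Icc (a i) (b i), (t : UnitAddCircle) = x s i).card : ℝ) ≤
      S.card * (∏ i, (b i - a i) + 3 * δ * 5 ^ n) +
        4 ^ n * ∑ h ∈ (freqBox n N).erase 0,
          ‖∑ s ∈ S, ∏ i, (fourier (h i) (x s i) : ℂ)‖ / freqWeight h := by
  classical
  have hN' : (1 : ℝ) ≤ N := by exact_mod_cast hN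
  have hδ1 : δ ≤ 1 := by
    by_contra h
    have : 1 < δ ^ 3 := one_lt_pow₀ (not_le.1 h) (by norm_num)
    nlinarith
  choose c v hc0 hv0 hv1 hv4 hcm hmaj using fun i => exists_arc_majorant hN hδ hδN (hab i)
  choose r hr0 hr1 hr2 using hmaj
  have h1 : ((S.filter fun s => ∀ i, ∃ t ∈ Set.Icc (a i) (b i),
      (t : UnitAddCircle) = x s i).card : ℝ) ≤ ∑ s ∈ S, ∏ i, r i (x s i) := by
    rw [Finset.card_filter]
    push_cast
    refine Finset.sum_le_sum fun s _ => ?_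
    split_ifs with hs
    · calc (1 : ℝ) = ∏ i : Fin n, 1 := by simp
        _ ≤ _ := Finset.prod_le_prod (fun _ _ => zero_le_one) fun i _ => hr2 i _ (hs i)
    · exact Finset.prod_nonneg fun i _ => hr0 i _
  refine h1.trans ?_
  have h2 : ((∑ s ∈ S, ∏ i, r i (x s i) : ℝ) : ℂ) =
      ∑ h ∈ freqBox n N, (∏ i, c i (h i)) * ∑ s ∈ S, ∏ i, (fourier (h i) (x s i) : ℂ) := by
    push_cast
    simp_rw [← hr1, Finset.prod_univ_sum, Finset.prod_mul_distrib]
    rw [Finset.sum_comm]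
    simp_rw [Finset.mul_sum]
    rfl
  have hmem : (0 : Fin n → ℤ) ∈ freqBox n N := by simp [freqBox]
  rw [← Finset.add_sum_erase _ _ hmem] at h2
  have h3 : ∑ s ∈ S, ∏ i, r i (x s i) ≤ ‖(∏ i, c i 0) * ∑ s ∈ S,
      ∏ i, (fourier 0 (x s i) : ℂ)‖ + ∑ h ∈ (freqBox n N).erase 0,
        ‖(∏ i, c i (h i)) * ∑ s ∈ S, ∏ i, (fourier (h i) (x s i) : ℂ)‖ := by
    calc _ ≤ ‖((∑ s ∈ S, ∏ i, r i (x s i) : ℝ) : ℂ)‖ := by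
          rw [Complex.norm_real]; exact le_abs_self _
      _ ≤ _ := by
          rw [h2]
          refine (norm_add_le _ _).trans ?_
          gcongr
          · exact le_rfl
          · exact norm_sum_le _ _
  refine h3.trans (add_le_add ?_ ?_)
  · have : ‖(∏ i, c i 0) * ∑ s ∈ S, ∏ i : Fin n, (fourier 0 (x s i) : ℂ)‖ =
        S.card * ∏ i, v i := by
      simp only [hc0, fourier_zero, Finset.prod_const_one, Finset.sum_const, nsmul_eq_mul, mul_one]
      rw [norm_mul, Complex.norm_natCast, norm_prod, mul_comm]
      congr 1
      refine Finset.prod_congr rfl fun i _ => ?_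
      rw [Complex.norm_real, Real.norm_of_nonneg (hv0 i)]
    rw [this]
    gcongr
    calc ∏ i, v i ≤ ∏ i, ((b i - a i) + 3 * δ) :=
          Finset.prod_le_prod (fun i _ => hv0 i) fun i _ => hv1 i
      _ ≤ _ := by
          refine (prod_add_le Finset.univ (by positivity) (by linarith)
            (fun i => sub_nonneg.2 (hab i)) hab1).trans ?_
          simp
  · rw [Finset.mul_sum]
    refine Finset.sum_le_sum fun h _ => ?_
    rw [norm_mul, norm_prod]
    have h4 : ∏ i, ‖c i (h i)‖ ≤ 4 ^ n / freqWeight h := by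
      have : (4 : ℝ) ^ n / freqWeight h = ∏ i, (4 / max 1 |(h i : ℝ)|) := by
        rw [Finset.prod_div_distrib]; simp [freqWeight]
      rw [this]
      refine Finset.prod_le_prod (fun _ _ => norm_nonneg _) fun i _ => ?_
      by_cases hi : h i = 0
      · rw [hi, hc0, Complex.norm_real, Real.norm_of_nonneg (hv0 i)]
        simpa using hv4 i (hab1 i)
      · refine (hcm i _ hi).trans ?_
        have : (1 : ℝ) ≤ |(h i : ℝ)| := by exact_mod_cast Int.one_le_abs hi
        rw [max_eq_right this]
        gcongr
        norm_num
    calc _ ≤ 4 ^ n / freqWeight h * ‖∑ s ∈ S, ∏ i, (fourier (h i) (x s i) : ℂ)‖ := by gcongr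
      _ = _ := by ring

open Classical in
/-- The points of a finite family that lie in a box. -/
def inBox {ι : Type*} (S : Finset ι) (x : ι → Fin n → UnitAddCircle) (a b : Fin n → ℝ) :
    Finset ι :=
  S.filter fun s => ∀ i, ∃ t ∈ Set.Icc (a i) (b i), (t : UnitAddCircle) = x s i

/-- A point outside the box has a first coordinate `i` where it fails. It then lies in the box with
the given arcs before `i`, the complementary arc `[b_i, a_i + 1]` at `i`, and full circles after
`i`. A lower bound for one box is thus reduced to upper bounds for `n` others. -/
theorem card_le_inBox_add_sum {ι : Type*} (S : Finset ι) (x : ι → Fin n → UnitAddCircle)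
    (a b : Fin n → ℝ) :
    S.card ≤ (inBox S x a b).card + ∑ i, (inBox S x
      (fun j => if j < i then a j else if j = i then b i else 0)
      (fun j => if j < i then b j else if j = i then a i + 1 else 1)).card := by
  classical
  have hsub : S ⊆ inBox S x a b ∪ Finset.univ.biUnion fun i => inBox S x
      (fun j => if j < i then a j else if j = i then b i else 0)
      (fun j => if j < i then b j else if j = i then a i + 1 else 1) := by
    intro s hs
    by_cases h : ∀ i, ∃ t ∈ Set.Icc (a i) (b i), (t : UnitAddCircle) = x s i
    · exact Finset.mem_union_left _ (Finset.mem_filter.2 ⟨hs, h⟩)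
    · refine Finset.mem_union_right _ (Finset.mem_biUnion.2 ?_)
      have hne : (Finset.univ.filter fun i =>
          ¬ ∃ t ∈ Set.Icc (a i) (b i), (t : UnitAddCircle) = x s i).Nonempty := by
        push Not at h
        obtain ⟨i, hi⟩ := h
        exact ⟨i, Finset.mem_filter.2 ⟨Finset.mem_univ _, by push Not; exact hi⟩⟩
      set i := Finset.min' _ hne with hi
      have hi1 := (Finset.mem_filter.1 (Finset.min'_mem _ hne)).2
      rw [← hi] at hi1
      have hi2 : ∀ j < i, ∃ t ∈ Set.Icc (a j) (b j), (t : UnitAddCircle) = x s j := by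
        intro j hj
        by_contra hcon
        exact absurd (Finset.min'_le _ j (Finset.mem_filter.2 ⟨Finset.mem_univ _, hcon⟩))
          (not_le.2 hj)
      have hall : ∀ (c : ℝ) (y : UnitAddCircle), ∃ t ∈ Set.Icc c (c + 1), (t : UnitAddCircle) = y := by
        intro c y
        have := AddCircle.coe_image_Icc_eq (1 : ℝ) c
        have hy : y ∈ (QuotientAddGroup.mk '' Set.Icc c (c + 1) : Set (AddCircle (1 : ℝ))) := by
          rw [this]; trivial
        exact hy
      refine ⟨i, Finset.mem_univ _, Finset.mem_filter.2 ⟨hs, fun j => ?_⟩⟩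
      rcases lt_trichotomy j i with hj | hj | hj
      · simpa [hj] using hi2 j hj
      · subst hj
        obtain ⟨t, ht, hty⟩ := hall (a i) (x s i)
        refine ⟨t, ?_, hty⟩
        have : b i ≤ t := by
          by_contra hcon
          exact hi1 ⟨t, ⟨ht.1, (not_le.1 hcon).le⟩, hty⟩
        simpa using ⟨this, ht.2⟩
      · obtain ⟨t, ht, hty⟩ := hall 0 (x s j)
        refine ⟨t, ?_, hty⟩
        simpa [not_lt.2 hj.le, hj.ne'] using ht
  refine (Finset.card_le_card hsub).trans ((Finset.card_union_le _ _).trans ?_)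
  gcongr
  exact Finset.card_biUnion_le

/-- The `n` boxes covering the complement have total volume exactly that of the complement, by
telescoping, so the reduction loses nothing in the main term. -/
theorem sum_complement_volumes (l : Fin n → ℝ) :
    ∑ i, ∏ j : Fin n, (if j < i then l j else if j = i then 1 - l i else 1) = 1 - ∏ i, l i := by
  have h := Finset.prod_one_sub_ordered Finset.univ (fun i => 1 - l i)
  simp only [sub_sub_cancel] at h
  rw [h, sub_sub_cancel]
  refine Finset.sum_congr rfl fun i _ => ?_
  rw [← Finset.mul_prod_erase _ _ (Finset.mem_univ i), Finset.prod_filter]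
  simp only [lt_irrefl, if_false, if_true]
  congr 1
  rw [← Finset.mul_prod_erase Finset.univ (fun j => if j < i then l j else 1) (Finset.mem_univ i)]
  simp only [lt_irrefl, if_false, one_mul]
  refine Finset.prod_congr rfl fun j hj => ?_
  have := Finset.ne_of_mem_erase hj
  simp [this]

/-- The error term of the Erdős–Turán inequality. -/
def etError {ι : Type*} (S : Finset ι) (x : ι → Fin n → UnitAddCircle) (N : ℕ) (δ : ℝ) : ℝ :=
  S.card * (3 * δ * 5 ^ n) + 4 ^ n * ∑ h ∈ (freqBox n N).erase 0,
    ‖∑ s ∈ S, ∏ i, (fourier (h i) (x s i) : ℂ)‖ / freqWeight h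

theorem etError_nonneg {ι : Type*} (S : Finset ι) (x : ι → Fin n → UnitAddCircle) (N : ℕ) {δ : ℝ}
    (hδ : 0 ≤ δ) : 0 ≤ etError S x N δ := by
  have : ∀ h : Fin n → ℤ, 0 ≤ freqWeight h := fun h => (freqWeight_pos h).le
  unfold etError
  refine add_nonneg (by positivity) (mul_nonneg (by positivity) (Finset.sum_nonneg fun h _ => ?_))
  exact div_nonneg (norm_nonneg _) (this h)

/-- The upper bound costs one error term; the lower bound costs one for each of the `n` boxes
covering the complement. -/
theorem abs_card_inBox_sub_le {ι : Type*} (S : Finset ι) (x : ι → Fin n → UnitAddCircle)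
    {N : ℕ} (hN : 0 < N) {δ : ℝ} (hδ : 0 < δ) (hδN : δ ^ 3 * N = 1) {a b : Fin n → ℝ}
    (hab : ∀ i, a i ≤ b i) (hab1 : ∀ i, b i - a i ≤ 1) :
    |((inBox S x a b).card : ℝ) - S.card * ∏ i, (b i - a i)| ≤ (n + 1) * etError S x N δ := by
  classical
  have hE := etError_nonneg S x N hδ.le
  have hup : ∀ {a b : Fin n → ℝ}, (∀ i, a i ≤ b i) → (∀ i, b i - a i ≤ 1) →
      ((inBox S x a b).card : ℝ) ≤ S.card * ∏ i, (b i - a i) + etError S x N δ := by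
    intro a b h1 h2
    refine le_trans (le_of_eq ?_) ((card_box_le S x hN hδ hδN h1 h2).trans (le_of_eq ?_))
    · unfold inBox; congr!
    · unfold etError; ring
  rw [abs_le]
  constructor
  · have h1 : (S.card : ℝ) ≤ (inBox S x a b).card + ∑ i, ((inBox S x
        (fun j => if j < i then a j else if j = i then b i else 0)
        (fun j => if j < i then b j else if j = i then a i + 1 else 1)).card : ℝ) := by
      exact_mod_cast card_le_inBox_add_sum S x a b
    have h2 : ∀ i, ((inBox S x
        (fun j => if j < i then a j else if j = i then b i else 0)
        (fun j => if j < i then b j else if j = i then a i + 1 else 1)).card : ℝ) ≤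
        S.card * (∏ j, (if j < i then b j - a j else if j = i then 1 - (b i - a i) else 1)) +
          etError S x N δ := by
      intro i
      refine (hup ?_ ?_).trans (le_of_eq ?_)
      · intro j
        have h3 := hab j; have h4 := hab1 i
        split_ifs <;> linarith
      · intro j
        have h3 := hab i; have h4 := hab1 j
        split_ifs <;> linarith
      · congr 2
        refine Finset.prod_congr rfl fun j _ => ?_
        split_ifs <;> ring
    have h3 := sum_complement_volumes fun i => b i - a i
    have h4 : ∑ i, ((inBox S x
        (fun j => if j < i then a j else if j = i then b i else 0)
        (fun j => if j < i then b j else if j = i then a i + 1 else 1)).card : ℝ) ≤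
          S.card * (1 - ∏ i, (b i - a i)) + n * etError S x N δ := by
      refine (Finset.sum_le_sum fun i _ => h2 i).trans (le_of_eq ?_)
      rw [Finset.sum_add_distrib, ← Finset.mul_sum, h3]
      simp
    linarith
  · have h1 := hup hab hab1
    have : 0 ≤ (n : ℝ) * etError S x N δ := by positivity
    linarith

theorem volume_real_arc {a b : ℝ} (hab : a ≤ b) (hab1 : b - a ≤ 1) :
    (volume : Measure UnitAddCircle).real ((fun t : ℝ => (t : UnitAddCircle)) '' Set.Icc a b) =
      b - a := by
  have hmp := UnitAddCircle.measurePreserving_mk a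
  have hmeas : MeasurableSet ((fun t : ℝ => (t : UnitAddCircle)) '' Set.Icc a b) :=
    (isCompact_Icc.image (AddCircle.continuous_mk' 1)).isClosed.measurableSet
  have h1 := hmp.measure_preimage hmeas.nullMeasurableSet
  rw [measureReal_def, ← h1, Measure.restrict_apply' measurableSet_Ioc]
  have h2 : volume ((QuotientAddGroup.mk ⁻¹' ((fun t : ℝ => (t : UnitAddCircle)) '' Set.Icc a b)) ∩
      Set.Ioc a (a + 1)) = ENNReal.ofReal (b - a) := by
    refine le_antisymm ?_ ?_
    -- The fundamental domain `(a, a + 1]` represents the class of `a` by `a + 1`, hence the extra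
    -- null point.
    · calc _ ≤ volume (Set.Icc a b ∪ {a + 1}) := by
            refine measure_mono ?_
            rintro t ⟨⟨s, hs, hst⟩, ht⟩
            have ha1 : a + 1 ∈ Set.Ioc a (a + 1) := ⟨by linarith, le_rfl⟩
            rcases hs.1.eq_or_lt with h | h
            · refine Or.inr ((AddCircle.coe_eq_coe_iff_of_mem_Ioc ht ha1).1 ?_)
              rw [AddCircle.coe_add, AddCircle.coe_period, add_zero, h]
              exact hst.symm
            · refine Or.inl ?_
              have hs' : s ∈ Set.Ioc a (a + 1) := ⟨h, by linarith [hs.2]⟩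
              rwa [← (AddCircle.coe_eq_coe_iff_of_mem_Ioc hs' ht).1 hst]
        _ ≤ volume (Set.Icc a b) + volume {a + 1} := measure_union_le _ _
        _ = _ := by simp
    · rw [← Real.volume_Ioc]
      refine measure_mono fun t ht => ⟨⟨t, ⟨ht.1.le, ht.2⟩, rfl⟩, ht.1, by linarith [ht.2]⟩
  rw [h2, ENNReal.toReal_ofReal (by linarith)]

theorem isBox_eq_pi (a b : Fin n → ℝ) :
    (fun (t : Fin n → ℝ) (i : Fin n) => (t i : UnitAddCircle)) '' Set.Icc a b =
      Set.univ.pi fun i => (fun t : ℝ => (t : UnitAddCircle)) '' Set.Icc (a i) (b i) := by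
  ext y
  constructor
  · rintro ⟨t, ht, rfl⟩ i _
    exact ⟨t i, ⟨ht.1 i, ht.2 i⟩, rfl⟩
  · intro h
    choose! t ht using fun i => h i (Set.mem_univ i)
    exact ⟨t, ⟨fun i => (ht i).1.1, fun i => (ht i).1.2⟩, funext fun i => (ht i).2⟩

theorem measurableSet_of_isBox {B : Set (Fin n → UnitAddCircle)} (h : IsBox B) :
    MeasurableSet B := by
  obtain ⟨a, b, -, rfl⟩ := h
  rw [isBox_eq_pi]
  exact MeasurableSet.univ_pi fun i =>
    (isCompact_Icc.image (AddCircle.continuous_mk' 1)).isClosed.measurableSet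

theorem Delta_real (A : Family n) (q : ℕ) [NeZero q] {B : Set (Fin n → UnitAddCircle)}
    (hB : MeasurableSet B) [DecidablePred fun a => fracPoint q a ∈ B] :
    (Delta A q).real B =
      ((crtFinset A q).filter fun a => fracPoint q a ∈ B).card / (rho A q : ℝ) := by
  classical
  have hfin : Fintype (crtSet A q) := Fintype.ofFinite _
  have h1 : (Measure.sum fun a : crtSet A q => Measure.dirac (fracPoint q a.1)) B =
      (((crtFinset A q).filter fun a => fracPoint q a ∈ B).card : ℝ≥0∞) := by
    rw [Measure.sum_apply _ hB, tsum_fintype]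
    simp_rw [Measure.dirac_apply' _ hB]
    rw [Finset.card_filter]
    push_cast
    rw [← Finset.sum_subtype (crtFinset A q) (fun x => mem_crtFinset)
      (fun a => B.indicator 1 (fracPoint q a))]
    refine Finset.sum_congr rfl fun a _ => ?_
    simp [Set.indicator_apply]
  rw [measureReal_def, Delta, Measure.smul_apply, h1, smul_eq_mul, ENNReal.toReal_mul,
    ENNReal.toReal_inv, ENNReal.toReal_natCast, ENNReal.toReal_natCast, div_eq_inv_mul]

theorem prod_fourier_fracPoint (q : ℕ) [NeZero q] (h : Fin n → ℤ) (a : Fin n → ZMod q) :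
    ∏ i, (fourier (h i) (fracPoint q a i) : ℂ) =
      ZMod.stdAddChar (∑ i, (h i : ZMod q) * a i) := by
  have h1 : (∑ i, (h i : ZMod q) * a i) = ((∑ i, h i * ((a i).val : ℤ) : ℤ) : ZMod q) := by
    push_cast
    refine Finset.sum_congr rfl fun i _ => ?_
    rw [ZMod.natCast_zmod_val]
  rw [h1, ZMod.stdAddChar_coe]
  unfold fracPoint
  simp_rw [fourier_coe_apply]
  rw [← Complex.exp_sum]
  congr 1
  push_cast
  rw [Finset.mul_sum, Finset.sum_div]
  refine Finset.sum_congr rfl fun i _ => ?_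
  ring

/-- Erdős–Turán inequality for the measures `Δ_q`. -/
theorem disc_Delta_le (A : Family n) (q : ℕ) [NeZero q] (hρ : 1 ≤ rho A q) {N : ℕ} (hN : 0 < N)
    {δ : ℝ} (hδ : 0 < δ) (hδN : δ ^ 3 * N = 1) :
    disc (Delta A q) ≤ (n + 1) * (3 * δ * 5 ^ n + 4 ^ n * ∑ h ∈ (freqBox n N).erase 0,
      ‖weyl A q (fun i => (h i : ZMod q))‖ / freqWeight h) := by
  classical
  have hρ' : (0 : ℝ) < rho A q := by exact_mod_cast hρ
  refine csSup_le ⟨_, _, ⟨0, 0, fun i => by simp, rfl⟩, rfl⟩ ?_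
  rintro d ⟨B, hB, rfl⟩
  rw [Delta_real A q (measurableSet_of_isBox hB)]
  obtain ⟨a, b, hab, rfl⟩ := hB
  have hvol : (volume : Measure (Fin n → UnitAddCircle)).real
      ((fun (t : Fin n → ℝ) (i : Fin n) => (t i : UnitAddCircle)) '' Set.Icc a b) =
        ∏ i, (b i - a i) := by
    rw [isBox_eq_pi, measureReal_def, volume_pi_pi, ENNReal.toReal_prod]
    exact Finset.prod_congr rfl fun i _ => volume_real_arc (hab i).1 (hab i).2
  have hcount : ((crtFinset A q).filter fun c => fracPoint q c ∈
      (fun (t : Fin n → ℝ) (i : Fin n) => (t i : UnitAddCircle)) '' Set.Icc a b) =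
        inBox (crtFinset A q) (fracPoint q) a b := by
    unfold inBox
    refine Finset.filter_congr fun c _ => ?_
    rw [isBox_eq_pi]
    simp [Set.mem_pi]
  rw [hvol, hcount]
  have h := abs_card_inBox_sub_le (crtFinset A q) (fracPoint q) hN hδ hδN
    (fun i => (hab i).1) (fun i => (hab i).2)
  rw [card_crtFinset] at h
  have e1 : ((inBox (crtFinset A q) (fracPoint q) a b).card : ℝ) / rho A q - ∏ i, (b i - a i) =
      (((inBox (crtFinset A q) (fracPoint q) a b).card : ℝ) - rho A q * ∏ i, (b i - a i)) /
        rho A q := by field_simp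
  rw [e1, abs_div, abs_of_pos hρ', div_le_iff₀ hρ']
  refine h.trans (le_of_eq ?_)
  unfold etError
  simp_rw [prod_fourier_fracPoint]
  have e2 : ∀ h : Fin n → ℤ, ‖∑ s ∈ crtFinset A q,
      (ZMod.stdAddChar (∑ i, (h i : ZMod q) * s i) : ℂ)‖ =
        rho A q * ‖weyl A q (fun i => (h i : ZMod q))‖ := by
    intro h
    unfold weyl
    rw [norm_mul, norm_inv, Complex.norm_natCast, mul_inv_cancel_left₀ hρ'.ne']
  simp_rw [e2, card_crtFinset, mul_div_assoc, ← Finset.mul_sum]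
  ring

theorem disc_Delta_le_one (A : Family n) (q : ℕ) [NeZero q] (hρ : 1 ≤ rho A q) :
    disc (Delta A q) ≤ 1 := by
  classical
  have hρ' : (0 : ℝ) < rho A q := by exact_mod_cast hρ
  refine csSup_le ⟨_, _, ⟨0, 0, fun i => by simp, rfl⟩, rfl⟩ ?_
  rintro d ⟨B, hB, rfl⟩
  rw [Delta_real A q (measurableSet_of_isBox hB)]
  obtain ⟨a, b, hab, rfl⟩ := hB
  have hvol : (volume : Measure (Fin n → UnitAddCircle)).real
      ((fun (t : Fin n → ℝ) (i : Fin n) => (t i : UnitAddCircle)) '' Set.Icc a b) =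
        ∏ i, (b i - a i) := by
    rw [isBox_eq_pi, measureReal_def, volume_pi_pi, ENNReal.toReal_prod]
    exact Finset.prod_congr rfl fun i _ => volume_real_arc (hab i).1 (hab i).2
  rw [hvol]
  have h1 : ∏ i, (b i - a i) ≤ 1 :=
    Finset.prod_le_one (fun i _ => by linarith [(hab i).1]) fun i _ => (hab i).2
  have h2 : 0 ≤ ∏ i, (b i - a i) := Finset.prod_nonneg fun i _ => by linarith [(hab i).1]
  set K := (crtFinset A q).filter fun c => fracPoint q c ∈
      (fun (t : Fin n → ℝ) (i : Fin n) => (t i : UnitAddCircle)) '' Set.Icc a b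
  have h3 : (K.card : ℝ) / rho A q ≤ 1 := by
    refine div_le_one_of_le₀ ?_ hρ'.le
    rw [← card_crtFinset]
    exact_mod_cast Finset.card_filter_le _ _
  have h4 : 0 ≤ (K.card : ℝ) / rho A q := by positivity
  rw [abs_le]
  constructor <;> linarith

theorem sum_inv_freqWeight_le (n N : ℕ) :
    ∑ h ∈ freqBox n N, 1 / freqWeight h ≤ (3 + 2 * Real.log N) ^ n := by
  have h1 : ∑ h ∈ freqBox n N, 1 / freqWeight h =
      ∏ _i : Fin n, ∑ m ∈ Finset.Icc (-N : ℤ) N, 1 / max 1 |(m : ℝ)| := by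
    rw [Finset.prod_univ_sum]
    refine Finset.sum_congr rfl fun h _ => ?_
    simp [freqWeight]
  have h2 : ∑ m ∈ Finset.Icc (-N : ℤ) N, 1 / max 1 |(m : ℝ)| ≤ 3 + 2 * Real.log N := by
    have hsub : Finset.Icc (-N : ℤ) N ⊆ {0} ∪ ((Finset.Icc 1 N).image (fun j : ℕ => (j : ℤ)) ∪
        (Finset.Icc 1 N).image (fun j : ℕ => -(j : ℤ))) := by
      intro m hm
      simp only [Finset.mem_Icc, Finset.mem_union, Finset.mem_singleton, Finset.mem_image] at hm ⊢
      rcases lt_trichotomy m 0 with h | h | h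
      · exact Or.inr (Or.inr ⟨m.natAbs, by omega, by omega⟩)
      · exact Or.inl h
      · exact Or.inr (Or.inl ⟨m.natAbs, by omega, by omega⟩)
    have hh : ∑ j ∈ Finset.Icc 1 N, 1 / (j : ℝ) ≤ 1 + Real.log N := by
      have h := harmonic_le_one_add_log N
      rw [harmonic_eq_sum_Icc] at h
      push_cast at h
      simpa [one_div] using h
    have hterm : ∀ j ∈ Finset.Icc 1 N, 1 / max 1 |((j : ℤ) : ℝ)| = 1 / (j : ℝ) := by
      intro j hj
      have : (1 : ℝ) ≤ j := by exact_mod_cast (Finset.mem_Icc.1 hj).1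
      simp [this]
    have hterm' : ∀ j ∈ Finset.Icc 1 N, 1 / max 1 |((-(j : ℤ) : ℤ) : ℝ)| = 1 / (j : ℝ) := by
      intro j hj
      have : (1 : ℝ) ≤ j := by exact_mod_cast (Finset.mem_Icc.1 hj).1
      simp [this]
    calc _ ≤ ∑ m ∈ {0} ∪ ((Finset.Icc 1 N).image (fun j : ℕ => (j : ℤ)) ∪
        (Finset.Icc 1 N).image (fun j : ℕ => -(j : ℤ))), 1 / max 1 |(m : ℝ)| :=
          Finset.sum_le_sum_of_subset_of_nonneg hsub fun _ _ _ => by positivity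
      _ ≤ ∑ m ∈ {(0 : ℤ)}, 1 / max 1 |(m : ℝ)| +
          (∑ m ∈ (Finset.Icc 1 N).image (fun j : ℕ => (j : ℤ)), 1 / max 1 |(m : ℝ)| +
          ∑ m ∈ (Finset.Icc 1 N).image (fun j : ℕ => -(j : ℤ)), 1 / max 1 |(m : ℝ)|) := by
          have hu : ∀ s t : Finset ℤ, ∑ m ∈ s ∪ t, 1 / max 1 |(m : ℝ)| ≤
              ∑ m ∈ s, 1 / max 1 |(m : ℝ)| + ∑ m ∈ t, 1 / max 1 |(m : ℝ)| := by
            intro s t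
            rw [← Finset.sum_union_inter]
            have : 0 ≤ ∑ m ∈ s ∩ t, 1 / max 1 |(m : ℝ)| :=
              Finset.sum_nonneg fun _ _ => by positivity
            linarith
          exact (hu _ _).trans (add_le_add le_rfl (hu _ _))
      _ ≤ 1 + ((1 + Real.log N) + (1 + Real.log N)) := by
          rw [Finset.sum_image (by simp), Finset.sum_image (by simp), Finset.sum_congr rfl hterm,
            Finset.sum_congr rfl hterm']
          gcongr
          simp
      _ = _ := by ring
  rw [h1, Finset.prod_const, Finset.card_univ, Fintype.card_fin]
  exact pow_le_pow_left₀ (Finset.sum_nonneg fun _ _ => by positivity) h2 n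

/-! ### Sums of multiplicative functions over integers with `l` prime factors. -/

/-- The positive integers up to `X` with exactly `l` distinct prime factors. -/
def omegaSet (X l : ℕ) : Finset ℕ := (Finset.Icc 1 X).filter fun q => q.primeFactors.card = l

/-- The prime powers up to `X`. -/
def primePowers (X : ℕ) : Finset ℕ := (Finset.Icc 1 X).filter IsPrimePow

/-- The multiplicative function with prescribed values on prime powers. -/
def mulExt (g : ℕ → ℝ) (q : ℕ) : ℝ := ∏ p ∈ q.primeFactors, g (p ^ q.factorization p)

theorem mulExt_nonneg {g : ℕ → ℝ} (hg : ∀ r, 0 ≤ g r) (q : ℕ) : 0 ≤ mulExt g q :=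
  Finset.prod_nonneg fun _ _ => hg _

theorem mulExt_cast {q : ℕ} (hq : q ≠ 0) : mulExt (fun r => (r : ℝ)) q = q := by
  conv_rhs => rw [← Nat.prod_factorization_pow_eq_self hq]
  unfold mulExt
  simp only
  rw [Finsupp.prod, Nat.support_factorization]
  push_cast
  rfl

theorem mulExt_div_cast (g : ℕ → ℝ) {q : ℕ} (hq : q ≠ 0) :
    mulExt (fun r => g r / r) q = mulExt g q / q := by
  rw [← mulExt_cast hq]
  exact Finset.prod_div_distrib _ _

theorem primeFactors_ordCompl (q p : ℕ) :
    (q / p ^ q.factorization p).primeFactors = q.primeFactors.erase p := by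
  rw [← Nat.support_factorization, Nat.factorization_ordCompl, Finsupp.support_erase,
    Nat.support_factorization]

theorem mulExt_eq (g : ℕ → ℝ) {q p : ℕ} (hp : p ∈ q.primeFactors) :
    mulExt g q = g (p ^ q.factorization p) * mulExt g (q / p ^ q.factorization p) := by
  unfold mulExt
  rw [← Finset.mul_prod_erase _ _ hp, primeFactors_ordCompl]
  congr 1
  refine Finset.prod_congr rfl fun p' hp' => ?_
  rw [Nat.factorization_ordCompl, Finsupp.erase_ne (Finset.ne_of_mem_erase hp')]

/-- Splitting off the full power of one prime is injective on pairs `(q, p)`: the prime is recovered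
as the least factor of the power, and `q` as the product. The right side forgets coprimality, which
only enlarges it. -/
theorem sum_omegaSet_succ_le (Φ : ℕ → ℕ → ℝ) (hΦ : ∀ r m, 0 ≤ Φ r m) (X l : ℕ) :
    ∑ q ∈ omegaSet X (l + 1), ∑ p ∈ q.primeFactors,
        Φ (p ^ q.factorization p) (q / p ^ q.factorization p) ≤
      ∑ m ∈ omegaSet X l, ∑ r ∈ primePowers (X / m), Φ r m := by
  classical
  rw [Finset.sum_sigma', Finset.sum_sigma']
  set φ : (Σ _ : ℕ, ℕ) → (Σ _ : ℕ, ℕ) := fun x =>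
    ⟨x.1 / x.2 ^ x.1.factorization x.2, x.2 ^ x.1.factorization x.2⟩ with hφ
  have key : ∀ x ∈ (omegaSet X (l + 1)).sigma fun q => q.primeFactors,
      x.2.Prime ∧ x.1.factorization x.2 ≠ 0 ∧ x.1 ≠ 0 ∧ x.1 ≤ X ∧
        x.1.primeFactors.card = l + 1 ∧ x.2 ∈ x.1.primeFactors := by
    intro x hx
    simp only [Finset.mem_sigma, omegaSet, Finset.mem_filter, Finset.mem_Icc] at hx
    obtain ⟨⟨⟨h1, h2⟩, h3⟩, h4⟩ := hx
    have hp := Nat.prime_of_mem_primeFactors h4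
    refine ⟨hp, ?_, by omega, h2, h3, h4⟩
    exact (hp.factorization_pos_of_dvd (by omega) (Nat.dvd_of_mem_primeFactors h4)).ne'
  have hinj : Set.InjOn φ ((omegaSet X (l + 1)).sigma fun q => q.primeFactors : Finset _) := by
    intro x hx y hy hxy
    obtain ⟨hp, hf, h0, -⟩ := key x hx
    obtain ⟨hp', hf', h0', -⟩ := key y hy
    simp only [hφ, Sigma.mk.injEq, heq_eq_eq] at hxy
    have e1 : x.2 = y.2 := by
      have := congrArg Nat.minFac hxy.2
      rwa [Nat.Prime.pow_minFac hp hf, Nat.Prime.pow_minFac hp' hf'] at this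
    have e2 : x.1 = y.1 := by
      rw [← Nat.ordProj_mul_ordCompl_eq_self x.1 x.2, ← Nat.ordProj_mul_ordCompl_eq_self y.1 y.2,
        hxy.1, hxy.2]
    ext
    · exact e2
    · exact heq_of_eq e1
  rw [← Finset.sum_image (s := (omegaSet X (l + 1)).sigma fun q => q.primeFactors) (g := φ)
    (f := fun y => Φ y.2 y.1) hinj]
  refine Finset.sum_le_sum_of_subset_of_nonneg ?_ fun _ _ _ => hΦ _ _
  intro y hy
  obtain ⟨x, hx, rfl⟩ := Finset.mem_image.1 hy
  obtain ⟨hp, hf, h0, hX, hcard, hmem⟩ := key x hx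
  have hpow : 0 < x.2 ^ x.1.factorization x.2 := pow_pos hp.pos _
  have hco : 0 < x.1 / x.2 ^ x.1.factorization x.2 := Nat.ordCompl_pos _ h0
  have heq := Nat.ordProj_mul_ordCompl_eq_self x.1 x.2
  simp only [hφ, Finset.mem_sigma, omegaSet, primePowers, Finset.mem_filter, Finset.mem_Icc]
  refine ⟨⟨⟨hco, ?_⟩, ?_⟩, ⟨hpow, ?_⟩, hp.isPrimePow.pow hf⟩
  · exact (Nat.div_le_self _ _).trans hX
  · rw [primeFactors_ordCompl, Finset.card_erase_of_mem hmem, hcard]; rfl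
  · rw [Nat.le_div_iff_mul_le hco, heq]; exact hX

theorem primePowers_mono {X Y : ℕ} (h : X ≤ Y) : primePowers X ⊆ primePowers Y :=
  Finset.filter_subset_filter _ (Finset.Icc_subset_Icc_right h)

/-- Each `q` with `l + 1` prime factors arises `l + 1` times by splitting off a prime power; this
produces the factorial by induction. -/
theorem sum_mulExt_le {g : ℕ → ℝ} (hg : ∀ r, 0 ≤ g r) (X l : ℕ) :
    ∑ q ∈ omegaSet X l, mulExt g q ≤ (∑ r ∈ primePowers X, g r) ^ l / (l.factorial : ℝ) := by
  have hs : 0 ≤ ∑ r ∈ primePowers X, g r := Finset.sum_nonneg fun _ _ => hg _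
  induction l with
  | zero =>
    have : ∀ q ∈ omegaSet X 0, q = 1 := by
      intro q hq
      simp only [omegaSet, Finset.mem_filter, Finset.mem_Icc, Finset.card_eq_zero,
        Nat.primeFactors_eq_empty] at hq
      omega
    calc _ ≤ ∑ q ∈ {1}, mulExt g q :=
          Finset.sum_le_sum_of_subset_of_nonneg (fun q hq => Finset.mem_singleton.2 (this q hq))
            fun _ _ _ => mulExt_nonneg hg _
      _ = _ := by simp [mulExt]
  | succ l ih =>
    have h1 : ((l : ℝ) + 1) * ∑ q ∈ omegaSet X (l + 1), mulExt g q =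
        ∑ q ∈ omegaSet X (l + 1), ∑ p ∈ q.primeFactors,
          g (p ^ q.factorization p) * mulExt g (q / p ^ q.factorization p) := by
      rw [Finset.mul_sum]
      refine Finset.sum_congr rfl fun q hq => ?_
      rw [Finset.sum_congr rfl fun p hp => (mulExt_eq g hp).symm, Finset.sum_const,
        (Finset.mem_filter.1 hq).2, nsmul_eq_mul]
      push_cast; rfl
    have h2 := sum_omegaSet_succ_le (fun r m => g r * mulExt g m)
      (fun r m => mul_nonneg (hg r) (mulExt_nonneg hg m)) X l
    have h3 : ∑ m ∈ omegaSet X l, ∑ r ∈ primePowers (X / m), g r * mulExt g m ≤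
        (∑ r ∈ primePowers X, g r) * ∑ m ∈ omegaSet X l, mulExt g m := by
      rw [Finset.mul_sum]
      refine Finset.sum_le_sum fun m _ => ?_
      rw [← Finset.sum_mul]
      exact mul_le_mul_of_nonneg_right (Finset.sum_le_sum_of_subset_of_nonneg
        (primePowers_mono (Nat.div_le_self _ _)) fun _ _ _ => hg _) (mulExt_nonneg hg m)
    have h4 := h1.le.trans (h2.trans (h3.trans (mul_le_mul_of_nonneg_left ih hs)))
    rw [Nat.factorial_succ, pow_succ]
    push_cast
    rw [le_div_iff₀ (by positivity)]
    calc _ = (l.factorial : ℝ) * (((l : ℝ) + 1) * ∑ q ∈ omegaSet X (l + 1), mulExt g q) := by ring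
      _ ≤ (l.factorial : ℝ) * ((∑ r ∈ primePowers X, g r) *
          ((∑ r ∈ primePowers X, g r) ^ l / (l.factorial : ℝ))) := by gcongr
      _ = _ := by field_simp

theorem log_eq_sum_primeFactors {q : ℕ} (hq : q ≠ 0) :
    Real.log q = ∑ p ∈ q.primeFactors, Real.log ((p ^ q.factorization p : ℕ) : ℝ) := by
  conv_lhs => rw [← Nat.prod_factorization_pow_eq_self hq]
  rw [Finsupp.prod, Nat.support_factorization, Nat.cast_prod, Real.log_prod]
  intro p hp
  have := (Nat.prime_of_mem_primeFactors hp).pos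
  positivity

/-- The Hardy–Ramanujan device: write `log q` as a sum over the prime powers of `q` and sum over the
chosen one first. The hypothesis gives `B X / m` for the inner sum, leaving a sum of `g(m)/m`. For
`q > √X` the logarithm is then a gain of order `log X`. -/
theorem sum_mulExt_mul_log_le {g : ℕ → ℝ} (hg : ∀ r, 0 ≤ g r) {B : ℝ} (hB0 : 0 ≤ B) (X l : ℕ)
    (hB : ∀ Y ≤ X, ∑ r ∈ primePowers Y, g r * Real.log r ≤ B * Y) :
    ∑ q ∈ omegaSet X (l + 1), mulExt g q * Real.log q ≤
      B * X * ((∑ r ∈ primePowers X, g r / r) ^ l / (l.factorial : ℝ)) := by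
  have h1 : ∑ q ∈ omegaSet X (l + 1), mulExt g q * Real.log q =
      ∑ q ∈ omegaSet X (l + 1), ∑ p ∈ q.primeFactors,
        g (p ^ q.factorization p) * Real.log ((p ^ q.factorization p : ℕ) : ℝ) *
          mulExt g (q / p ^ q.factorization p) := by
    refine Finset.sum_congr rfl fun q hq => ?_
    have hq0 : q ≠ 0 := by
      have := (Finset.mem_Icc.1 (Finset.mem_filter.1 hq).1).1
      omega
    rw [log_eq_sum_primeFactors hq0, Finset.mul_sum]
    refine Finset.sum_congr rfl fun p hp => ?_
    rw [mulExt_eq g hp]; ring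
  have h2 := sum_omegaSet_succ_le (fun r m => g r * Real.log r * mulExt g m)
      (fun r m => mul_nonneg (mul_nonneg (hg r) (Real.log_natCast_nonneg r))
        (mulExt_nonneg hg m)) X l
  rw [h1]
  refine h2.trans ?_
  have h3 : ∀ m ∈ omegaSet X l, ∑ r ∈ primePowers (X / m), g r * Real.log r * mulExt g m ≤
      B * X * mulExt (fun r => g r / r) m := by
    intro m hm
    have hm0 : m ≠ 0 := by
      have := (Finset.mem_Icc.1 (Finset.mem_filter.1 hm).1).1
      omega
    rw [← Finset.sum_mul, mulExt_div_cast g hm0]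
    have h4 := hB (X / m) (Nat.div_le_self _ _)
    have h5 : ((X / m : ℕ) : ℝ) ≤ X / m := Nat.cast_div_le
    calc _ ≤ B * (X / m : ℕ) * mulExt g m :=
          mul_le_mul_of_nonneg_right h4 (mulExt_nonneg hg m)
      _ ≤ B * (X / m) * mulExt g m := by
          have := mulExt_nonneg hg m
          gcongr
      _ = _ := by ring
  refine (Finset.sum_le_sum h3).trans ?_
  rw [← Finset.mul_sum]
  exact mul_le_mul_of_nonneg_left
    (sum_mulExt_le (fun r => div_nonneg (hg r) (by positivity)) X l) (by positivity)

/-! ### A lower bound for elementary symmetric sums. -/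

/-- The elementary symmetric sums of a finite family. -/
def elemSymm {ι : Type*} (T : Finset ι) (x : ι → ℝ) (m : ℕ) : ℝ :=
  ∑ t ∈ T.powersetCard m, ∏ i ∈ t, x i

theorem elemSymm_succ {ι : Type*} [DecidableEq ι] (T : Finset ι) (x : ι → ℝ) (m : ℕ) :
    ((m : ℝ) + 1) * elemSymm T x (m + 1) =
      ∑ t ∈ T.powersetCard m, (∏ i ∈ t, x i) * ∑ j ∈ T \ t, x j := by
  have h1 : ((m : ℝ) + 1) * elemSymm T x (m + 1) =
      ∑ t ∈ T.powersetCard (m + 1), ∑ j ∈ t, ∏ i ∈ t, x i := by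
    rw [elemSymm, Finset.mul_sum]
    refine Finset.sum_congr rfl fun t ht => ?_
    rw [Finset.sum_const, (Finset.mem_powersetCard.1 ht).2, nsmul_eq_mul]
    push_cast; rfl
  rw [h1]
  simp_rw [Finset.mul_sum]
  rw [Finset.sum_sigma', Finset.sum_sigma']
  refine Finset.sum_bij' (fun y _ => ⟨y.1.erase y.2, y.2⟩) (fun y _ => ⟨insert y.2 y.1, y.2⟩)
    ?_ ?_ ?_ ?_ ?_
  · rintro ⟨t, j⟩ h
    simp only [Finset.mem_sigma, Finset.mem_powersetCard, Finset.mem_sdiff] at h ⊢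
    refine ⟨⟨(Finset.erase_subset _ _).trans h.1.1, ?_⟩, h.1.1 h.2, Finset.notMem_erase _ _⟩
    rw [Finset.card_erase_of_mem h.2, h.1.2]; rfl
  · rintro ⟨t, j⟩ h
    simp only [Finset.mem_sigma, Finset.mem_powersetCard, Finset.mem_sdiff] at h ⊢
    refine ⟨⟨Finset.insert_subset h.2.1 h.1.1, ?_⟩, Finset.mem_insert_self _ _⟩
    rw [Finset.card_insert_of_notMem h.2.2, h.1.2]
  · rintro ⟨t, j⟩ h
    simp only [Finset.mem_sigma] at h
    simp [Finset.insert_erase h.2]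
  · rintro ⟨t, j⟩ h
    simp only [Finset.mem_sigma, Finset.mem_sdiff] at h
    simp [Finset.erase_insert h.2.2]
  · rintro ⟨t, j⟩ h
    simp only [Finset.mem_sigma] at h
    rw [mul_comm]
    exact (Finset.mul_prod_erase t x h.2).symm

/-- When a chosen set of `m ≤ K` elements is extended by one more, the elements already used have
total at most `K M`, so the available ones still sum to at least `σ`. -/
theorem le_elemSymm {ι : Type*} (T : Finset ι) {x : ι → ℝ} {M σ : ℝ}
    (hx0 : ∀ i ∈ T, 0 ≤ x i) (hxM : ∀ i ∈ T, x i ≤ M) (hM : 0 ≤ M) (hσ0 : 0 ≤ σ) (K : ℕ)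
    (hσ : σ + K * M ≤ ∑ i ∈ T, x i) (m : ℕ) (hm : m ≤ K + 1) :
    σ ^ m / (m.factorial : ℝ) ≤ elemSymm T x m := by
  classical
  induction m with
  | zero => simp [elemSymm]
  | succ m ih =>
    have ih := ih (by omega)
    have h1 := elemSymm_succ T x m
    have h2 : σ * elemSymm T x m ≤
        ∑ t ∈ T.powersetCard m, (∏ i ∈ t, x i) * ∑ j ∈ T \ t, x j := by
      rw [elemSymm, Finset.mul_sum]
      refine Finset.sum_le_sum fun t ht => ?_
      obtain ⟨hts, htc⟩ := Finset.mem_powersetCard.1 ht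
      rw [mul_comm]
      refine mul_le_mul_of_nonneg_left ?_ (Finset.prod_nonneg fun i hi => hx0 i (hts hi))
      have h3 := Finset.sum_sdiff hts (f := x)
      have h4 : ∑ i ∈ t, x i ≤ K * M := by
        calc ∑ i ∈ t, x i ≤ t.card • M := Finset.sum_le_card_nsmul _ _ _ fun i hi => hxM i (hts hi)
          _ = m * M := by rw [htc, nsmul_eq_mul]
          _ ≤ K * M := by
              gcongr; omega
      linarith
    rw [Nat.factorial_succ, pow_succ]
    push_cast
    rw [div_le_iff₀ (by positivity)]
    calc _ = (m.factorial : ℝ) * (σ * (σ ^ m / (m.factorial : ℝ))) := by field_simp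
      _ ≤ (m.factorial : ℝ) * (σ * elemSymm T x m) := by gcongr
      _ ≤ (m.factorial : ℝ) * (((m : ℝ) + 1) * elemSymm T x (m + 1)) := by
          rw [h1]; gcongr
      _ = _ := by ring

/-! ### Smooth and rough parts; averaging Weyl sums over the rough part. -/

/-- The part of `q` composed of the primes satisfying a predicate. -/
def primePart (Q : ℕ → Prop) [DecidablePred Q] (q : ℕ) : ℕ :=
  ∏ p ∈ q.primeFactors.filter Q, p ^ q.factorization p

theorem primePart_pos (Q : ℕ → Prop) [DecidablePred Q] (q : ℕ) : 0 < primePart Q q :=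
  Finset.prod_pos fun _ hp =>
    pow_pos (Nat.prime_of_mem_primeFactors (Finset.mem_filter.1 hp).1).pos _

theorem primePart_mul_not (Q : ℕ → Prop) [DecidablePred Q] {q : ℕ} (hq : q ≠ 0) :
    primePart Q q * primePart (fun p => ¬ Q p) q = q := by
  conv_rhs => rw [← Nat.prod_factorization_pow_eq_self hq]
  rw [Finsupp.prod, Nat.support_factorization, primePart, primePart,
    Finset.prod_filter_mul_prod_filter_not]

theorem primeFactors_primePart (Q : ℕ → Prop) [DecidablePred Q] (q : ℕ) :
    (primePart Q q).primeFactors = q.primeFactors.filter Q := by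
  ext p
  simp only [Nat.mem_primeFactors_of_ne_zero (primePart_pos Q q).ne', Finset.mem_filter]
  constructor
  · rintro ⟨hp, hd⟩
    obtain ⟨p', hp', hd'⟩ := (Prime.dvd_finsetProd_iff hp.prime _).1 hd
    obtain ⟨hp1, hp2⟩ := Finset.mem_filter.1 hp'
    have := (Nat.prime_dvd_prime_iff_eq hp (Nat.prime_of_mem_primeFactors hp1)).1
      (hp.dvd_of_dvd_pow hd')
    subst this
    exact ⟨hp1, hp2⟩
  · rintro ⟨hp1, hp2⟩
    have hp := Nat.prime_of_mem_primeFactors hp1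
    refine ⟨hp, ?_⟩
    refine dvd_trans ?_ (Finset.dvd_prod_of_mem _ (Finset.mem_filter.2 ⟨hp1, hp2⟩))
    refine dvd_pow_self _ (Finsupp.mem_support_iff.1 ?_)
    rwa [Nat.support_factorization]

theorem coprime_primePart (Q : ℕ → Prop) [DecidablePred Q] (q : ℕ) :
    (primePart Q q).Coprime (primePart (fun p => ¬ Q p) q) := by
  rw [← Nat.disjoint_primeFactors (primePart_pos _ _).ne' (primePart_pos _ _).ne',
    primeFactors_primePart, primeFactors_primePart]
  exact Finset.disjoint_filter_filter_not _ _ _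

theorem rho_eq_prod (A : Family n) {q : ℕ} (hq : q ≠ 0) :
    rho A q = ∏ p ∈ q.primeFactors, rho A (p ^ q.factorization p) := by
  have h := Nat.multiplicative_factorization (fun m => if m = 0 then 0 else rho A m) ?_ ?_ hq
  · simp only [hq, if_false] at h
    rw [h, Finsupp.prod, Nat.support_factorization]
    refine Finset.prod_congr rfl fun p hp => ?_
    have := (Nat.prime_of_mem_primeFactors hp).pos
    rw [if_neg (by positivity)]
  · intro r s hrs
    by_cases hr : r = 0
    · simp [hr]
    by_cases hs : s = 0
    · simp [hs]
    simp only [hr, hs, mul_eq_zero, or_self, if_false]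
    exact rho_mul A hr hs hrs
  · simp [rho_one]

theorem one_le_rho_ordProj (A : Family n) {q p : ℕ} (hq : q ≠ 0) (h : 1 ≤ rho A q)
    (hp : p ∈ q.primeFactors) : 1 ≤ rho A (p ^ q.factorization p) := by
  rw [rho_eq_prod A hq] at h
  by_contra hcon
  have : rho A (p ^ q.factorization p) = 0 := by omega
  rw [Finset.prod_eq_zero hp this] at h
  omega

open Classical in
/-- The absolute value of the Weyl sum of the cofactor. -/
def twistedWeyl (A : Family n) (h : Fin n → ℤ) (r s : ℕ) : ℝ :=
  if hr : r = 0 then 0 else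
    haveI : NeZero r := ⟨hr⟩
    ‖weyl A r (fun i => (s : ZMod r)⁻¹ * (h i : ZMod r))‖

theorem twistedWeyl_eq (A : Family n) (h : Fin n → ℤ) (r s : ℕ) [NeZero r] :
    twistedWeyl A h r s = ‖weyl A r (fun i => (s : ZMod r)⁻¹ * (h i : ZMod r))‖ := by
  rw [twistedWeyl, dif_neg (NeZero.ne r)]

theorem twistedWeyl_nonneg (A : Family n) (h : Fin n → ℤ) (r s : ℕ) :
    0 ≤ twistedWeyl A h r s := by
  unfold twistedWeyl
  split_ifs
  · rfl
  · exact norm_nonneg _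

open Classical in
/-- The integers up to `M` coprime to `r` and free of primes up to `Z`. -/
def roughSet (r M Z : ℕ) : Finset ℕ :=
  (Finset.Ioc 0 M).filter fun s => s.Coprime r ∧ ∀ p, p.Prime → p ≤ Z → ¬ p ∣ s

/-- Sort the rough `s` by the inverse of their class modulo `r`. The sieve bound is the same for
every class, so it factors out and leaves the sum over all unit multiples of `h`. -/
theorem sum_twistedWeyl_le (A : Family n) (h : Fin n → ℤ) {r : ℕ} (hr : 0 < r) (M : ℕ) {Z : ℕ}
    (hZ : 2 ≤ Z) : ∑ s ∈ roughSet r M Z, twistedWeyl A h r s ≤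
      unitSum A h r * (2 * M / (r.totient * Real.log Z) + (Z : ℝ) ^ 4) := by
  classical
  have : NeZero r := ⟨hr.ne'⟩
  have h1 : ∀ s ∈ roughSet r M Z, twistedWeyl A h r s = ∑ b : (ZMod r)ˣ,
      ‖weyl A r (fun i => (b : ZMod r) * (h i : ZMod r))‖ *
        if (s : ZMod r) = ((b⁻¹ : (ZMod r)ˣ) : ZMod r) then 1 else 0 := by
    intro s hs
    have hs : s.Coprime r := (Finset.mem_filter.1 hs).2.1
    rw [twistedWeyl_eq, Finset.sum_eq_single (ZMod.unitOfCoprime s hs)⁻¹]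
    · rw [inv_inv, ZMod.coe_unitOfCoprime, if_pos rfl, mul_one, ← ZMod.inv_coe_unit,
        ZMod.coe_unitOfCoprime]
    · intro b _ hb
      rw [if_neg, mul_zero]
      intro hsb
      apply hb
      have : ZMod.unitOfCoprime s hs = b⁻¹ := by
        ext; rw [ZMod.coe_unitOfCoprime, hsb]
      rw [this, inv_inv]
    · simp
  rw [Finset.sum_congr rfl h1, Finset.sum_comm, unitSum_eq, Finset.sum_mul]
  refine Finset.sum_le_sum fun b _ => ?_
  rw [← Finset.mul_sum]
  refine mul_le_mul_of_nonneg_left ?_ (norm_nonneg _)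
  refine le_trans ?_ (card_sifted_le (q := r) (b := ((b⁻¹ : (ZMod r)ˣ) : ZMod r).val) (M := M) hr hZ)
  rw [Finset.sum_boole]
  refine Nat.cast_le.2 (Finset.card_le_card fun s hs => ?_)
  obtain ⟨hs1, hs2⟩ := Finset.mem_filter.1 hs
  obtain ⟨hs3, hs4, hs5⟩ := Finset.mem_filter.1 hs1
  refine Finset.mem_filter.2 ⟨hs3, ?_, fun p hp hpZ _ => hs5 p hp hpZ⟩
  rw [← ZMod.natCast_eq_natCast_iff, ZMod.natCast_zmod_val, hs2]

/-- The moduli with large total size and small smooth part. -/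
def goodSet (A : Family n) (X k Z : ℕ) : Finset ℕ :=
  (omegaSet X k).filter fun q => 1 ≤ rho A q ∧ X < q ^ 2 ∧ primePart (· ≤ Z) q ^ 3 ≤ X

/-- The index `j` is the number of prime factors of the rough part. It is at least 1, because `X <
q²` and `r³ ≤ X` exclude `r = q`. As those primes exceed `Z`, it satisfies `Z^j ≤ X`. -/
theorem sum_twistedWeyl_goodSet_le (A : Family n) (h : Fin n → ℤ) (X k Z : ℕ) :
    ∑ q ∈ goodSet A X k Z, twistedWeyl A h (primePart (· ≤ Z) q) (primePart (fun p => ¬ p ≤ Z) q) ≤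
      ∑ j ∈ (Finset.Icc 1 k).filter (fun j => Z ^ j ≤ X),
        ∑ r ∈ (omegaSet X (k - j)).filter (fun r => 1 ≤ rho A r ∧ r ^ 3 ≤ X),
          ∑ s ∈ roughSet r (X / r) Z, twistedWeyl A h r s := by
  classical
  simp_rw [Finset.sum_sigma']
  set φ : ℕ → (Σ _ : ℕ, Σ _ : ℕ, ℕ) := fun q => ⟨(primePart (fun p => ¬ p ≤ Z) q).primeFactors.card,
    primePart (· ≤ Z) q, primePart (fun p => ¬ p ≤ Z) q⟩ with hφ
  have hinj : Set.InjOn φ (goodSet A X k Z) := by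
    intro q hq q' hq' he
    simp only [hφ, Sigma.mk.injEq, heq_eq_eq] at he
    have hq0 : ∀ q ∈ goodSet A X k Z, q ≠ 0 := by
      intro q hq
      simp only [goodSet, omegaSet, Finset.mem_filter, Finset.mem_Icc] at hq
      omega
    rw [← primePart_mul_not (· ≤ Z) (hq0 q hq), ← primePart_mul_not (· ≤ Z) (hq0 q' hq'), he.2.1,
      he.2.2]
  rw [← Finset.sum_image (g := φ) (f := fun y => twistedWeyl A h y.2.1 y.2.2) hinj]
  refine Finset.sum_le_sum_of_subset_of_nonneg ?_ fun _ _ _ => twistedWeyl_nonneg _ _ _ _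
  intro y hy
  obtain ⟨q, hq, rfl⟩ := Finset.mem_image.1 hy
  simp only [goodSet, omegaSet, Finset.mem_filter, Finset.mem_Icc] at hq
  obtain ⟨⟨⟨h1, h2⟩, h3⟩, h4, h5, h6⟩ := hq
  have hq0 : q ≠ 0 := by omega
  have hmul := primePart_mul_not (· ≤ Z) hq0
  have hcop := coprime_primePart (· ≤ Z) q
  have hpf1 := primeFactors_primePart (· ≤ Z) q
  have hpf2 := primeFactors_primePart (fun p => ¬ p ≤ Z) q
  have hcard : (primePart (· ≤ Z) q).primeFactors.card +
      (primePart (fun p => ¬ p ≤ Z) q).primeFactors.card = k := by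
    rw [hpf1, hpf2, Finset.card_filter_add_card_filter_not, h3]
  have hr0 := primePart_pos (· ≤ Z) q
  have hs0 := primePart_pos (fun p => ¬ p ≤ Z) q
  simp only [hφ, Finset.mem_sigma, Finset.mem_filter, Finset.mem_Icc, omegaSet, roughSet,
    Finset.mem_Ioc]
  set r := primePart (· ≤ Z) q
  set s := primePart (fun p => ¬ p ≤ Z) q
  have hs1 : s ≠ 1 := by
    intro hs
    rw [hs, mul_one] at hmul
    rw [hmul] at h6
    nlinarith
  have hj : 1 ≤ s.primeFactors.card := by
    rw [Nat.one_le_iff_ne_zero, Ne, Finset.card_eq_zero, Nat.primeFactors_eq_empty]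
    omega
  have hrq : r ≤ X := by
    refine le_trans (Nat.le_of_dvd (by omega) ⟨s, hmul.symm⟩) h2
  refine ⟨⟨⟨hj, by omega⟩, ?_⟩, ⟨⟨⟨hr0, hrq⟩, by omega⟩, ?_, h6⟩, ⟨hs0, ?_⟩, hcop.symm, ?_⟩
  · calc Z ^ s.primeFactors.card ≤ ∏ p ∈ s.primeFactors, p := by
          refine Finset.pow_card_le_prod _ _ _ fun p hp => ?_
          rw [hpf2] at hp
          exact (not_le.1 (Finset.mem_filter.1 hp).2).le
      _ ≤ s := Nat.le_of_dvd hs0 (Nat.prod_primeFactors_dvd s)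
      _ ≤ q := Nat.le_of_dvd (by omega) ⟨r, by rw [mul_comm]; exact hmul.symm⟩
      _ ≤ X := h2
  · rw [← hmul] at h4
    exact ((one_le_rho_of_mul A hr0.ne' hs0.ne' hcop).1 h4).1
  · rw [Nat.le_div_iff_mul_le hr0, mul_comm, hmul]; exact h2
  · intro p hp hpZ hps
    have : p ∈ s.primeFactors := Nat.mem_primeFactors.2 ⟨hp, hps, hs0.ne'⟩
    rw [hpf2] at this
    exact (Finset.mem_filter.1 this).2 hpZ

open Classical in
/-- The average of the Weyl sums on prime powers with nonempty `A_r`. -/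
def avgWeight (A : Family n) (h : Fin n → ℤ) (r : ℕ) : ℝ :=
  if 1 ≤ rho A r then unitAvg A h r else 0

theorem avgWeight_nonneg (A : Family n) (h : Fin n → ℤ) (r : ℕ) : 0 ≤ avgWeight A h r := by
  unfold avgWeight; split_ifs
  · exact unitAvg_nonneg _ _ _
  · rfl

theorem avgWeight_le_one (A : Family n) (h : Fin n → ℤ) (r : ℕ) : avgWeight A h r ≤ 1 := by
  unfold avgWeight; split_ifs
  · exact unitAvg_le_one _ _ _
  · norm_num

theorem unitAvg_eq_mulExt (A : Family n) (h : Fin n → ℤ) {r : ℕ} (hr : r ≠ 0) (hρ : 1 ≤ rho A r) :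
    unitAvg A h r = mulExt (avgWeight A h) r := by
  rw [unitAvg_eq_prod A h hr, mulExt]
  refine Finset.prod_congr rfl fun p hp => ?_
  rw [avgWeight, if_pos (one_le_rho_ordProj A hr hρ hp)]

theorem sum_weyl_goodSet_le (A : Family n) (h : Fin n → ℤ) {X k Z : ℕ} (hZ : 2 ≤ Z)
    (hZX : Z ^ 15 ≤ X) :
    ∑ q ∈ goodSet A X k Z, twistedWeyl A h (primePart (· ≤ Z) q) (primePart (fun p => ¬ p ≤ Z) q) ≤
      4 * X / Real.log Z * ∑ j ∈ (Finset.Icc 1 k).filter (fun j => Z ^ j ≤ X),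
        (∑ r ∈ primePowers X, avgWeight A h r / r) ^ (k - j) / ((k - j).factorial : ℝ) := by
  refine (sum_twistedWeyl_goodSet_le A h X k Z).trans ?_
  rw [Finset.mul_sum]
  refine Finset.sum_le_sum fun j _ => ?_
  have hl : 0 < Real.log Z := Real.log_pos (by exact_mod_cast hZ)
  have hlZ : Real.log Z ≤ Z := (Real.log_le_sub_one_of_pos (by positivity)).trans (by linarith)
  have h1 : ∀ r ∈ (omegaSet X (k - j)).filter (fun r => 1 ≤ rho A r ∧ r ^ 3 ≤ X),
      ∑ s ∈ roughSet r (X / r) Z, twistedWeyl A h r s ≤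
        4 * X / Real.log Z * mulExt (fun r => avgWeight A h r / r) r := by
    intro r hr
    simp only [omegaSet, Finset.mem_filter, Finset.mem_Icc] at hr
    obtain ⟨⟨⟨hr1, hr2⟩, -⟩, hr4, hr5⟩ := hr
    have hr0 : (0 : ℝ) < r := by exact_mod_cast hr1
    have ht : (0 : ℝ) < r.totient := by exact_mod_cast Nat.totient_pos.2 hr1
    have htr : (r.totient : ℝ) ≤ r := by exact_mod_cast Nat.totient_le r
    refine (sum_twistedWeyl_le A h hr1 (X / r) hZ).trans ?_
    rw [mulExt_div_cast _ (by omega), ← unitAvg_eq_mulExt A h (by omega) hr4, unitAvg]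
    have h2 : ((X / r : ℕ) : ℝ) ≤ X / r := Nat.cast_div_le
    -- The conditions `r³ ≤ X` and `Z¹⁵ ≤ X` are calibrated for this: it makes the sieve remainder
    -- `Z⁴` no larger than the main term.
    have h3 : (Z : ℝ) ^ 5 * (r : ℝ) ^ 2 ≤ X := by
      have hn : (Z ^ 5 * r ^ 2) ^ 3 ≤ X ^ 3 := by
        calc (Z ^ 5 * r ^ 2) ^ 3 = Z ^ 15 * (r ^ 3) ^ 2 := by ring
          _ ≤ X * X ^ 2 := by gcongr
          _ = X ^ 3 := by ring
      have := le_of_pow_le_pow_left₀ (by norm_num) (Nat.zero_le _) hn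
      exact_mod_cast this
    have h4 : (Z : ℝ) ^ 4 ≤ 2 * (X / r) / (r.totient * Real.log Z) := by
      rw [le_div_iff₀ (by positivity), mul_div_assoc', le_div_iff₀ hr0]
      calc (Z : ℝ) ^ 4 * (r.totient * Real.log Z) * r ≤ (Z : ℝ) ^ 4 * (r * Z) * r := by gcongr
        _ = (Z : ℝ) ^ 5 * (r : ℝ) ^ 2 := by ring
        _ ≤ X := h3
        _ ≤ 2 * X := by have : (0 : ℝ) ≤ X := by positivity
                        linarith
    have h5 : 2 * ((X / r : ℕ) : ℝ) / (r.totient * Real.log Z) + (Z : ℝ) ^ 4 ≤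
        2 * (X / r) / (r.totient * Real.log Z) + 2 * (X / r) / (r.totient * Real.log Z) := by
      gcongr
    calc _ ≤ unitSum A h r * (2 * (X / r) / (r.totient * Real.log Z) +
          2 * (X / r) / (r.totient * Real.log Z)) :=
          mul_le_mul_of_nonneg_left h5 (unitSum_nonneg _ _ _)
      _ = _ := by field_simp; ring
  refine (Finset.sum_le_sum h1).trans ?_
  rw [← Finset.mul_sum]
  refine mul_le_mul_of_nonneg_left ?_ (by positivity)
  have hnn : ∀ r : ℕ, 0 ≤ avgWeight A h r / r :=
    fun r => div_nonneg (avgWeight_nonneg A h r) (by positivity)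
  refine le_trans ?_ (sum_mulExt_le hnn X (k - j))
  exact Finset.sum_le_sum_of_subset_of_nonneg (Finset.filter_subset _ _)
    fun _ _ _ => mulExt_nonneg hnn _

/-! ### The averaged Weyl sums summed over prime powers. -/

theorem sum_primePowers_eq (f : ℕ → ℝ) (X : ℕ) :
    ∑ r ∈ primePowers X, f r = ∑ p ∈ (Finset.Icc 1 X).filter Nat.Prime, f p +
      ∑ r ∈ (primePowers X).filter (fun r => ¬ r.Prime), f r := by
  rw [← Finset.sum_filter_add_sum_filter_not (primePowers X) Nat.Prime]
  congr 2
  ext r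
  simp only [primePowers, Finset.mem_filter]
  exact ⟨fun h => ⟨h.1.1, h.2⟩, fun h => ⟨⟨h.1, h.2.isPrimePow⟩, h.2⟩⟩

theorem exists_sum_nonprime_le : ∃ C : ℝ, 0 < C ∧ ∀ X : ℕ,
    ∑ r ∈ (primePowers X).filter (fun r => ¬ r.Prime), (r : ℝ) ^ (-(5 / 8) : ℝ) ≤ C := by
  obtain ⟨C, hC, h⟩ := exists_sum_rpow_powerful_le
  refine ⟨C, hC, fun X => h _ fun r hr => ?_⟩
  obtain ⟨h1, h2⟩ := Finset.mem_filter.1 hr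
  exact isPrimePow_not_prime_eq (Finset.mem_filter.1 h1).2 h2

theorem sum_primesQ_eq (A : Family n) (X : ℕ) (f : ℕ → ℝ) :
    ∑ p ∈ primesQ A X, f p =
      ∑ p ∈ (Finset.Icc 1 X).filter Nat.Prime, if 1 ≤ rho A p then f p else 0 := by
  rw [primesQ, Nat.floor_natCast, ← Finset.sum_filter, Finset.filter_filter]

/-- Primes not dividing a fixed nonzero coordinate of `h` contribute at most their share of `𝒫̃`.
Those dividing it are bounded trivially and, since the coordinate is at most `N`, cost only about
`log log log N`. Proper prime powers contribute a constant. -/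
theorem exists_sum_avgWeight_le : ∃ C : ℝ, 0 < C ∧ ∀ (n : ℕ) (A : Family n) (X N : ℕ)
    (h : Fin n → ℤ) (T : ℝ), h ∈ (freqBox n N).erase 0 → 2 ≤ T → Real.log N ≤ T →
      ∑ r ∈ primePowers X, avgWeight A h r / r ≤
        calPtilde A X + (Real.log 4 * Real.log (Real.log T) + C) := by
  obtain ⟨C1, hC1, h1⟩ := exists_sum_nonprime_le
  obtain ⟨C2, hC2, h2⟩ := exists_sum_inv_primeFactors_le
  refine ⟨C1 + C2, by positivity, fun n A X N h T hh hT hN => ?_⟩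
  obtain ⟨hne, hbox⟩ := Finset.mem_erase.1 hh
  obtain ⟨i, hi⟩ := Function.ne_iff.1 hne
  have hi0 : (h i).natAbs ≠ 0 := by simpa using hi
  have hiN : (h i).natAbs ≤ N := by
    have := (Fintype.mem_piFinset.1 hbox) i
    have := Finset.mem_Icc.1 this
    omega
  have hlog : Real.log (h i).natAbs ≤ T := by
    refine le_trans (Real.log_le_log (by positivity) ?_) hN
    exact_mod_cast hiN
  have h2 := h2 T hT _ hi0 hlog
  rw [sum_primePowers_eq]
  have hnon : ∑ r ∈ (primePowers X).filter (fun r => ¬ r.Prime), avgWeight A h r / r ≤ C1 := by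
    refine le_trans (Finset.sum_le_sum fun r hr => ?_) (h1 X)
    have hr1 : (1 : ℝ) ≤ r := by
      exact_mod_cast (Finset.mem_Icc.1 (Finset.mem_filter.1 (Finset.mem_filter.1 hr).1).1).1
    calc avgWeight A h r / r ≤ 1 / r := by
          gcongr; exact avgWeight_le_one _ _ _
      _ = (r : ℝ) ^ (-1 : ℝ) := by rw [Real.rpow_neg_one, one_div]
      _ ≤ _ := Real.rpow_le_rpow_of_exponent_le hr1 (by norm_num)
  have hpr : ∑ p ∈ (Finset.Icc 1 X).filter Nat.Prime, avgWeight A h p / p ≤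
      ∑ p ∈ (Finset.Icc 1 X).filter Nat.Prime, ((if 1 ≤ rho A p then
        1 / (p : ℝ) * Real.sqrt ((lam A p : ℝ) / (rho A p : ℝ)) else 0) +
          if p ∈ (h i).natAbs.primeFactors then 1 / (p : ℝ) else 0) := by
    refine Finset.sum_le_sum fun p hp => ?_
    have hp := (Finset.mem_filter.1 hp).2
    by_cases hd : p ∈ (h i).natAbs.primeFactors
    · rw [if_pos hd]
      have h3 : avgWeight A h p / p ≤ 1 / p := by
        gcongr; exact avgWeight_le_one _ _ _
      have h4 : 0 ≤ if 1 ≤ rho A p then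
          1 / (p : ℝ) * Real.sqrt ((lam A p : ℝ) / (rho A p : ℝ)) else 0 := by
        split_ifs <;> positivity
      linarith
    · rw [if_neg hd, add_zero]
      unfold avgWeight
      split_ifs with hρ
      · rw [div_eq_inv_mul, ← one_div]
        refine mul_le_mul_of_nonneg_left (unitAvg_prime_le A h hp ⟨i, fun hdi => hd ?_⟩ hρ)
          (by positivity)
        exact Nat.mem_primeFactors.2 ⟨hp, by exact_mod_cast Int.natCast_dvd.1 hdi, hi0⟩
      · simp
  rw [Finset.sum_add_distrib, ← sum_primesQ_eq A X
    (fun p => 1 / (p : ℝ) * Real.sqrt ((lam A p : ℝ) / (rho A p : ℝ)))] at hpr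
  have hdiv : ∑ p ∈ (Finset.Icc 1 X).filter Nat.Prime,
      (if p ∈ (h i).natAbs.primeFactors then 1 / (p : ℝ) else 0) ≤
        ∑ p ∈ (h i).natAbs.primeFactors, 1 / (p : ℝ) := by
    rw [← Finset.sum_filter]
    refine Finset.sum_le_sum_of_subset_of_nonneg (fun p hp => (Finset.mem_filter.1 hp).2)
      fun _ _ _ => by positivity
  unfold calPtilde
  linarith

/-! ### Rankin's method for moduli with a large smooth part. -/

/-- The weight of Rankin's method. -/
def rankinWeight (A : Family n) (Z : ℕ) (δ : ℝ) (r : ℕ) : ℝ :=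
  if 1 ≤ rho A r then (if r.minFac ≤ Z then (r : ℝ) ^ δ else 1) else 0

theorem rankinWeight_nonneg (A : Family n) (Z : ℕ) (δ : ℝ) (r : ℕ) : 0 ≤ rankinWeight A Z δ r := by
  unfold rankinWeight
  split_ifs <;> positivity

theorem rankinWeight_le (A : Family n) (Z : ℕ) {δ : ℝ} (hδ : 0 ≤ δ) {r : ℕ} (hr : 1 ≤ r) :
    rankinWeight A Z δ r ≤ (r : ℝ) ^ δ := by
  have hr' : (1 : ℝ) ≤ r := by exact_mod_cast hr
  have := Real.one_le_rpow hr' hδ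
  unfold rankinWeight
  split_ifs <;> linarith

theorem mulExt_rankinWeight (A : Family n) (Z : ℕ) (δ : ℝ) {q : ℕ} (hq : q ≠ 0)
    (hρ : 1 ≤ rho A q) :
    mulExt (rankinWeight A Z δ) q = (primePart (· ≤ Z) q : ℝ) ^ δ := by
  unfold mulExt primePart
  push_cast
  rw [← Real.finsetProd_rpow _ _ fun p _ => by positivity, Finset.prod_filter]
  refine Finset.prod_congr rfl fun p hp => ?_
  have hpp := Nat.prime_of_mem_primeFactors hp
  have hf := (hpp.factorization_pos_of_dvd hq (Nat.dvd_of_mem_primeFactors hp)).ne'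
  rw [rankinWeight, if_pos (one_le_rho_ordProj A hq hρ hp), hpp.pow_minFac hf]
  push_cast
  rfl

/-- With `t = δ log p ≤ 10` this is `e^t ≤ 1 + t e^t`. Linearising in `log p` lets Chebyshev-type
sums control the Rankin weight. -/
theorem rpow_le_of_le {Z p : ℕ} {δ : ℝ} (hδ : 0 ≤ δ) (hZ : δ * Real.log Z ≤ 10) (hp : 1 ≤ p)
    (hpZ : p ≤ Z) : (p : ℝ) ^ δ ≤ 1 + Real.exp 10 * (δ * Real.log p) := by
  have hp' : (1 : ℝ) ≤ p := by exact_mod_cast hp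
  have hl : 0 ≤ Real.log p := Real.log_nonneg hp'
  have hle : Real.log p ≤ Real.log Z := Real.log_le_log (by linarith) (by exact_mod_cast hpZ)
  rw [Real.rpow_def_of_pos (by linarith), mul_comm]
  set t := δ * Real.log p
  have ht0 : 0 ≤ t := by positivity
  have ht : t ≤ 10 := le_trans (mul_le_mul_of_nonneg_left hle hδ) hZ
  have h1 : Real.exp t * (1 - t) ≤ 1 := by
    have := Real.one_sub_le_exp_neg t
    calc _ ≤ Real.exp t * Real.exp (-t) := by gcongr
      _ = 1 := by rw [← Real.exp_add]; simp
  have h2 : Real.exp t ≤ Real.exp 10 := Real.exp_le_exp.2 ht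
  nlinarith

theorem exists_sum_rankinWeight_mul_log_le : ∃ B : ℝ, 0 < B ∧ ∀ (n : ℕ) (A : Family n) (Z : ℕ)
    (δ : ℝ), 0 ≤ δ → δ ≤ 1 / 8 → δ * Real.log Z ≤ 10 → ∀ Y : ℕ,
      ∑ r ∈ primePowers Y, rankinWeight A Z δ r * Real.log r ≤ B * Y := by
  obtain ⟨C, hC, h⟩ := exists_sum_nonprime_le
  have h4 : 0 < Real.log 4 := Real.log_pos (by norm_num)
  refine ⟨(1 + Real.exp 10 * 10) * Real.log 4 + 8 * C, by positivity,
    fun n A Z δ hδ0 hδ hZ Y => ?_⟩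
  rw [sum_primePowers_eq, add_mul]
  refine add_le_add ?_ ?_
  · calc _ ≤ ∑ p ∈ (Finset.Icc 1 Y).filter Nat.Prime, (1 + Real.exp 10 * 10) * Real.log p := by
          refine Finset.sum_le_sum fun p hp => ?_
          obtain ⟨hp1, hpp⟩ := Finset.mem_filter.1 hp
          refine mul_le_mul_of_nonneg_right ?_ (Real.log_natCast_nonneg p)
          have hE := Real.exp_pos 10
          unfold rankinWeight
          split_ifs with h1 h2
          · rw [hpp.minFac_eq] at h2
            refine (rpow_le_of_le hδ0 hZ hpp.one_le h2).trans ?_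
            have hle : Real.log p ≤ Real.log Z :=
              Real.log_le_log (by exact_mod_cast hpp.pos) (by exact_mod_cast h2)
            have := mul_le_mul_of_nonneg_left hle hδ0
            have := mul_le_mul_of_nonneg_left (this.trans hZ) hE.le
            linarith
          · linarith
          · linarith
      _ = (1 + Real.exp 10 * 10) * Chebyshev.theta Y := by
          rw [← Finset.mul_sum, Chebyshev.theta_eq_sum_Icc, Nat.floor_natCast]
          congr 2
      _ ≤ (1 + Real.exp 10 * 10) * (Real.log 4 * Y) := by
          gcongr
          exact Chebyshev.theta_le_log4_mul_x (by positivity)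
      _ = _ := by ring
  · calc _ ≤ ∑ r ∈ (primePowers Y).filter (fun r => ¬ r.Prime),
          8 * Y * (r : ℝ) ^ (-(5 / 8) : ℝ) := by
          refine Finset.sum_le_sum fun r hr => ?_
          have hr2 := Finset.mem_Icc.1 (Finset.mem_filter.1 (Finset.mem_filter.1 hr).1).1
          have hr1 : (1 : ℝ) ≤ r := by exact_mod_cast hr2.1
          have hrY : (r : ℝ) ≤ Y := by exact_mod_cast hr2.2
          have h1 := rankinWeight_le A Z hδ0 hr2.1
          have h2 : (r : ℝ) ^ δ ≤ (r : ℝ) ^ (1 / 8 : ℝ) :=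
            Real.rpow_le_rpow_of_exponent_le hr1 hδ
          have h3 : Real.log r ≤ 8 * (r : ℝ) ^ (1 / 8 : ℝ) := by
            have := Real.log_le_rpow_div (x := (r : ℝ)) (by linarith) (by norm_num : (0 : ℝ) < 1 / 8)
            linarith
          calc rankinWeight A Z δ r * Real.log r
              ≤ (r : ℝ) ^ (1 / 8 : ℝ) * (8 * (r : ℝ) ^ (1 / 8 : ℝ)) :=
                mul_le_mul (h1.trans h2) h3 (Real.log_nonneg hr1) (by positivity)
            _ = 8 * (r : ℝ) ^ (1 / 4 : ℝ) := by
                rw [mul_left_comm, ← Real.rpow_add (by linarith)]; norm_num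
            _ ≤ 8 * (r : ℝ) ^ (3 / 8 : ℝ) := by
                gcongr 8 * ?_
                exact Real.rpow_le_rpow_of_exponent_le hr1 (by norm_num)
            _ = 8 * r * (r : ℝ) ^ (-(5 / 8) : ℝ) := by
                rw [mul_assoc]
                conv_rhs => enter [2, 1]; rw [← Real.rpow_one (r : ℝ)]
                rw [← Real.rpow_add (by linarith)]; norm_num
            _ ≤ _ := by gcongr
      _ = 8 * Y * ∑ r ∈ (primePowers Y).filter (fun r => ¬ r.Prime), (r : ℝ) ^ (-(5 / 8) : ℝ) := by
          rw [Finset.mul_sum]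
      _ ≤ 8 * Y * C := by
          gcongr
          exact h Y
      _ = _ := by ring

/-- The excess of `p^δ` over 1 contributes at most a constant times `δ ∑_{p ≤ Z} (log p)/p`, which
is `O(1)` because `δ log Z ≤ 10`. The tilt therefore changes `𝒫` only by a constant. -/
theorem exists_sum_rankinWeight_div_le : ∃ C : ℝ, 0 < C ∧ ∀ (n : ℕ) (A : Family n) (Z : ℕ)
    (δ : ℝ), 1 ≤ Z → 0 ≤ δ → δ ≤ 1 / 8 → δ * Real.log Z ≤ 10 → ∀ X : ℕ,
      ∑ r ∈ primePowers X, rankinWeight A Z δ r / r ≤ calP A X + C := by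
  obtain ⟨C, hC, h⟩ := exists_sum_nonprime_le
  have h4 : 0 < Real.log 4 := Real.log_pos (by norm_num)
  refine ⟨C + Real.exp 10 * (Real.log 4 * 11), by positivity, fun n A Z δ hZ1 hδ0 hδ hZ X => ?_⟩
  have hE := Real.exp_pos 10
  rw [sum_primePowers_eq]
  have hnon : ∑ r ∈ (primePowers X).filter (fun r => ¬ r.Prime), rankinWeight A Z δ r / r ≤ C := by
    refine le_trans (Finset.sum_le_sum fun r hr => ?_) (h X)
    have hr2 := Finset.mem_Icc.1 (Finset.mem_filter.1 (Finset.mem_filter.1 hr).1).1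
    have hr1 : (1 : ℝ) ≤ r := by exact_mod_cast hr2.1
    have h1 := rankinWeight_le A Z hδ0 hr2.1
    have h2 : (r : ℝ) ^ δ ≤ (r : ℝ) ^ (1 / 8 : ℝ) :=
      Real.rpow_le_rpow_of_exponent_le hr1 hδ
    calc rankinWeight A Z δ r / r ≤ (r : ℝ) ^ (1 / 8 : ℝ) / r := by
          gcongr; exact h1.trans h2
      _ = (r : ℝ) ^ (-(7 / 8) : ℝ) := by
          rw [div_eq_mul_inv, ← Real.rpow_neg_one, ← Real.rpow_add (by linarith)]; norm_num
      _ ≤ _ := Real.rpow_le_rpow_of_exponent_le hr1 (by norm_num)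
  have hpr : ∑ p ∈ (Finset.Icc 1 X).filter Nat.Prime, rankinWeight A Z δ p / p ≤
      ∑ p ∈ (Finset.Icc 1 X).filter Nat.Prime, ((if 1 ≤ rho A p then 1 / (p : ℝ) else 0) +
          if p ≤ Z then Real.exp 10 * δ * (Real.log p / p) else 0) := by
    refine Finset.sum_le_sum fun p hp => ?_
    have hpp := (Finset.mem_filter.1 hp).2
    have hp0 : (0 : ℝ) < p := by exact_mod_cast hpp.pos
    have hl : 0 ≤ Real.log p := Real.log_natCast_nonneg p
    unfold rankinWeight
    rw [hpp.minFac_eq]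
    split_ifs with h1 h2
    · calc (p : ℝ) ^ δ / p ≤ (1 + Real.exp 10 * (δ * Real.log p)) / p := by
            gcongr; exact rpow_le_of_le hδ0 hZ hpp.one_le h2
        _ = _ := by ring
    · simp
    · rw [zero_div]; positivity
    · simp
  have hlog := sum_log_div_primes_le (x := (Z : ℝ)) (by exact_mod_cast hZ1)
  rw [Nat.floor_natCast] at hlog
  have hsec : ∑ p ∈ (Finset.Icc 1 X).filter Nat.Prime,
      (if p ≤ Z then Real.exp 10 * δ * (Real.log p / p) else 0) ≤
        Real.exp 10 * (Real.log 4 * 11) := by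
    have hnn : ∀ p : ℕ, 0 ≤ Real.log p / p :=
      fun p => div_nonneg (Real.log_natCast_nonneg p) (by positivity)
    calc _ ≤ ∑ p ∈ (Finset.Icc 1 Z).filter Nat.Prime, Real.exp 10 * δ * (Real.log p / p) := by
          rw [← Finset.sum_filter]
          refine Finset.sum_le_sum_of_subset_of_nonneg (fun p hp => ?_)
            fun p _ _ => mul_nonneg (by positivity) (hnn p)
          simp only [Finset.mem_filter, Finset.mem_Icc] at hp ⊢
          exact ⟨⟨hp.1.1.1, hp.2⟩, hp.1.2⟩
      _ = Real.exp 10 * (δ * ∑ p ∈ (Finset.Icc 1 Z).filter Nat.Prime, Real.log p / p) := by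
          rw [← Finset.mul_sum]; ring
      _ ≤ Real.exp 10 * (δ * (Real.log 4 * (1 + Real.log Z))) := by gcongr
      _ = Real.exp 10 * (Real.log 4 * (δ + δ * Real.log Z)) := by ring
      _ ≤ _ := by
          gcongr
          linarith
  rw [Finset.sum_add_distrib, ← sum_primesQ_eq A X (fun p => 1 / (p : ℝ))] at hpr
  unfold calP
  linarith

/-- The moduli with large smooth part. -/
def badSet (A : Family n) (X k Z : ℕ) : Finset ℕ :=
  (omegaSet X k).filter fun q => 1 ≤ rho A q ∧ X < q ^ 2 ∧ X < primePart (· ≤ Z) q ^ 3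

/-- On the bad set the smooth part exceeds `X^{1/3}`, so with `δ = 10 / log Z` its `δ`-th power is
at least `exp((10/3) log X / log Z)`; also `log q ≥ (log X)/2`. Both gains are played against the
weighted Hardy–Ramanujan bound. The condition `80 ≤ log Z` is `δ ≤ 1/8`. -/
theorem exists_card_badSet_le : ∃ C : ℝ, 0 < C ∧ ∀ (n : ℕ) (A : Family n) (X m Z : ℕ), 2 ≤ X →
    80 ≤ Real.log Z →
      ((badSet A X (m + 1) Z).card : ℝ) ≤ Real.exp (-(10 / 3 * (Real.log X / Real.log Z))) *
        (C * X / Real.log X * ((calP A X + C) ^ m / (m.factorial : ℝ))) := by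
  obtain ⟨B, hB0, hB⟩ := exists_sum_rankinWeight_mul_log_le
  obtain ⟨C, hC0, hC⟩ := exists_sum_rankinWeight_div_le
  refine ⟨2 * B + C, by positivity, fun n A X m Z hX hZ => ?_⟩
  have hlZ : 0 < Real.log Z := by linarith
  set δ : ℝ := 10 / Real.log Z with hδ
  have hδ0 : 0 < δ := by positivity
  have hδ1 : δ ≤ 1 / 8 := by
    rw [hδ, div_le_div_iff₀ hlZ (by norm_num)]; linarith
  have hδZ : δ * Real.log Z ≤ 10 := by rw [hδ]; field_simp; rfl
  have hZ1 : 1 ≤ Z := by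
    rcases Nat.eq_zero_or_pos Z with h | h
    · subst h; simp at hlZ
    · exact h
  have hX1 : (1 : ℝ) < X := by exact_mod_cast hX
  have hlX : 0 < Real.log X := Real.log_pos hX1
  set f := rankinWeight A Z δ
  have h1 := sum_mulExt_mul_log_le (g := f) (rankinWeight_nonneg A Z δ) hB0.le X m
    (fun Y _ => hB n A Z δ hδ0.le hδ1 hδZ Y)
  have h2 : (badSet A X (m + 1) Z).card * (Real.exp (10 / 3 * (Real.log X / Real.log Z)) *
      (Real.log X / 2)) ≤ ∑ q ∈ omegaSet X (m + 1), mulExt f q * Real.log q := by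
    rw [← nsmul_eq_mul]
    refine le_trans (Finset.card_nsmul_le_sum _ (fun q => mulExt f q * Real.log q) _
      fun q hq => ?_) (Finset.sum_le_sum_of_subset_of_nonneg (Finset.filter_subset _ _)
      fun q _ _ => mul_nonneg (mulExt_nonneg (rankinWeight_nonneg A Z δ) q)
        (Real.log_natCast_nonneg q))
    simp only [badSet, omegaSet, Finset.mem_filter, Finset.mem_Icc] at hq
    obtain ⟨⟨⟨hq1, hq2⟩, hq3⟩, hq4, hq5, hq6⟩ := hq
    rw [mulExt_rankinWeight A Z δ (by omega) hq4]
    have hpos := primePart_pos (· ≤ Z) q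
    set r := primePart (· ≤ Z) q
    have hlr : Real.log X ≤ 3 * Real.log r := by
      have : Real.log X ≤ Real.log ((r : ℝ) ^ 3) :=
        Real.log_le_log (by linarith) (by exact_mod_cast hq6.le)
      rwa [Real.log_pow] at this
    have hlq : Real.log X ≤ 2 * Real.log q := by
      have : Real.log X ≤ Real.log ((q : ℝ) ^ 2) :=
        Real.log_le_log (by linarith) (by exact_mod_cast hq5.le)
      rwa [Real.log_pow] at this
    refine mul_le_mul ?_ (by linarith) (by positivity) (by positivity)
    rw [Real.rpow_def_of_pos (by exact_mod_cast hpos)]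
    refine Real.exp_le_exp.2 ?_
    rw [hδ, mul_div_assoc', mul_div_assoc']
    exact div_le_div_of_nonneg_right (by linarith) hlZ.le
  have h3 := h2.trans h1
  have hP : 0 ≤ calP A X := by
    unfold calP
    have : 0 ≤ ∑ p ∈ primesQ A X, 1 / (p : ℝ) := Finset.sum_nonneg fun _ _ => by positivity
    linarith
  have h4 : B * X * ((∑ r ∈ primePowers X, f r / r) ^ m / (m.factorial : ℝ)) ≤
      B * X * ((calP A X + C) ^ m / (m.factorial : ℝ)) := by
    gcongr
    · exact Finset.sum_nonneg fun r _ => div_nonneg (rankinWeight_nonneg A Z δ r) (by positivity)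
    · exact hC n A Z δ hZ1 hδ0.le hδ1 hδZ X
  rw [Real.exp_neg]
  have hE := Real.exp_pos (10 / 3 * (Real.log X / Real.log Z))
  set E := Real.exp (10 / 3 * (Real.log X / Real.log Z))
  have h5 : (calP A X + C) ^ m ≤ (calP A X + (2 * B + C)) ^ m := by gcongr; linarith
  calc ((badSet A X (m + 1) Z).card : ℝ)
      = (badSet A X (m + 1) Z).card * (E * (Real.log X / 2)) * (E⁻¹ * (2 / Real.log X)) := by
        field_simp
    _ ≤ B * X * ((calP A X + C) ^ m / (m.factorial : ℝ)) * (E⁻¹ * (2 / Real.log X)) := by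
        exact mul_le_mul_of_nonneg_right (h3.trans h4) (by positivity)
    _ = E⁻¹ * ((2 * B) * X / Real.log X * ((calP A X + C) ^ m / (m.factorial : ℝ))) := by
        field_simp
    _ ≤ _ := by
        gcongr
        linarith

/-! ### The upper bound for the sum of the discrepancies. -/

theorem mem_Qk_natCast {A : Family n} {k X q : ℕ} :
    q ∈ Qk A k X ↔ q ∈ omegaSet X k ∧ 1 ≤ rho A q := by
  simp only [Qk, omegaSet, Finset.mem_filter, Nat.floor_natCast]
  tauto

theorem Qk_subset (A : Family n) (X k Z : ℕ) : Qk A k X ⊆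
    Finset.Icc 1 X.sqrt ∪ (badSet A X k Z ∪ goodSet A X k Z) := by
  intro q hq
  obtain ⟨h1, h2⟩ := mem_Qk_natCast.1 hq
  have h3 := Finset.mem_Icc.1 (Finset.mem_filter.1 h1).1
  simp only [Finset.mem_union, badSet, goodSet, Finset.mem_filter, Finset.mem_Icc]
  by_cases h4 : X < q ^ 2
  · rcases lt_or_ge X (primePart (· ≤ Z) q ^ 3) with h5 | h5
    · exact Or.inr (Or.inl ⟨h1, h2, h4, h5⟩)
    · exact Or.inr (Or.inr ⟨h1, h2, h4, h5⟩)
  · refine Or.inl ⟨h3.1, Nat.le_sqrt.2 ?_⟩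
    rw [← sq]; omega

/-- Moduli up to `√X` and moduli with a large smooth part are bounded trivially by 1 each;
Erdős–Turán is applied to the rest, with the frequency sum interchanged with the sum over moduli. -/
theorem exists_sum_disc_le : ∃ (K : ℕ → ℝ) (C : ℝ), 0 < C ∧ (∀ n, 0 < K n) ∧
    ∀ (n : ℕ) (A : Family n) (X m N Z : ℕ) (δ T : ℝ), 0 < N → 0 < δ → δ ^ 3 * N = 1 → 2 ≤ X →
      80 ≤ Real.log Z → Z ^ 15 ≤ X → 2 ≤ T → Real.log N ≤ T →
      ∑ q ∈ Qk A (m + 1) X, disc (Delta A q) ≤ Real.sqrt X +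
        Real.exp (-(10 / 3 * (Real.log X / Real.log Z))) *
          (C * X / Real.log X * ((calP A X + C) ^ m / (m.factorial : ℝ))) +
        K n * ((Qk A (m + 1) X).card * δ + (3 + 2 * Real.log N) ^ n * (X / Real.log Z *
          ∑ j ∈ (Finset.Icc 1 (m + 1)).filter (fun j => Z ^ j ≤ X),
            (calPtilde A X + (Real.log 4 * Real.log (Real.log T) + C)) ^ (m + 1 - j) /
              ((m + 1 - j).factorial : ℝ))) := by
  obtain ⟨C1, hC1, hbad⟩ := exists_card_badSet_le
  obtain ⟨C2, hC2, havg⟩ := exists_sum_avgWeight_le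
  refine ⟨fun n => (n + 1) * (3 * 5 ^ n + 4 * 4 ^ n), C1 + C2, by positivity,
    fun n => by positivity, fun n A X m N Z δ T hN hδ hδN hX hZ hZX hT hNT => ?_⟩
  classical
  have hlZ : 0 < Real.log Z := by linarith
  have hZ2 : 2 ≤ Z := by
    by_contra h
    have : Z = 0 ∨ Z = 1 := by omega
    rcases this with rfl | rfl <;> simp at hlZ
  have hX1 : (1 : ℝ) < X := by exact_mod_cast hX
  have hlX : 0 < Real.log X := Real.log_pos hX1
  have hP : 0 ≤ calP A X := by
    unfold calP
    have : 0 ≤ ∑ p ∈ primesQ A X, 1 / (p : ℝ) := Finset.sum_nonneg fun _ _ => by positivity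
    linarith
  have hρ : ∀ q ∈ Qk A (m + 1) X, q ≠ 0 ∧ 1 ≤ rho A q := by
    intro q hq
    obtain ⟨h1, h2⟩ := mem_Qk_natCast.1 hq
    have h3 := Finset.mem_Icc.1 (Finset.mem_filter.1 h1).1
    exact ⟨by omega, h2⟩
  have hd1 : ∀ q ∈ Qk A (m + 1) X, disc (Delta A q) ≤ 1 := by
    intro q hq
    have : NeZero q := ⟨(hρ q hq).1⟩
    exact disc_Delta_le_one A q (hρ q hq).2
  have hd0 : ∀ q, 0 ≤ disc (Delta A q) := by
    intro q
    refine Real.sSup_nonneg ?_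
    rintro d ⟨B, -, rfl⟩
    exact abs_nonneg _
  set Qs := Qk A (m + 1) X with hQs
  set G := goodSet A X (m + 1) Z with hG
  have hGQ : G ⊆ Qs := by
    intro q hq
    simp only [hG, goodSet, Finset.mem_filter] at hq
    exact mem_Qk_natCast.2 ⟨hq.1, hq.2.1⟩
  have hsplit : ∑ q ∈ Qs, disc (Delta A q) ≤
      (X.sqrt : ℝ) + (badSet A X (m + 1) Z).card + ∑ q ∈ G, disc (Delta A q) := by
    rw [← Finset.sum_sdiff hGQ]
    gcongr
    calc _ ≤ ∑ q ∈ Qs \ G, (1 : ℝ) :=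
          Finset.sum_le_sum fun q hq => hd1 q (Finset.mem_sdiff.1 hq).1
      _ = ((Qs \ G).card : ℝ) := by simp
      _ ≤ ((Finset.Icc 1 X.sqrt ∪ badSet A X (m + 1) Z).card : ℝ) := by
          refine Nat.cast_le.2 (Finset.card_le_card fun q hq => ?_)
          obtain ⟨h1, h2⟩ := Finset.mem_sdiff.1 hq
          have := Qk_subset A X (m + 1) Z h1
          simp only [Finset.mem_union] at this ⊢
          tauto
      _ ≤ (((Finset.Icc 1 X.sqrt).card + (badSet A X (m + 1) Z).card : ℕ) : ℝ) :=
          Nat.cast_le.2 (Finset.card_union_le _ _)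
      _ = _ := by simp
  have hsq : (X.sqrt : ℝ) ≤ Real.sqrt X := Real.nat_sqrt_le_real_sqrt
  have hbadle : ((badSet A X (m + 1) Z).card : ℝ) ≤
      Real.exp (-(10 / 3 * (Real.log X / Real.log Z))) *
          ((C1 + C2) * X / Real.log X * ((calP A X + (C1 + C2)) ^ m / (m.factorial : ℝ))) := by
    refine (hbad n A X m Z hX hZ).trans ?_
    gcongr <;> linarith
  set J := (Finset.Icc 1 (m + 1)).filter (fun j => Z ^ j ≤ X)
  set S := calPtilde A X + (Real.log 4 * Real.log (Real.log T) + (C1 + C2)) with hS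
  -- `log log T` may be negative, but `T ≥ 2` keeps it above `-1`, and the 3 built into `𝒫̃`
  -- outweighs `log 4`.
  have hS0 : 0 ≤ S := by
    have h1 : 3 ≤ calPtilde A X := by
      unfold calPtilde
      have : 0 ≤ ∑ p ∈ primesQ A X, 1 / (p : ℝ) * Real.sqrt ((lam A p : ℝ) / (rho A p : ℝ)) :=
        Finset.sum_nonneg fun _ _ => by positivity
      linarith
    have h2 : Real.log 2 ≤ Real.log T := Real.log_le_log (by norm_num) hT
    have h3 := Real.log_two_gt_d9
    have h4 : -1 ≤ Real.log (Real.log T) := by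
      have h5 : Real.exp (-1) ≤ 1 / 2 := by
        rw [Real.exp_neg, ← one_div]
        exact one_div_le_one_div_of_le (by norm_num) (by linarith [Real.add_one_le_exp (1 : ℝ)])
      rw [Real.le_log_iff_exp_le (by linarith)]
      linarith
    have h6 : Real.log 4 ≤ 2 := by
      rw [show (4 : ℝ) = 2 ^ 2 by norm_num, Real.log_pow]
      have := Real.log_two_lt_d9
      push_cast
      linarith
    have h7 : 0 < Real.log 4 := Real.log_pos (by norm_num)
    nlinarith
  set M := ∑ j ∈ J, S ^ (m + 1 - j) / ((m + 1 - j).factorial : ℝ) with hM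
  have hM0 : 0 ≤ M := Finset.sum_nonneg fun j _ => by positivity
  have hh : ∀ h ∈ (freqBox n N).erase 0, ∑ q ∈ G, twistedWeyl A h (primePart (· ≤ Z) q)
      (primePart (fun p => ¬ p ≤ Z) q) ≤ 4 * X / Real.log Z * M := by
    intro h hh
    refine (sum_weyl_goodSet_le A h hZ2 hZX).trans ?_
    gcongr 4 * X / Real.log Z * ?_
    refine Finset.sum_le_sum fun j _ => ?_
    gcongr
    · exact Finset.sum_nonneg fun r _ => div_nonneg (avgWeight_nonneg A h r) (by positivity)
    · refine (havg n A X N h T hh hT hNT).trans ?_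
      rw [hS]; linarith
  have hgood : ∑ q ∈ G, disc (Delta A q) ≤ (n + 1) * (3 * δ * 5 ^ n * Qs.card + 4 ^ n *
      ∑ h ∈ (freqBox n N).erase 0, (4 * X / Real.log Z * M) / freqWeight h) := by
    have h1 : ∀ q ∈ G, disc (Delta A q) ≤ (n + 1) * (3 * δ * 5 ^ n + 4 ^ n *
        ∑ h ∈ (freqBox n N).erase 0, twistedWeyl A h (primePart (· ≤ Z) q)
          (primePart (fun p => ¬ p ≤ Z) q) / freqWeight h) := by
      intro q hq
      obtain ⟨hq0, hqρ⟩ := hρ q (hGQ hq)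
      have : NeZero q := ⟨hq0⟩
      refine (disc_Delta_le A q hqρ hN hδ hδN).trans ?_
      gcongr with h hh
      · exact (freqWeight_pos h).le
      · have e := primePart_mul_not (· ≤ Z) hq0
        have hc := coprime_primePart (· ≤ Z) q
        have hr : NeZero (primePart (· ≤ Z) q) := ⟨(primePart_pos _ _).ne'⟩
        have hs : NeZero (primePart (fun p => ¬ p ≤ Z) q) := ⟨(primePart_pos _ _).ne'⟩
        rw [twistedWeyl_eq]
        refine le_trans (le_of_eq ?_) (norm_weyl_mul_le A hc h)
        congr! <;> exact e.symm
    calc _ ≤ ∑ q ∈ G, ((n : ℝ) + 1) * (3 * δ * 5 ^ n + 4 ^ n *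
          ∑ h ∈ (freqBox n N).erase 0, twistedWeyl A h (primePart (· ≤ Z) q)
            (primePart (fun p => ¬ p ≤ Z) q) / freqWeight h) := Finset.sum_le_sum h1
      _ = ((n : ℝ) + 1) * (3 * δ * 5 ^ n * G.card + 4 ^ n * ∑ h ∈ (freqBox n N).erase 0,
          (∑ q ∈ G, twistedWeyl A h (primePart (· ≤ Z) q)
            (primePart (fun p => ¬ p ≤ Z) q)) / freqWeight h) := by
          rw [← Finset.mul_sum, Finset.sum_add_distrib, Finset.sum_const, nsmul_eq_mul,
            ← Finset.mul_sum, Finset.sum_comm]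
          simp_rw [← Finset.sum_div]
          ring
      _ ≤ _ := by
          gcongr with h hh'
          · exact (freqWeight_pos h).le
          · exact hh h hh'
  have hsumh : ∑ h ∈ (freqBox n N).erase 0, (4 * X / Real.log Z * M) / freqWeight h ≤
      (3 + 2 * Real.log N) ^ n * (4 * X / Real.log Z * M) := by
    calc _ = (∑ h ∈ (freqBox n N).erase 0, 1 / freqWeight h) * (4 * X / Real.log Z * M) := by
          rw [Finset.sum_mul]
          refine Finset.sum_congr rfl fun h _ => by ring
      _ ≤ (∑ h ∈ freqBox n N, 1 / freqWeight h) * (4 * X / Real.log Z * M) := by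
          refine mul_le_mul_of_nonneg_right (Finset.sum_le_sum_of_subset_of_nonneg
            (Finset.erase_subset (0 : Fin n → ℤ) (freqBox n N)) fun h _ _ => ?_) (by positivity)
          have := freqWeight_pos h
          positivity
      _ ≤ _ := by
          gcongr
          exact sum_inv_freqWeight_le n N
  have hNlog : 0 ≤ Real.log N := Real.log_natCast_nonneg N
  have hU : 0 ≤ X / Real.log Z * M := by positivity
  set U := X / Real.log Z * M
  set L := (3 + 2 * Real.log N) ^ n
  have hL : 0 ≤ L := by positivity
  have hs2 : ∑ h ∈ (freqBox n N).erase 0, (4 * X / Real.log Z * M) / freqWeight h ≤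
      4 * (L * U) := hsumh.trans (le_of_eq (by simp only [U, L]; ring))
  have h5 : (0 : ℝ) ≤ 5 ^ n := by positivity
  have h4 : (0 : ℝ) ≤ 4 ^ n := by positivity
  calc _ ≤ (X.sqrt : ℝ) + (badSet A X (m + 1) Z).card + ∑ q ∈ G, disc (Delta A q) := hsplit
    _ ≤ Real.sqrt X + _ + (n + 1) * (3 * δ * 5 ^ n * Qs.card + 4 ^ n * (4 * (L * U))) := by
        refine add_le_add (add_le_add hsq hbadle) (hgood.trans ?_)
        gcongr
    _ ≤ _ := by
        refine add_le_add le_rfl ?_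
        have hgoal : ((n : ℝ) + 1) * (3 * δ * 5 ^ n * Qs.card + 4 ^ n * (4 * (L * U))) ≤
            (n + 1) * ((3 * 5 ^ n + 4 * 4 ^ n) * (Qs.card * δ + L * U)) := by
          refine mul_le_mul_of_nonneg_left ?_ (by positivity)
          have e : (3 * 5 ^ n + 4 * 4 ^ n) * (Qs.card * δ + L * U) =
            (3 * δ * 5 ^ n * Qs.card + 4 ^ n * (4 * (L * U))) +
              (4 * 4 ^ n * (Qs.card * δ) + 3 * 5 ^ n * (L * U)) := by ring
          rw [e]
          have : 0 ≤ 4 * (4 : ℝ) ^ n * (Qs.card * δ) + 3 * 5 ^ n * (L * U) := by positivity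
          linarith
        exact hgoal.trans (le_of_eq (by ring))

/-! ### The lower bound for the number of moduli. -/

theorem one_le_rho_prod (A : Family n) (t : Finset ℕ) (ht : ∀ p ∈ t, p.Prime ∧ 1 ≤ rho A p) :
    1 ≤ rho A (∏ p ∈ t, p) := by
  classical
  induction t using Finset.induction_on with
  | empty => simp [rho_one]
  | insert p t hp ih =>
    have hp' := ht p (Finset.mem_insert_self _ _)
    have ht' : ∀ q ∈ t, q.Prime ∧ 1 ≤ rho A q := fun q hq => ht q (Finset.mem_insert_of_mem hq)
    rw [Finset.prod_insert hp]
    refine (one_le_rho_of_mul A hp'.1.ne_zero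
      (Finset.prod_ne_zero_iff.2 fun q hq => (ht' q hq).1.ne_zero) ?_).2 ⟨hp'.2, ih ht'⟩
    refine Nat.Coprime.prod_right fun q hq => (Nat.coprime_primes hp'.1 (ht' q hq).1).2 ?_
    rintro rfl
    exact hp hq

theorem mem_primesQ {A : Family n} {x : ℝ} (hx : 0 ≤ x) {p : ℕ} :
    p ∈ primesQ A x ↔ (p : ℝ) ≤ x ∧ p.Prime ∧ 1 ≤ rho A p := by
  simp only [primesQ, Finset.mem_filter, Finset.mem_Icc, Nat.le_floor_iff hx]
  exact ⟨fun h => ⟨h.1.2, h.2⟩, fun h => ⟨⟨h.2.1.one_le, h.1⟩, h.2⟩⟩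

/-- Counting the products of `m` primes below `y` and one prime above `y`. -/
theorem le_card_Qk {A : Family n} {α x₀ : ℝ} (hx₀ : 0 ≤ x₀)
    (hA : DensityAssumption A α x₀)
    {X m : ℕ} {y : ℝ} (hX : 2 ≤ X) (hy : 1 ≤ y) (hyX : y ^ (m + 1) ≤ Real.sqrt X)
    (h0 : x₀ ≤ Real.sqrt X) (h1 : 2 * Real.log 4 ≤ α * Real.sqrt X) (T : Finset ℕ)
    (hT : ∀ p ∈ T, p.Prime ∧ 1 ≤ rho A p ∧ (p : ℝ) ≤ y) :
    α / 2 * (X / Real.log X) * elemSymm T (fun p => 1 / (p : ℝ)) m ≤ (Qk A (m + 1) X).card := by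
  classical
  have hX1 : (1 : ℝ) < X := by exact_mod_cast hX
  have hlX : 0 < Real.log X := Real.log_pos hX1
  have hsq : Real.sqrt X * Real.sqrt X = X := Real.mul_self_sqrt (by linarith)
  have hs1 : 1 ≤ Real.sqrt X := le_trans (one_le_pow₀ hy) hyX
  have hl4 : 0 < Real.log 4 := Real.log_pos (by norm_num)
  set P : Finset ℕ → Finset ℕ := fun t =>
    (primesQ A ((X : ℝ) / (∏ p ∈ t, p : ℕ))).filter (fun p => y < (p : ℝ)) with hP
  have hprodpos : ∀ t ∈ T.powersetCard m, (0 : ℝ) < (∏ p ∈ t, p : ℕ) := by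
    intro t ht
    have := (Finset.mem_powersetCard.1 ht).1
    exact_mod_cast Finset.prod_pos fun p hp => (hT p (this hp)).1.pos
  have hprodle : ∀ t ∈ T.powersetCard m, ((∏ p ∈ t, p : ℕ) : ℝ) ≤ y ^ m := by
    intro t ht
    obtain ⟨h1, h2⟩ := Finset.mem_powersetCard.1 ht
    push_cast
    calc ∏ p ∈ t, (p : ℝ) ≤ ∏ p ∈ t, y :=
          Finset.prod_le_prod (fun p _ => by positivity) fun p hp => (hT p (h1 hp)).2.2
      _ = y ^ m := by rw [Finset.prod_const, h2]
  have hcount : ∀ t ∈ T.powersetCard m,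
      α / 2 * (X / Real.log X) * ∏ p ∈ t, (1 / (p : ℝ)) ≤ (P t).card := by
    intro t ht
    have hpos := hprodpos t ht
    have hle := hprodle t ht
    have hinv : ∏ p ∈ t, (1 / (p : ℝ)) = 1 / (∏ p ∈ t, p : ℕ) := by
      push_cast
      simp
    rw [hinv]
    set d : ℝ := ((∏ p ∈ t, p : ℕ) : ℝ) with hd
    have hyd : y * d ≤ Real.sqrt X :=
      calc y * d ≤ y * y ^ m := by gcongr
        _ = y ^ (m + 1) := by ring
        _ ≤ _ := hyX
    have hdX : Real.sqrt X ≤ X / d := by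
      rw [le_div_iff₀ hpos]
      calc Real.sqrt X * d ≤ Real.sqrt X * Real.sqrt X := by
            gcongr
            nlinarith
        _ = X := hsq
    have hdens := hA (X / d) (h0.trans hdX)
    have hd1 : (1 : ℝ) ≤ d := by
      rw [hd]
      exact_mod_cast Nat.one_le_iff_ne_zero.2 fun h => hpos.ne' (by rw [hd, h]; simp)
    -- Each prime above `y` weighs at most `log X`. The primes up to `y` are removed at a cost of
    -- `(log 4) y`, shown below to be at most half of the main term `α X / d`.
    have hsplit : ∑ p ∈ primesQ A (X / d), Real.log p ≤
        ∑ p ∈ P t, Real.log X + Real.log 4 * y := by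
      rw [← Finset.sum_filter_add_sum_filter_not _ (fun p : ℕ => y < (p : ℝ))]
      refine add_le_add (Finset.sum_le_sum fun p hp => ?_) ?_
      · have hp1 := (Finset.mem_filter.1 hp).1
        rw [mem_primesQ (by positivity)] at hp1
        refine Real.log_le_log (by exact_mod_cast hp1.2.1.pos) (hp1.1.trans ?_)
        exact div_le_self (by linarith) hd1
      · calc _ ≤ ∑ p ∈ (Finset.Ioc 0 ⌊y⌋₊).filter Nat.Prime, Real.log p := by
              refine Finset.sum_le_sum_of_subset_of_nonneg (fun p hp => ?_)
                fun p _ _ => Real.log_natCast_nonneg p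
              obtain ⟨hp1, hp2⟩ := Finset.mem_filter.1 hp
              rw [mem_primesQ (by positivity)] at hp1
              simp only [Finset.mem_filter, Finset.mem_Ioc]
              exact ⟨⟨hp1.2.1.pos, Nat.le_floor (not_lt.1 hp2)⟩, hp1.2.1⟩
          _ = Chebyshev.theta y := rfl
          _ ≤ _ := Chebyshev.theta_le_log4_mul_x (by linarith)
    rw [Finset.sum_const, nsmul_eq_mul] at hsplit
    have hy2 : Real.log 4 * y ≤ α / 2 * (X / d) := by
      rw [mul_div_assoc', le_div_iff₀ hpos]
      calc Real.log 4 * y * d = Real.log 4 * (y * d) := by ring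
        _ ≤ Real.log 4 * Real.sqrt X := by gcongr
        _ ≤ α / 2 * (Real.sqrt X * Real.sqrt X) := by nlinarith
        _ = _ := by rw [hsq]
    have : α / 2 * (X / d) ≤ (P t).card * Real.log X := by linarith
    calc α / 2 * (X / Real.log X) * (1 / d) = α / 2 * (X / d) / Real.log X := by ring
      _ ≤ (P t).card := by rwa [div_le_iff₀ hlX]
  have hcard : ((T.powersetCard m).sigma P).card ≤ (Qk A (m + 1) X).card := by
    have hpf : ∀ t ∈ T.powersetCard m, ∀ p ∈ P t,
        p ∉ t ∧ (∀ q ∈ insert p t, q.Prime ∧ 1 ≤ rho A q) ∧ y < p ∧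
          (p * ∏ q ∈ t, q ≤ X) := by
      intro t ht p hp
      have hpos := hprodpos t ht
      obtain ⟨ht1, ht2⟩ := Finset.mem_powersetCard.1 ht
      obtain ⟨hp1, hp2⟩ := Finset.mem_filter.1 hp
      rw [mem_primesQ (by positivity)] at hp1
      refine ⟨fun hpt => absurd (hT p (ht1 hpt)).2.2 (not_le.2 hp2), fun q hq => ?_, hp2, ?_⟩
      · rcases Finset.mem_insert.1 hq with rfl | hq
        · exact hp1.2
        · exact ⟨(hT q (ht1 hq)).1, (hT q (ht1 hq)).2.1⟩
      · have := hp1.1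
        rw [le_div_iff₀ hpos] at this
        exact_mod_cast this
    have hfac : ∀ t ∈ T.powersetCard m, ∀ p ∈ P t,
        (p * ∏ q ∈ t, q).primeFactors = insert p t := by
      intro t ht p hp
      obtain ⟨h1, h2, -, -⟩ := hpf t ht p hp
      rw [← Finset.prod_insert (f := fun q => q) h1, Nat.primeFactors_prod fun q hq => (h2 q hq).1]
    refine Finset.card_le_card_of_injOn (fun s => s.2 * ∏ q ∈ s.1, q) ?_ ?_
    · rintro ⟨t, p⟩ hs
      obtain ⟨ht, hp⟩ := Finset.mem_sigma.1 hs
      obtain ⟨h1, h2, -, h4⟩ := hpf t ht p hp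
      have hf := hfac t ht p hp
      simp only [Qk, Finset.coe_filter, Finset.mem_Icc, Nat.floor_natCast, Set.mem_ofPred_eq]
      refine ⟨⟨Nat.pos_of_ne_zero fun h => ?_, h4⟩, ?_, ?_⟩
      · rw [h, Nat.primeFactors_zero] at hf
        exact Finset.insert_ne_empty p t hf.symm
      · rw [← Finset.prod_insert (f := fun q => q) h1]
        exact one_le_rho_prod A _ h2
      · rw [hf, Finset.card_insert_of_notMem h1, (Finset.mem_powersetCard.1 ht).2]
    · rintro ⟨t, p⟩ hs ⟨t', p'⟩ hs' heq
      obtain ⟨ht, hp⟩ := Finset.mem_sigma.1 hs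
      obtain ⟨ht', hp'⟩ := Finset.mem_sigma.1 hs'
      simp only at ht hp ht' hp' heq
      have hf := hfac t ht p hp
      rw [heq, hfac t' ht' p' hp'] at hf
      obtain ⟨a1, -, a3, -⟩ := hpf t ht p hp
      obtain ⟨b1, -, b3, -⟩ := hpf t' ht' p' hp'
      -- The large prime is the only prime factor exceeding `y`, so the set of prime factors
      -- determines both `p` and `t`.
      have hpp : p = p' := by
        have h1 : p ∈ insert p' t' := hf ▸ Finset.mem_insert_self p t
        rcases Finset.mem_insert.1 h1 with h | h
        · exact h
        · exact absurd (hT p ((Finset.mem_powersetCard.1 ht').1 h)).2.2 (not_le.2 a3)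
      subst hpp
      have htt : t = t' := by
        rw [← Finset.erase_insert a1, ← Finset.erase_insert b1, hf]
      subst htt
      rfl
  rw [elemSymm, Finset.mul_sum]
  calc _ ≤ ∑ t ∈ T.powersetCard m, ((P t).card : ℝ) := Finset.sum_le_sum hcount
    _ = (((T.powersetCard m).sigma P).card : ℝ) := by rw [Finset.card_sigma]; push_cast; rfl
    _ ≤ _ := by exact_mod_cast hcard

/-- Primes up to `k` are discarded so that each remaining reciprocal is below `1/k`, and primes
above `X^{1/(2k)}` so that products of `k` of them stay below `√X`. The first removal costs `O(log
log k)` and the second about `(log 4) log k`, in total at most `(3/2) log k` plus a constant. -/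
theorem exists_le_sum_middle_primes : ∃ C : ℝ, 0 < C ∧ ∀ (n : ℕ) (A : Family n) (X k : ℕ),
    1 ≤ k → 2 ≤ X → 2 * (k : ℝ) ≤ Real.log X →
      calP A X - C - 3 / 2 * Real.log k ≤
        ∑ p ∈ (primesQ A X).filter (fun p => k < p ∧ (p : ℝ) ≤ (X : ℝ) ^ (1 / (2 * (k : ℝ)))),
          1 / (p : ℝ) := by
  obtain ⟨C1, hC1, h⟩ := exists_sum_inv_primes_le
  have hl4 : 0 < Real.log 4 := Real.log_pos (by norm_num)
  have hl4' : Real.log 4 ≤ 1.3863 := by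
    rw [show (4 : ℝ) = 2 ^ 2 by norm_num, Real.log_pow]
    have := Real.log_two_lt_d9
    push_cast
    linarith
  refine ⟨C1 + 3 + Real.log 4 * (Real.log 20 + 2), by
    have := Real.log_pos (by norm_num : (1 : ℝ) < 20)
    positivity, fun n A X k hk hX hkX => ?_⟩
  have hk1 : (1 : ℝ) ≤ k := by exact_mod_cast hk
  have hlk : 0 ≤ Real.log k := Real.log_nonneg hk1
  have hX1 : (1 : ℝ) < X := by exact_mod_cast hX
  have hlX : 0 < Real.log X := Real.log_pos hX1
  set y : ℝ := (X : ℝ) ^ (1 / (2 * (k : ℝ))) with hy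
  have hly : Real.log y = Real.log X / (2 * k) := by
    rw [hy, Real.log_rpow (by linarith)]; ring
  have hy1 : 1 < y := Real.one_lt_rpow hX1 (by positivity)
  have hyX : y ≤ X := by
    rw [hy]
    conv_rhs => rw [← Real.rpow_one (X : ℝ)]
    refine Real.rpow_le_rpow_of_exponent_le hX1.le ?_
    rw [div_le_one (by positivity)]; linarith
  have hsmall : ∑ p ∈ (Finset.Icc 1 k).filter Nat.Prime, 1 / (p : ℝ) ≤
      C1 + Real.log 4 * (Real.log k / 20 + Real.log 20) := by
    have h20 : 0 < Real.log 20 := Real.log_pos (by norm_num)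
    rcases eq_or_lt_of_le hk with rfl | hk2
    · have : (Finset.Icc 1 1).filter Nat.Prime = ∅ := by decide
      rw [this, Finset.sum_empty]
      positivity
    · have hk2' : (2 : ℝ) ≤ k := by exact_mod_cast hk2
      have := h k hk2'
      rw [Nat.floor_natCast] at this
      have hlk0 : 0 < Real.log k := Real.log_pos (by linarith)
      -- The fraction 1/20 is small enough that `(21/20) log 4` stays below 3/2.
      have h3 : Real.log (Real.log k) ≤ Real.log k / 20 + Real.log 20 := by
        have h4 := Real.log_le_sub_one_of_pos (show 0 < Real.log k / 20 by positivity)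
        rw [Real.log_div hlk0.ne' (by norm_num)] at h4
        linarith
      have := mul_le_mul_of_nonneg_left h3 hl4.le
      linarith
  have hlarge := sum_inv_primes_Ioc_le hy1 hyX
  have hll : Real.log (Real.log X) - Real.log (Real.log y) + 1 / Real.log y ≤
      Real.log k + 2 := by
    rw [hly, Real.log_div hlX.ne' (by positivity), Real.log_mul (by norm_num) (by positivity),
      one_div_div]
    have : 2 * (k : ℝ) / Real.log X ≤ 1 := by rwa [div_le_one hlX]
    have := Real.log_two_lt_d9
    linarith
  have hll' := mul_le_mul_of_nonneg_left hll hl4.le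
  have hall : ∑ p ∈ primesQ A X, 1 / (p : ℝ) ≤
      ∑ p ∈ (primesQ A X).filter (fun p => k < p ∧ (p : ℝ) ≤ y), 1 / (p : ℝ) +
        (∑ p ∈ (Finset.Icc 1 k).filter Nat.Prime, 1 / (p : ℝ) +
          ∑ p ∈ (Finset.Ioc ⌊y⌋₊ ⌊(X : ℝ)⌋₊).filter Nat.Prime, 1 / (p : ℝ)) := by
    classical
    rw [← Finset.sum_filter_add_sum_filter_not (primesQ A X)
      (fun p => k < p ∧ (p : ℝ) ≤ y)]
    gcongr
    refine le_trans ?_ (Finset.sum_union_inter (s₁ := (Finset.Icc 1 k).filter Nat.Prime)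
      (s₂ := (Finset.Ioc ⌊y⌋₊ ⌊(X : ℝ)⌋₊).filter Nat.Prime) (f := fun p : ℕ => 1 / (p : ℝ))).le
    refine le_trans (Finset.sum_le_sum_of_subset_of_nonneg (fun p hp => ?_)
      fun p _ _ => by positivity) (le_add_of_nonneg_right (Finset.sum_nonneg fun p _ => by positivity))
    obtain ⟨hp1, hp2⟩ := Finset.mem_filter.1 hp
    rw [mem_primesQ (by positivity)] at hp1
    have hpX : p ≤ X := by exact_mod_cast hp1.1
    simp only [Finset.mem_union, Finset.mem_filter, Finset.mem_Icc, Finset.mem_Ioc,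
      Nat.floor_natCast, hp1.2.1, and_true]
    rcases le_or_gt p k with hpk | hpk
    · exact Or.inl ⟨hp1.2.1.one_le, hpk⟩
    · refine Or.inr ⟨(Nat.floor_lt (by linarith)).2 (not_le.1 fun h => hp2 ⟨hpk, h⟩), hpX⟩
  unfold calP
  have h5 : Real.log 4 * (21 / 20 * Real.log k) ≤ 3 / 2 * Real.log k := by nlinarith
  linarith

/-- With reciprocals at most `1/(m + 1)`, avoiding `m` used primes costs at most 1 in the elementary
symmetric bound, which is absorbed in the constant. -/
theorem exists_le_card_Qk : ∃ C : ℝ, 0 < C ∧ ∀ (n : ℕ) (A : Family n) (α x₀ : ℝ), 0 < α → 2 ≤ x₀ →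
    DensityAssumption A α x₀ → ∀ X m : ℕ, x₀ ≤ Real.sqrt X → 2 * Real.log 4 ≤ α * Real.sqrt X →
      2 * ((m + 1 : ℕ) : ℝ) ≤ Real.log X →
      0 ≤ calP A X - C - 3 / 2 * Real.log (m + 1 : ℕ) →
      α / 2 * (X / Real.log X) *
        ((calP A X - C - 3 / 2 * Real.log (m + 1 : ℕ)) ^ m / (m.factorial : ℝ)) ≤
          (Qk A (m + 1) X).card := by
  obtain ⟨C, hC, h⟩ := exists_le_sum_middle_primes
  refine ⟨C + 1, by positivity, fun n A α x₀ hα hx₀ hA X m h0 h1 h2 h3 => ?_⟩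
  have hX : 2 ≤ X := by
    have h4 : (2 : ℝ) ≤ Real.sqrt X := hx₀.trans h0
    have h5 : Real.sqrt X ^ 2 = X := Real.sq_sqrt (by positivity)
    have : (2 : ℝ) ≤ X := by nlinarith
    exact_mod_cast this
  have hX1 : (1 : ℝ) < X := by exact_mod_cast hX
  have hk := h n A X (m + 1) (by omega) hX h2
  set T := (primesQ A X).filter
    (fun p => m + 1 < p ∧ (p : ℝ) ≤ (X : ℝ) ^ (1 / (2 * ((m + 1 : ℕ) : ℝ)))) with hT
  have hTm : ∀ p ∈ T, p.Prime ∧ 1 ≤ rho A p ∧ m + 1 < p ∧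
      (p : ℝ) ≤ (X : ℝ) ^ (1 / (2 * ((m + 1 : ℕ) : ℝ))) := by
    intro p hp
    obtain ⟨hp1, hp2⟩ := Finset.mem_filter.1 hp
    rw [mem_primesQ (by positivity)] at hp1
    exact ⟨hp1.2.1, hp1.2.2, hp2⟩
  have hlX : 0 < Real.log X := Real.log_pos hX1
  refine le_trans (mul_le_mul_of_nonneg_left ?_ (by positivity))
    (le_card_Qk (by linarith) hA hX (y := (X : ℝ) ^ (1 / (2 * ((m + 1 : ℕ) : ℝ))))
      (Real.one_le_rpow hX1.le (by positivity)) ?_ h0 h1 T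
      fun p hp => ⟨(hTm p hp).1, (hTm p hp).2.1, (hTm p hp).2.2.2⟩)
  · refine le_elemSymm T (M := 1 / (m + 1 : ℝ)) (fun p _ => by positivity) (fun p hp => ?_)
      (by positivity) h3 m ?_ m (by omega)
    · have : (m : ℝ) + 1 < p := by exact_mod_cast (hTm p hp).2.2.1
      exact one_div_le_one_div_of_le (by positivity) this.le
    · have : (m : ℝ) * (1 / (m + 1 : ℝ)) ≤ 1 := by
        rw [mul_one_div, div_le_one (by positivity)]; linarith
      linarith
  · rw [← Real.rpow_natCast, ← Real.rpow_mul (by positivity), Real.sqrt_eq_rpow]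
    refine Real.rpow_le_rpow_of_exponent_le hX1.le (le_of_eq ?_)
    have : ((m + 1 : ℕ) : ℝ) ≠ 0 := by positivity
    field_simp

/-! ### Comparison inequalities and admissible parameters. -/

theorem three_le_calPtilde (A : Family n) (x : ℝ) : 3 ≤ calPtilde A x := by
  unfold calPtilde
  have : 0 ≤ ∑ p ∈ primesQ A x, 1 / (p : ℝ) * Real.sqrt ((lam A p : ℝ) / (rho A p : ℝ)) :=
    Finset.sum_nonneg fun _ _ => by positivity
  linarith

theorem calPtilde_le_calP (A : Family n) (x : ℝ) : calPtilde A x ≤ calP A x := by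
  unfold calPtilde calP
  gcongr with p hp
  have hpp := (Finset.mem_filter.1 hp).2.1
  have : NeZero p := ⟨hpp.ne_zero⟩
  refine mul_le_of_le_one_right (by positivity) (Real.sqrt_le_one.2 ?_)
  exact div_le_one_of_le₀ (by exact_mod_cast lam_le_rho A p) (by positivity)

theorem DensityAssumption.le_log_four {A : Family n} {α x₀ : ℝ} (hx₀ : 2 ≤ x₀)
    (h : DensityAssumption A α x₀) : α ≤ Real.log 4 := by
  have h1 := h x₀ le_rfl
  have h2 : ∑ p ∈ primesQ A x₀, Real.log p ≤ Real.log 4 * x₀ := by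
    refine le_trans ?_ (Chebyshev.theta_le_log4_mul_x (by linarith : (0 : ℝ) ≤ x₀))
    refine Finset.sum_le_sum_of_subset_of_nonneg (fun p hp => ?_)
      fun p _ _ => Real.log_natCast_nonneg p
    obtain ⟨hp1, hp2⟩ := Finset.mem_filter.1 hp
    exact Finset.mem_filter.2 ⟨Finset.mem_Ioc.2 ⟨hp2.1.pos, (Finset.mem_Icc.1 hp1).2⟩, hp2.1⟩
  exact le_of_mul_le_mul_right (h1.trans h2) (by linarith)

/-- For `11 y ≤ P` one has `P - y ≥ (10/11) P`, whence the factor 11/10. With `y = C + (3/2) log k`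
it is the origin of the coefficient 33/20 further on. -/
theorem div_sub_pow_le_exp {P y : ℝ} (hP : 0 < P) (hy : 0 ≤ y) (hyP : 11 * y ≤ P) (m : ℕ) :
    (P / (P - y)) ^ m ≤ Real.exp (m * (11 / 10 * y / P)) := by
  have h0 : 0 < P - y := by linarith
  rw [Real.exp_nat_mul]
  gcongr
  have h1 := Real.add_one_le_exp (y / (P - y))
  have h2 : y / (P - y) + 1 = P / (P - y) := by field_simp; ring
  rw [h2] at h1
  refine h1.trans (Real.exp_le_exp.2 ?_)
  rw [div_le_div_iff₀ h0 hP]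
  nlinarith

/-- The additive error `S` must become a multiplicative one. Since `R P ≥ 3`, the left side is at
most `R (1 + S/3)`. If `R^{1/6} (1 + S/3) ≤ 1`, a sixth of the exponent pays for the error;
otherwise `1/R < (1 + S/3)⁶`, so `S/P` is a small relative perturbation of `R`. -/
theorem add_div_le_rpow_mul_exp {P R S : ℝ} (hP : 0 < P) (hR : 3 ≤ R * P) (hR1 : R ≤ 1)
    (hS : 0 ≤ S) :
    R + S / P ≤ R ^ (5 / 6 : ℝ) * Real.exp (S * (1 + S / 3) ^ 6 / P) := by
  have hR0 : 0 < R := by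
    by_contra h
    nlinarith
  have h6 : (R ^ (1 / 6 : ℝ)) ^ 6 = R := by
    rw [← Real.rpow_natCast, ← Real.rpow_mul hR0.le]; norm_num
  have hmul : R ^ (5 / 6 : ℝ) * R ^ (1 / 6 : ℝ) = R := by
    rw [← Real.rpow_add hR0]; norm_num
  have hr : 0 < R ^ (1 / 6 : ℝ) := by positivity
  rcases le_or_gt (R ^ (1 / 6 : ℝ) * (1 + S / 3)) 1 with h | h
  · have h1 : R + S / P ≤ R * (1 + S / 3) := by
      have : S / P ≤ R * (S / 3) := by
        rw [div_le_iff₀ hP]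
        nlinarith
      linarith
    calc R + S / P ≤ R * (1 + S / 3) := h1
      _ = R ^ (5 / 6 : ℝ) * (R ^ (1 / 6 : ℝ) * (1 + S / 3)) := by rw [← mul_assoc, hmul]
      _ ≤ R ^ (5 / 6 : ℝ) * 1 := by gcongr
      _ ≤ _ := by
          gcongr
          exact Real.one_le_exp (by positivity)
  · have h1 : 1 ≤ R * (1 + S / 3) ^ 6 := by
      have := one_le_pow₀ (n := 6) h.le
      rwa [mul_pow, h6] at this
    have h2 : R + S / P ≤ R * Real.exp (S * (1 + S / 3) ^ 6 / P) := by
      have h3 := Real.add_one_le_exp (S * (1 + S / 3) ^ 6 / P)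
      have h4 : S / P ≤ R * (S * (1 + S / 3) ^ 6 / P) := by
        rw [mul_div_assoc']
        gcongr
        nlinarith
      nlinarith
    refine h2.trans ?_
    gcongr
    conv_lhs => rw [← Real.rpow_one R]
    exact Real.rpow_le_rpow_of_exponent_ge hR0 hR1 (by norm_num)

/-- The perturbation is of size `log log v`, so its seventh power is dominated by a small multiple
of `log v`. Here `6 v` is the bound for `log N`. -/
theorem exists_loglog_pow_le (C : ℝ) (hC : 0 ≤ C) : ∃ C' : ℝ, 0 < C' ∧ ∀ v : ℝ, 1 ≤ v →
    0 ≤ Real.log 4 * Real.log (Real.log (6 * v)) + C ∧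
    (Real.log 4 * Real.log (Real.log (6 * v)) + C) *
      (1 + (Real.log 4 * Real.log (Real.log (6 * v)) + C) / 3) ^ 6 ≤ Real.log v / 20 + C' := by
  have hl4 : 0 < Real.log 4 := Real.log_pos (by norm_num)
  have hl4' : Real.log 4 ≤ 2 := by
    rw [show (4 : ℝ) = 2 ^ 2 by norm_num, Real.log_pow]
    have := Real.log_two_lt_d9
    push_cast
    linarith
  have hl6 : 1 ≤ Real.log 6 := by
    rw [Real.le_log_iff_exp_le (by norm_num)]
    linarith [Real.exp_one_lt_d9]
  set c : ℝ := (7).factorial * 4 ^ 7 * Real.exp ((1 + C) / 4) with hc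
  have hc0 : 0 < c := by positivity
  refine ⟨Real.log 6 / 20 + 5 * c ^ 2, by positivity, fun v hv => ?_⟩
  have hw : Real.log (6 * v) = Real.log 6 + Real.log v := Real.log_mul (by norm_num) (by linarith)
  have hw1 : 1 ≤ Real.log (6 * v) := by
    have := Real.log_nonneg hv
    linarith
  set w := Real.log (6 * v)
  have hlw : 0 ≤ Real.log w := Real.log_nonneg hw1
  set S := Real.log 4 * Real.log w + C
  have hS : 0 ≤ S := by positivity
  refine ⟨hS, ?_⟩
  have h1 : S * (1 + S / 3) ^ 6 ≤ (1 + S) ^ 7 := by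
    calc S * (1 + S / 3) ^ 6 ≤ (1 + S) * (1 + S) ^ 6 := by
          gcongr
          · linarith
          · linarith
      _ = _ := by ring
  have h2 : (1 + S) ^ 7 ≤ c * Real.sqrt w := by
    have h3 := Real.pow_div_factorial_le_exp ((1 + S) / 4) (by positivity) 7
    have h4 : Real.exp ((1 + S) / 4) ≤ Real.exp ((1 + C) / 4) * Real.sqrt w := by
      rw [Real.sqrt_eq_rpow, Real.rpow_def_of_pos (by linarith), ← Real.exp_add]
      refine Real.exp_le_exp.2 ?_
      have : Real.log 4 * Real.log w ≤ 2 * Real.log w := by gcongr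
      simp only [S]
      linarith
    have h5 := h3.trans h4
    rw [div_pow, div_div, div_le_iff₀ (by positivity)] at h5
    refine h5.trans (le_of_eq ?_)
    rw [hc]
    ring
  have h3 : c * Real.sqrt w ≤ w / 20 + 5 * c ^ 2 := by
    have h4 := Real.sq_sqrt (by linarith : 0 ≤ w)
    nlinarith [sq_nonneg (Real.sqrt w - 10 * c)]
  linarith

theorem eventually_add_mul_sqrt_le (a b : ℝ) {c : ℝ} (hc : 0 < c) : ∃ L₀ : ℝ, ∀ L : ℝ, L₀ ≤ L →
    a + b * Real.sqrt L ≤ c * L := by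
  refine ⟨1 + ((|a| + |b|) / c) ^ 2, fun L hL => ?_⟩
  have h0 : 0 ≤ ((|a| + |b|) / c) ^ 2 := by positivity
  have hL0 : 0 ≤ L := by linarith
  have h1 : 1 ≤ Real.sqrt L := Real.one_le_sqrt.2 (by linarith)
  have h2 : (|a| + |b|) / c ≤ Real.sqrt L := Real.le_sqrt_of_sq_le (by linarith)
  rw [div_le_iff₀ hc] at h2
  have h3 := Real.mul_self_sqrt hL0
  calc a + b * Real.sqrt L ≤ |a| * Real.sqrt L + |b| * Real.sqrt L := by
        have := le_abs_self a
        have := le_abs_self b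
        have := abs_nonneg a
        gcongr
        nlinarith
    _ = (|a| + |b|) * Real.sqrt L := by ring
    _ ≤ Real.sqrt L * c * Real.sqrt L := by gcongr
    _ = c * L := by rw [mul_right_comm, h3, mul_comm]

/-- `Z` is `X^{1/u}` rounded up. The condition `u ≥ 16` leaves room for `Z¹⁵ ≤ X` after rounding,
and `u² ≤ log X` limits the effect of rounding on `log X / log Z` to 1. -/
theorem exists_sieving_level {X : ℕ} {u : ℝ} (hu : 16 ≤ u) (huX : u ^ 2 ≤ Real.log X)
    (hX : 6400 ≤ Real.log X) : ∃ Z : ℕ, 80 ≤ Real.log Z ∧ Z ^ 15 ≤ X ∧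
      Real.log X / Real.log Z ≤ u ∧ u - 1 ≤ Real.log X / Real.log Z := by
  have hX0 : (0 : ℝ) < X := by
    rcases Nat.eq_zero_or_pos X with h | h
    · subst h; norm_num at hX
    · exact_mod_cast h
  have hu0 : 0 < u := by linarith
  set z : ℝ := (X : ℝ) ^ (1 / u) with hz
  have hlz : Real.log z = Real.log X / u := by rw [hz, Real.log_rpow hX0]; ring
  have hz0 : 0 < z := Real.rpow_pos_of_pos hX0 _
  have hz1 : 1 ≤ z := by
    rw [← Real.log_nonneg_iff hz0, hlz]
    exact div_nonneg (by linarith) hu0.le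
  have hZz : z ≤ ⌈z⌉₊ := Nat.le_ceil z
  have hZ0 : (0 : ℝ) < ⌈z⌉₊ := by linarith
  have h1 : Real.log X / u ≤ Real.log ⌈z⌉₊ := hlz ▸ Real.log_le_log hz0 hZz
  have h2 : Real.log ⌈z⌉₊ ≤ Real.log X / u + 1 := by
    have h3 := (Nat.ceil_lt_add_one hz0.le).le
    have h4 : (⌈z⌉₊ : ℝ) ≤ z * Real.exp 1 := by
      have := Real.add_one_le_exp (1 : ℝ)
      nlinarith
    have := Real.log_le_log hZ0 h4
    rwa [Real.log_mul hz0.ne' (Real.exp_pos 1).ne', Real.log_exp, hlz] at this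
  have h80 : 80 ≤ Real.log X / u := by
    rw [le_div_iff₀ hu0]
    rcases le_or_gt u 80 with h | h <;> nlinarith
  refine ⟨⌈z⌉₊, h80.trans h1, ?_, ?_, ?_⟩
  · have h3 : Real.log ((⌈z⌉₊ : ℝ) ^ 15) ≤ Real.log X := by
      rw [Real.log_pow]
      have h4 : Real.log X / u ≤ Real.log X / 16 := by gcongr
      push_cast
      linarith
    have := (Real.log_le_log_iff (by positivity) hX0).1 h3
    exact_mod_cast this
  · rw [div_le_iff₀ (by linarith)]
    rw [div_le_iff₀ hu0] at h1
    linarith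
  · rw [le_div_iff₀ (by linarith)]
    have h3 : u ≤ Real.log X / u := by rw [le_div_iff₀ hu0]; nlinarith
    have h4 : Real.log X / u * u = Real.log X := div_mul_cancel₀ _ hu0.ne'
    nlinarith

/-- Makes the moduli `q ≤ √X` negligible: `m!`, `e^k` and `P^k` together are at most `X^{1/4}`,
because `(k P)²` is far below `log X`. -/
theorem log_mul_factorial_mul_le {X m : ℕ} {P : ℝ} (hP : 3 ≤ P) (hX : 6400 ≤ Real.log X)
    (h : (100 * ((m + 1 : ℕ) : ℝ) * P) ^ 2 ≤ Real.log X) :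
    Real.log X * (m.factorial : ℝ) * (Real.exp (m + 1 : ℕ) * P ^ (m + 1)) ≤ Real.sqrt X := by
  have hX0 : (0 : ℝ) < X := by
    rcases Nat.eq_zero_or_pos X with h | h
    · subst h; norm_num at hX
    · exact_mod_cast h
  set ℓ := Real.log X with hℓ
  have hsq : Real.sqrt X = Real.exp (ℓ / 4) * Real.exp (ℓ / 4) := by
    rw [← Real.exp_add, Real.sqrt_eq_rpow, Real.rpow_def_of_pos hX0]
    congr 1
    ring
  have h1 : ℓ ≤ Real.exp (ℓ / 4) := by
    have := Real.pow_div_factorial_le_exp (ℓ / 4) (by linarith) 2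
    have h2 : ℓ ≤ (ℓ / 4) ^ 2 / ((2).factorial : ℝ) := by
      norm_num [Nat.factorial]
      nlinarith
    linarith
  have hk : (1 : ℝ) ≤ ((m + 1 : ℕ) : ℝ) := by push_cast; linarith [Nat.cast_nonneg (α := ℝ) m]
  have hm : (m.factorial : ℝ) ≤ ((m + 1 : ℕ) : ℝ) ^ (m + 1) := by
    have h2 : m.factorial ≤ (m + 1).factorial := Nat.factorial_le (Nat.le_succ m)
    exact_mod_cast h2.trans (Nat.factorial_le_pow (m + 1))
  set k : ℝ := ((m + 1 : ℕ) : ℝ) with hkdef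
  have h3 : (m.factorial : ℝ) * (Real.exp k * P ^ (m + 1)) ≤ Real.exp (ℓ / 4) := by
    calc (m.factorial : ℝ) * (Real.exp k * P ^ (m + 1))
        ≤ k ^ (m + 1) * (Real.exp k * P ^ (m + 1)) := by gcongr
      _ = (k * P) ^ (m + 1) * Real.exp k := by ring
      _ ≤ Real.exp (k * P) ^ (m + 1) * Real.exp k := by
          gcongr
          linarith [Real.add_one_le_exp (k * P)]
      _ = Real.exp (k * (k * P) + k) := by
          rw [← Real.exp_nat_mul, ← Real.exp_add]
      _ ≤ _ := by
          refine Real.exp_le_exp.2 ?_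
          have e : (100 * k * P) ^ 2 = 10000 * (k * P) ^ 2 := by ring
          have h5 : k ≤ k * P := le_mul_of_one_le_right (by linarith) (by linarith)
          have h6 : k * (k * P) ≤ (k * P) ^ 2 := by
            rw [sq]
            gcongr
          have h7 : k * P ≤ (k * P) ^ 2 := le_self_pow₀ (by linarith) two_ne_zero
          rw [e] at h
          linarith
  calc _ = ℓ * ((m.factorial : ℝ) * (Real.exp k * P ^ (m + 1))) := by ring
    _ ≤ Real.exp (ℓ / 4) * Real.exp (ℓ / 4) := by gcongr
    _ = _ := hsq.symm

/-- The range of the parameters in which the averages can be controlled. -/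
theorem exists_parameter_range (C D : ℝ) : ∀ α x₀ : ℝ, 0 < α → 2 ≤ x₀ → ∃ L₀ : ℝ,
    ∀ (n : ℕ) (A : Family n), DensityAssumption A α x₀ → ∀ X m : ℕ, L₀ ≤ Real.log (Real.log X) →
      ((m + 1 : ℕ) : ℝ) ≤ Real.exp (2 * Real.sqrt (Real.log (Real.log X))) →
      2 ≤ X ∧ 6400 ≤ Real.log X ∧ x₀ ≤ Real.sqrt X ∧ 2 * Real.log 4 ≤ α * Real.sqrt X ∧
        (100 * ((m + 1 : ℕ) : ℝ) * calP A X) ^ 2 ≤ Real.log X ∧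
        11 * (C + 3 / 2 * Real.log (m + 1 : ℕ)) ≤ calP A X ∧ D ≤ Real.log (calP A X) := by
  intro α x₀ hα hx₀
  obtain ⟨CP, hCP, hP⟩ := exists_calP_le
  have hl4 : 0 < Real.log 4 := Real.log_pos (by norm_num)
  have hl4' : Real.log 4 ≤ 1.4 := by
    rw [show (4 : ℝ) = 2 ^ 2 by norm_num, Real.log_pow]
    have := Real.log_two_lt_d9
    push_cast
    linarith
  set c₀ := α * Real.log (Real.log x₀) + Real.log 4 / Real.log x₀ with hc₀
  obtain ⟨L1, h1⟩ := eventually_add_mul_sqrt_le (x₀ + 4 / α) 0 (by norm_num : (0 : ℝ) < 1 / 2)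
  obtain ⟨L2, h2⟩ := eventually_add_mul_sqrt_le (11 * C + c₀) 33 hα
  obtain ⟨L3, h3⟩ := eventually_add_mul_sqrt_le (Real.exp D + c₀) 0 hα
  obtain ⟨L4, h4⟩ := eventually_add_mul_sqrt_le (Real.log 40000) 8 one_pos
  obtain ⟨L5, h5⟩ := eventually_add_mul_sqrt_le CP 0 (by norm_num : (0 : ℝ) < 1 / 2)
  refine ⟨9 + |L1| + |L2| + |L3| + |L4| + |L5|, fun n A hA X m hL hk => ?_⟩
  set L := Real.log (Real.log X) with hLdef
  have a1 := abs_nonneg L1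
  have a2 := abs_nonneg L2
  have a3 := abs_nonneg L3
  have a4 := abs_nonneg L4
  have a5 := abs_nonneg L5
  have hL9 : 9 ≤ L := by linarith
  specialize h1 L (by linarith [le_abs_self L1])
  specialize h2 L (by linarith [le_abs_self L2])
  specialize h3 L (by linarith [le_abs_self L3])
  specialize h4 L (by linarith [le_abs_self L4])
  specialize h5 L (by linarith [le_abs_self L5])
  have hX : 2 ≤ X := by
    by_contra h
    have : X = 0 ∨ X = 1 := by omega
    rcases this with rfl | rfl <;> simp [hLdef] at hL9 <;> linarith
  have hX1 : (1 : ℝ) < X := by exact_mod_cast hX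
  have hℓ : 0 < Real.log X := Real.log_pos hX1
  have hexp : Real.exp L = Real.log X := by rw [hLdef, Real.exp_log hℓ]
  have h6400 : 6400 ≤ Real.log X := by
    rw [← hexp]
    have e1 : Real.exp 9 ≤ Real.exp L := Real.exp_le_exp.2 hL9
    have e2 : Real.exp 9 = Real.exp 1 ^ 9 := by rw [← Real.exp_nat_mul]; norm_num
    have e3 : (2.7 : ℝ) ^ 9 ≤ Real.exp 1 ^ 9 := by
      gcongr
      linarith [Real.exp_one_gt_d9]
    have e4 : (6400 : ℝ) ≤ 2.7 ^ 9 := by norm_num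
    linarith
  have hsq : L / 2 ≤ Real.sqrt X := by
    have e1 : Real.sqrt X = Real.exp (Real.log X / 2) := by
      rw [Real.sqrt_eq_rpow, Real.rpow_def_of_pos (by linarith)]
      congr 1
      ring
    have e2 := Real.add_one_le_exp (Real.log X / 2)
    have e3 := Real.add_one_le_exp L
    rw [e1]
    linarith
  have hx₀X : x₀ ≤ Real.sqrt X := by
    have : 0 < 4 / α := by positivity
    linarith
  have hx₀X' : x₀ ≤ X := by
    have e1 : Real.sqrt X ^ 2 = X := Real.sq_sqrt (by linarith)
    nlinarith
  have hαX : 2 * Real.log 4 ≤ α * Real.sqrt X := by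
    have e1 : 4 / α ≤ Real.sqrt X := by linarith
    rw [div_le_iff₀ hα] at e1
    linarith
  have hPlow : α * L - c₀ ≤ calP A X := by
    have e1 := le_calP hx₀ hx₀X' hA
    have e2 : 0 < α / Real.log x₀ := div_pos hα (Real.log_pos (by linarith))
    rw [← hLdef] at e1
    rw [hc₀]
    linarith
  have hPup : calP A X ≤ 2 * L := by
    have e1 := hP X (by exact_mod_cast hX) n A
    rw [← hLdef] at e1
    nlinarith
  have hP3 : 3 ≤ calP A X := (three_le_calPtilde A X).trans (calPtilde_le_calP A X)
  set s := Real.sqrt L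
  have hs : s * s = L := Real.mul_self_sqrt (by linarith)
  have hs0 : 0 ≤ s := Real.sqrt_nonneg _
  have hk1 : (1 : ℝ) ≤ ((m + 1 : ℕ) : ℝ) := by push_cast; linarith [Nat.cast_nonneg (α := ℝ) m]
  set k : ℝ := ((m + 1 : ℕ) : ℝ)
  have hlogk : Real.log k ≤ 2 * s := by
    rwa [Real.log_le_iff_le_exp (by linarith)]
  refine ⟨hX, h6400, hx₀X, hαX, ?_, by linarith, ?_⟩
  -- Both `k` and `𝒫` are at most `exp(O(√L))`, while `log X = e^L`.
  · have e1 : L ≤ Real.exp (2 * s) := by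
      rw [two_mul, Real.exp_add, ← hs]
      have := Real.add_one_le_exp s
      gcongr <;> linarith
    have e2 : 100 * k * calP A X ≤ 200 * Real.exp (4 * s) := by
      calc 100 * k * calP A X ≤ 100 * Real.exp (2 * s) * (2 * Real.exp (2 * s)) := by
            gcongr
            linarith
        _ = 200 * (Real.exp (2 * s) * Real.exp (2 * s)) := by ring
        _ = _ := by
            rw [← Real.exp_add]
            congr 2
            ring
    calc (100 * k * calP A X) ^ 2 ≤ (200 * Real.exp (4 * s)) ^ 2 := by gcongr
      _ = Real.exp (Real.log 40000 + 8 * s) := by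
          rw [Real.exp_add, Real.exp_log (by norm_num), mul_pow, ← Real.exp_nat_mul]
          norm_num
          ring_nf
      _ ≤ Real.exp L := Real.exp_le_exp.2 (by linarith)
      _ = _ := hexp
  · rw [Real.le_log_iff_exp_le (by linarith)]
    linarith

/-- Compares the contribution of smooth parts with `l` prime factors to `σ^m / m!` from the lower
bound for `|𝒬_k|`, where `m = l + i`. The missing `i` factors appear as `P^{-i}`; the two
perturbations, of `𝒫̃` by `S` and of `P` by `P - σ`, are collected in `E`. -/
theorem pow_div_factorial_le {P σ Pt S Y loss E : ℝ} {i l : ℕ} (hP : 0 < P) (hσ : 0 < σ)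
    (hPt : 0 < Pt) (hS : 0 ≤ S) (h : Pt / P + S / P ≤ (Pt / P) ^ (5 / 6 : ℝ) * Real.exp (Y / P))
    (hloss : (P / σ) ^ (l + i) ≤ Real.exp loss) (hE : l * (Y / P) + loss ≤ E) :
    (Pt + S) ^ l / (l.factorial : ℝ) ≤ σ ^ (l + i) / ((l + i).factorial : ℝ) * (Real.exp E *
      (((l + i).factorial : ℝ) / (l.factorial : ℝ) * ((Pt / P) ^ (5 / 6 : ℝ)) ^ l *
        (P ^ i)⁻¹)) := by
  have hR : 0 < (Pt / P) ^ (5 / 6 : ℝ) := Real.rpow_pos_of_pos (div_pos hPt hP) _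
  set R := (Pt / P) ^ (5 / 6 : ℝ)
  have h1 : (Pt + S) ^ l ≤ P ^ l * (R ^ l * Real.exp (l * (Y / P))) := by
    rw [Real.exp_nat_mul, ← mul_pow, ← mul_pow]
    refine pow_le_pow_left₀ (by linarith) ?_ l
    rwa [← add_div, div_le_iff₀' hP] at h
  have h2 : P ^ (l + i) ≤ σ ^ (l + i) * Real.exp loss := by
    rwa [div_pow, div_le_iff₀ (pow_pos hσ _), mul_comm] at hloss
  have h3 : Real.exp (l * (Y / P)) * Real.exp loss ≤ Real.exp E := by
    rw [← Real.exp_add]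
    exact Real.exp_le_exp.2 hE
  have hf : (0 : ℝ) < l.factorial := by positivity
  have hf' : (0 : ℝ) < (l + i).factorial := by positivity
  have hPi : 0 < P ^ i := pow_pos hP i
  have hw : 0 ≤ R ^ l * (P ^ i)⁻¹ / l.factorial := by positivity
  calc (Pt + S) ^ l / (l.factorial : ℝ)
      ≤ P ^ l * (R ^ l * Real.exp (l * (Y / P))) / l.factorial :=
        div_le_div_of_nonneg_right h1 hf.le
    _ = P ^ (l + i) * (Real.exp (l * (Y / P)) * (R ^ l * (P ^ i)⁻¹ / l.factorial)) := by
        rw [pow_add]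
        field_simp
    _ ≤ σ ^ (l + i) * Real.exp loss * (Real.exp (l * (Y / P)) *
          (R ^ l * (P ^ i)⁻¹ / l.factorial)) :=
        mul_le_mul_of_nonneg_right h2 (mul_nonneg (Real.exp_pos _).le hw)
    _ = σ ^ (l + i) * (Real.exp (l * (Y / P)) * Real.exp loss) *
          (R ^ l * (P ^ i)⁻¹ / l.factorial) := by ring
    _ ≤ σ ^ (l + i) * Real.exp E * (R ^ l * (P ^ i)⁻¹ / l.factorial) :=
        mul_le_mul_of_nonneg_right (mul_le_mul_of_nonneg_left h3 (pow_pos hσ _).le) hw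
    _ = _ := by field_simp

/-! ### The average discrepancy in terms of two free parameters. -/

-- The quotient of the upper bound for the sum by the lower bound for `|𝒬_k|`. The four terms come
-- from `q ≤ √X`, from the smoothing scale `δ`, from large smooth parts, and from the Weyl sums,
-- with `j` the number of prime factors of the rough part. The parameters stay free because the two
-- ranges of `k` need different choices.
set_option maxHeartbeats 2000000 in
theorem exists_avgDisc_le : ∃ (K : ℕ → ℝ) (C : ℝ), (∀ n, 0 < K n) ∧ 0 < C ∧
    ∀ α x₀ : ℝ, 0 < α → 2 ≤ x₀ → ∃ L₀ : ℝ, ∀ (n : ℕ) (A : Family n), DensityAssumption A α x₀ →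
      ∀ X m : ℕ, L₀ ≤ Real.log (Real.log X) →
        ((m + 1 : ℕ) : ℝ) ≤ Real.exp (2 * Real.sqrt (Real.log (Real.log X))) →
        (Qk A (m + 1) X).Nonempty ∧ 20 * C ≤ Real.log (calP A X) ∧ ∀ u v : ℝ, 16 ≤ u →
          u ≤ 100 * ((m + 1 : ℕ) : ℝ) * calP A X → 1 ≤ v →
          avgDisc A (m + 1) X ≤ K n / α * ((Real.exp (m + 1 : ℕ) * calP A X ^ (m + 1))⁻¹ +
            Real.exp (-v) +
            Real.exp ((C + 33 / 20 * Real.log (m + 1 : ℕ)) * (m + 1 : ℕ) / calP A X) *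
              (Real.exp (-(10 / 3 * u)) +
                v ^ n * u * Real.exp ((m + 1 : ℕ) / calP A X * (Real.log v / 20)) *
                ∑ j ∈ (Finset.Icc 1 (m + 1)).filter (fun j : ℕ => (j : ℝ) ≤ u),
                  (m.factorial : ℝ) / ((m + 1 - j).factorial : ℝ) *
                    ((calPtilde A X / calP A X) ^ (5 / 6 : ℝ)) ^ (m + 1 - j) *
                      (calP A X ^ (j - 1))⁻¹)) := by
  obtain ⟨K, CU, hCU, hK, hU⟩ := exists_sum_disc_le
  obtain ⟨CL, hCL, hlow⟩ := exists_le_card_Qk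
  obtain ⟨CY, hCY, hY⟩ := exists_loglog_pow_le CU hCU.le
  set C := CU + 11 / 10 * CL + CY with hC
  refine ⟨fun n => 2 * (1 + CU * Real.exp (10 / 3) + K n + K n * 15 ^ n), C,
    fun n => by have := hK n; positivity, by positivity, fun α x₀ hα hx₀ => ?_⟩
  obtain ⟨L₀, hL₀⟩ := exists_parameter_range CL (20 * C) α x₀ hα hx₀
  refine ⟨L₀, fun n A hA X m hL hk => ?_⟩
  obtain ⟨hX, h6400, hx₀X, hαX, hrange, hPC, hPD⟩ := hL₀ n A hA X m hL hk
  have hPt3 := three_le_calPtilde A X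
  have hPtP := calPtilde_le_calP A X
  have hk1 : (1 : ℝ) ≤ ((m + 1 : ℕ) : ℝ) := by push_cast; linarith [Nat.cast_nonneg (α := ℝ) m]
  have hlk : 0 ≤ Real.log ((m + 1 : ℕ) : ℝ) := Real.log_nonneg hk1
  have hmk : (m : ℝ) ≤ ((m + 1 : ℕ) : ℝ) := by push_cast; linarith
  have h2k : 2 * ((m + 1 : ℕ) : ℝ) ≤ Real.log X := by
    have e1 : 100 * ((m + 1 : ℕ) : ℝ) ≤ 100 * ((m + 1 : ℕ) : ℝ) * calP A X :=
      le_mul_of_one_le_right (by positivity) (by linarith)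
    have e2 := le_self_pow₀ (by linarith : 1 ≤ 100 * ((m + 1 : ℕ) : ℝ) * calP A X) two_ne_zero
    linarith
  have hlow' := hlow n A α x₀ hα hx₀ hA X m hx₀X hαX h2k (by linarith)
  have hX1 : (1 : ℝ) < X := by exact_mod_cast hX
  set P := calP A X
  set k : ℝ := ((m + 1 : ℕ) : ℝ) with hkdef
  set ℓ := Real.log X
  set σ := P - CL - 3 / 2 * Real.log k with hσ
  have hP0 : 0 < P := by linarith
  have hσ1 : 1 ≤ σ := by linarith
  have hσ0 : 0 < σ := by linarith
  have hℓ0 : 0 < ℓ := by linarith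
  set Q : ℝ := ((Qk A (m + 1) X).card : ℝ)
  -- `B` is the lower bound for `|𝒬_k|`; `t1`, `t2` and `t4` below divide terms of the upper bound
  -- by it, while `t3` treats the term in which `|𝒬_k|` cancels.
  set B : ℝ := α / 2 * (X / ℓ) * (σ ^ m / (m.factorial : ℝ)) with hB
  have hfac : (0 : ℝ) < m.factorial := by positivity
  have hB0 : 0 < B := by positivity
  have hQ0 : 0 < Q := lt_of_lt_of_le hB0 hlow'
  refine ⟨Finset.card_pos.1 (Nat.cast_pos.1 hQ0), hPD, fun u v hu16 hu hv => ?_⟩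
  have hu0 : 0 < u := by linarith
  have hv0 : 0 < v := by linarith
  obtain ⟨Z, hZ80, hZ15, hZu, hZu'⟩ := exists_sieving_level hu16
    (le_trans (by gcongr) hrange) h6400
  have hlZ : 0 < Real.log Z := by linarith
  -- Taking `δ = 1/H` and `N = H³` gives `δ³ N = 1` with `δ ≤ e^{-v}` and `log N ≤ 6 v`.
  set H := ⌈Real.exp v⌉₊ with hH
  have hHv : Real.exp v ≤ H := Nat.le_ceil _
  have hH0 : (0 : ℝ) < H := lt_of_lt_of_le (Real.exp_pos v) hHv
  have hlH : Real.log H ≤ 2 * v := by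
    have e1 := (Nat.ceil_lt_add_one (Real.exp_pos v).le).le
    have e2 : (H : ℝ) ≤ Real.exp (2 * v) := by
      have e3 : 2 ≤ Real.exp v := by linarith [Real.add_one_le_exp v]
      have e4 := mul_le_mul_of_nonneg_right e3 (Real.exp_pos v).le
      rw [two_mul, Real.exp_add]
      linarith
    rwa [Real.log_le_iff_le_exp hH0]
  have hlN : Real.log ((H ^ 3 : ℕ) : ℝ) ≤ 6 * v := by
    push_cast
    rw [Real.log_pow]
    push_cast
    linarith
  have hup := hU n A X m (H ^ 3) Z (1 / (H : ℝ)) (6 * v) (by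
      have : 0 < H := by exact_mod_cast hH0
      positivity) (by positivity) (by
      push_cast
      field_simp) hX hZ80 hZ15 (by linarith) hlN
  obtain ⟨hS0, hSY⟩ := hY v hv
  set S0 := Real.log 4 * Real.log (Real.log (6 * v)) + CU
  set Pt := calPtilde A X
  set R := Pt / P with hRdef
  have hR0 : 0 < R := div_pos (by linarith) hP0
  have hR1 : R ≤ 1 := (div_le_one hP0).2 hPtP
  have hRP : 3 ≤ R * P := by rw [hRdef, div_mul_cancel₀ _ hP0.ne']; exact hPt3
  have hmain := add_div_le_rpow_mul_exp hP0 hRP hR1 hS0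
  set Y := S0 * (1 + S0 / 3) ^ 6 with hYdef
  have hY0 : 0 ≤ Y := by positivity
  set loss := m * (11 / 10 * (CL + 3 / 2 * Real.log k) / P) with hloss
  have hlosspow : (P / σ) ^ m ≤ Real.exp loss := by
    have := div_sub_pow_le_exp (P := P) (y := CL + 3 / 2 * Real.log k) hP0 (by positivity) hPC m
    rwa [show P - (CL + 3 / 2 * Real.log k) = σ by rw [hσ]; ring] at this
  set Λ := Real.exp ((C + 33 / 20 * Real.log k) * k / P) with hΛ
  have hα2 : α ≤ 2 := by
    have e1 := hA.le_log_four hx₀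
    have e2 := Real.log_two_lt_d9
    rw [show (4 : ℝ) = 2 ^ 2 by norm_num, Real.log_pow] at e1
    push_cast at e1
    linarith
  have t1 : Real.sqrt X / B ≤ 2 / α * (Real.exp k * P ^ (m + 1))⁻¹ := by
    have e1 := log_mul_factorial_mul_le (by linarith : (3 : ℝ) ≤ P) h6400 hrange
    have e2 : Real.sqrt X * Real.sqrt X = X := Real.mul_self_sqrt (by linarith)
    have e3 : 0 < Real.sqrt X := Real.sqrt_pos.2 (by linarith)
    have e4 : 0 < Real.exp k * P ^ (m + 1) := by positivity
    rw [div_le_iff₀ hB0, hB, ← div_eq_mul_inv, div_mul_eq_mul_div, le_div_iff₀ e4]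
    have e5 : 2 / α * (α / 2 * (X / ℓ) * (σ ^ m / (m.factorial : ℝ))) =
        Real.sqrt X * Real.sqrt X * σ ^ m / (ℓ * m.factorial) := by
      rw [e2]
      field_simp
    rw [e5, le_div_iff₀ (by positivity)]
    calc Real.sqrt X * (Real.exp k * P ^ (m + 1)) * (ℓ * m.factorial)
        = Real.sqrt X * (ℓ * m.factorial * (Real.exp k * P ^ (m + 1))) := by ring
      _ ≤ Real.sqrt X * Real.sqrt X := by gcongr
      _ ≤ Real.sqrt X * Real.sqrt X * σ ^ m :=
          le_mul_of_one_le_right (by positivity) (one_le_pow₀ hσ1)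
  have t2 : Real.exp (-(10 / 3 * (ℓ / Real.log Z))) *
      (CU * X / ℓ * ((P + CU) ^ m / (m.factorial : ℝ))) / B ≤
      2 / α * (CU * Real.exp (10 / 3) * (Λ * Real.exp (-(10 / 3 * u)))) := by
    have e1 : Real.exp (-(10 / 3 * (ℓ / Real.log Z))) ≤
        Real.exp (10 / 3) * Real.exp (-(10 / 3 * u)) := by
      rw [← Real.exp_add]
      exact Real.exp_le_exp.2 (by linarith)
    have e2 : ((P + CU) / P) ^ m ≤ Real.exp (m * (CU / P)) := by
      rw [Real.exp_nat_mul]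
      gcongr
      rw [add_div, div_self hP0.ne', add_comm]
      exact Real.add_one_le_exp _
    have e3 : Real.exp (m * (CU / P)) * Real.exp loss ≤ Λ := by
      rw [← Real.exp_add]
      refine Real.exp_le_exp.2 ?_
      calc m * (CU / P) + loss
          = (CU + 11 / 10 * CL + 33 / 20 * Real.log k) * m / P := by rw [hloss]; ring
        _ ≤ (C + 33 / 20 * Real.log k) * k / P := by
            gcongr
            rw [hC]; linarith
    have e4 : CU * X / ℓ * ((P + CU) ^ m / (m.factorial : ℝ)) / B =
        2 / α * (CU * (((P + CU) / P) ^ m * (P / σ) ^ m)) := by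
      rw [hB, div_pow, div_pow]
      field_simp
    rw [mul_div_assoc, e4]
    calc _ ≤ Real.exp (10 / 3) * Real.exp (-(10 / 3 * u)) *
          (2 / α * (CU * (Real.exp (m * (CU / P)) * Real.exp loss))) := by gcongr
      _ ≤ Real.exp (10 / 3) * Real.exp (-(10 / 3 * u)) * (2 / α * (CU * Λ)) := by gcongr
      _ = _ := by ring
  have t3 : 1 / (H : ℝ) ≤ 2 / α * Real.exp (-v) := by
    have e1 : 1 / (H : ℝ) ≤ Real.exp (-v) := by
      rw [Real.exp_neg, ← one_div]
      exact one_div_le_one_div_of_le (Real.exp_pos v) hHv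
    have e2 : 1 ≤ 2 / α := by rwa [le_div_iff₀ hα, one_mul]
    exact e1.trans (le_mul_of_one_le_left (Real.exp_pos _).le e2)
  set V := Real.exp (k / P * (Real.log v / 20)) with hV
  set J := (Finset.Icc 1 (m + 1)).filter (fun j : ℕ => (j : ℝ) ≤ u)
  set F : ℕ → ℝ := fun j => (m.factorial : ℝ) / ((m + 1 - j).factorial : ℝ) *
    (R ^ (5 / 6 : ℝ)) ^ (m + 1 - j) * (P ^ (j - 1))⁻¹ with hF
  have hF0 : ∀ j, 0 ≤ F j := fun j => by positivity
  have hterm : ∀ j ∈ Finset.Icc 1 (m + 1),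
      (Pt + S0) ^ (m + 1 - j) / ((m + 1 - j).factorial : ℝ) ≤
        σ ^ m / m.factorial * (Λ * V * F j) := by
    intro j hj
    obtain ⟨hj1, hj2⟩ := Finset.mem_Icc.1 hj
    obtain ⟨i, rfl⟩ := Nat.exists_eq_add_of_le' hj1
    obtain ⟨l, hl⟩ := Nat.exists_eq_add_of_le' (by omega : i ≤ m)
    have hl' : m + 1 - (i + 1) = l := by omega
    simp only [hF, hl', Nat.add_sub_cancel]
    have hlk' : (l : ℝ) ≤ k := le_trans (Nat.cast_le.2 (by omega)) hmk
    rw [hΛ, hV, ← Real.exp_add]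
    rw [hl] at hlosspow
    simp only [hl]
    refine pow_div_factorial_le hP0 hσ0 (by linarith) hS0 hmain hlosspow ?_
    have hlv := Real.log_nonneg hv
    have hloss0 : 11 / 10 * (CL + 3 / 2 * Real.log k) / P * m ≤
        11 / 10 * (CL + 3 / 2 * Real.log k) / P * k :=
      mul_le_mul_of_nonneg_left hmk (by positivity)
    calc l * (Y / P) + loss ≤ k * (Y / P) + k * (11 / 10 * (CL + 3 / 2 * Real.log k) / P) := by
          refine add_le_add (mul_le_mul_of_nonneg_right hlk' (by positivity)) ?_
          rw [hloss]
          linarith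
      _ ≤ k * ((Real.log v / 20 + CY) / P) +
            k * (11 / 10 * (CL + 3 / 2 * Real.log k) / P) := by gcongr
      _ = (CY + 11 / 10 * CL + 33 / 20 * Real.log k) * k / P + k / P * (Real.log v / 20) := by
          ring
      _ ≤ _ := by
          gcongr
          rw [hC]; linarith
  have hsum : ∑ j ∈ (Finset.Icc 1 (m + 1)).filter (fun j => Z ^ j ≤ X),
      (Pt + S0) ^ (m + 1 - j) / ((m + 1 - j).factorial : ℝ) ≤
        σ ^ m / m.factorial * (Λ * V * ∑ j ∈ J, F j) := by
    have hVV : 0 ≤ V := (Real.exp_pos _).le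
    have hΛ0 : 0 ≤ Λ := (Real.exp_pos _).le
    rw [Finset.mul_sum, Finset.mul_sum]
    calc _ ≤ ∑ j ∈ (Finset.Icc 1 (m + 1)).filter (fun j => Z ^ j ≤ X),
          σ ^ m / m.factorial * (Λ * V * F j) :=
          Finset.sum_le_sum fun j hj => hterm j (Finset.mem_filter.1 hj).1
      _ ≤ _ := by
          refine Finset.sum_le_sum_of_subset_of_nonneg (fun j hj => ?_)
            fun j _ _ => by have := hF0 j; positivity
          obtain ⟨hj1, hj2⟩ := Finset.mem_filter.1 hj
          refine Finset.mem_filter.2 ⟨hj1, le_trans ?_ hZu⟩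
          rw [le_div_iff₀ hlZ, ← Real.log_pow]
          have hZ0 : 0 < Z := by
            rcases Nat.eq_zero_or_pos Z with h | h
            · subst h; norm_num at hlZ
            · exact h
          exact Real.log_le_log (by positivity) (by exact_mod_cast hj2)
  set W := ∑ j ∈ J, F j
  have hW0 : 0 ≤ W := Finset.sum_nonneg fun j _ => hF0 j
  have hΛ0 : 0 < Λ := Real.exp_pos _
  have hV0 : 0 < V := Real.exp_pos _
  have t4 : (3 + 2 * Real.log ((H ^ 3 : ℕ) : ℝ)) ^ n * (X / Real.log Z *
      ∑ j ∈ (Finset.Icc 1 (m + 1)).filter (fun j => Z ^ j ≤ X),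
        (Pt + S0) ^ (m + 1 - j) / ((m + 1 - j).factorial : ℝ)) / B ≤
      2 / α * (15 ^ n * (Λ * (v ^ n * u * V * W))) := by
    have hN0 : 0 ≤ Real.log ((H ^ 3 : ℕ) : ℝ) := Real.log_natCast_nonneg _
    calc _ ≤ (15 * v) ^ n * (X / Real.log Z *
          (σ ^ m / m.factorial * (Λ * V * W))) / B := by
          gcongr
          linarith
      _ = 2 / α * (15 ^ n * (Λ * (v ^ n * (ℓ / Real.log Z) * V * W))) := by
          rw [hB, mul_pow]
          field_simp
      _ ≤ _ := by gcongr
  have hKn := hK n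
  have hdiv : ∀ a : ℝ, 0 ≤ a → a / Q ≤ a / B := fun a ha => by gcongr
  set s1 := Real.sqrt X
  set s2 := Real.exp (-(10 / 3 * (ℓ / Real.log Z))) *
      (CU * X / ℓ * ((P + CU) ^ m / (m.factorial : ℝ)))
  set s4 := (3 + 2 * Real.log ((H ^ 3 : ℕ) : ℝ)) ^ n * (X / Real.log Z *
      ∑ j ∈ (Finset.Icc 1 (m + 1)).filter (fun j => Z ^ j ≤ X),
        (Pt + S0) ^ (m + 1 - j) / ((m + 1 - j).factorial : ℝ))
  have hs1 : 0 ≤ s1 := Real.sqrt_nonneg _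
  have hs2 : 0 ≤ s2 := by positivity
  have hs4 : 0 ≤ s4 := by
    have hN0 : 0 ≤ Real.log ((H ^ 3 : ℕ) : ℝ) := Real.log_natCast_nonneg _
    have : 0 ≤ ∑ j ∈ (Finset.Icc 1 (m + 1)).filter (fun j => Z ^ j ≤ X),
        (Pt + S0) ^ (m + 1 - j) / ((m + 1 - j).factorial : ℝ) :=
      Finset.sum_nonneg fun j _ => by positivity
    positivity
  have havg : avgDisc A (m + 1) X ≤ s1 / Q + s2 / Q + K n * (1 / (H : ℝ) + s4 / Q) := by
    unfold avgDisc
    rw [div_le_iff₀ hQ0]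
    refine hup.trans (le_of_eq ?_)
    change s1 + s2 + K n * (Q * (1 / (H : ℝ)) + s4) = _
    field_simp
  set E1 := (Real.exp k * P ^ (m + 1))⁻¹
  set E2 := Real.exp (-v)
  set E3 := Real.exp (-(10 / 3 * u))
  set E4 := v ^ n * u * V * W
  have hE1 : 0 < E1 := by positivity
  have hE2 : 0 < E2 := Real.exp_pos _
  have hE3 : 0 < E3 := Real.exp_pos _
  have hE4 : 0 ≤ E4 := by positivity
  calc avgDisc A (m + 1) X ≤ s1 / B + s2 / B + K n * (1 / (H : ℝ) + s4 / B) := by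
        refine havg.trans ?_
        have := hdiv s1 hs1
        have := hdiv s2 hs2
        have := hdiv s4 hs4
        gcongr
    _ ≤ 2 / α * E1 + 2 / α * (CU * Real.exp (10 / 3) * (Λ * E3)) +
          K n * (2 / α * E2 + 2 / α * (15 ^ n * (Λ * E4))) := by gcongr
    _ = 2 / α * (1 * E1 + K n * E2 + CU * Real.exp (10 / 3) * (Λ * E3) +
          K n * 15 ^ n * (Λ * E4)) := by ring
    _ ≤ 2 / α * ((1 + CU * Real.exp (10 / 3) + K n + K n * 15 ^ n) * E1 +
          (1 + CU * Real.exp (10 / 3) + K n + K n * 15 ^ n) * E2 +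
          (1 + CU * Real.exp (10 / 3) + K n + K n * 15 ^ n) * (Λ * E3) +
          (1 + CU * Real.exp (10 / 3) + K n + K n * 15 ^ n) * (Λ * E4)) := by
        have c1 : 0 < CU * Real.exp (10 / 3) := by positivity
        have c2 : 0 < K n * 15 ^ n := by positivity
        gcongr <;> linarith
    _ = _ := by ring

/-! ### Choice of the parameters in the two ranges of `k`. -/

/-- A tangent line bound. The slope 3/8 is chosen so that Stirling leaves the coefficient `5/8 =
(5/4)(1/2)` in `log_factorial_sub_le`, as the interpolation requires. -/
theorem log_le_three_eighths_mul {y : ℝ} (hy : 0 < y) : Real.log y ≤ 3 / 8 * y + 1 / 4 := by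
  have h1 := Real.log_le_sub_one_of_pos (show 0 < 3 / 8 * y by positivity)
  rw [Real.log_mul (by norm_num) hy.ne'] at h1
  have h2 : -(5 / 4 : ℝ) ≤ Real.log (3 / 8) := by
    rw [Real.le_log_iff_exp_le (by norm_num), Real.exp_neg, inv_le_comm₀ (Real.exp_pos _)
      (by norm_num)]
    have h3 := Real.sum_le_exp_of_nonneg (show (0 : ℝ) ≤ 5 / 4 by norm_num) 4
    norm_num [Finset.sum_range_succ, Nat.factorial] at h3
    linarith
  linarith

theorem log_factorial_le {m : ℕ} (hm : 1 ≤ m) :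
    Real.log (m.factorial : ℝ) ≤ 1 + Real.log m + m * Real.log m - m := by
  induction m, hm using Nat.le_induction with
  | base => simp
  | succ m hm ih =>
    have hm0 : (0 : ℝ) < m := by exact_mod_cast hm
    have hm1 : (0 : ℝ) < (m : ℝ) + 1 := by linarith
    rw [Nat.factorial_succ]
    push_cast
    rw [Real.log_mul hm1.ne' (by positivity)]
    have h1 : 1 ≤ (m + 1 : ℝ) * (Real.log (m + 1) - Real.log m) := by
      have h2 := Real.log_le_sub_one_of_pos (show 0 < (m : ℝ) / (m + 1) by positivity)
      rw [Real.log_div hm0.ne' hm1.ne'] at h2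
      have h3 : (m : ℝ) / (m + 1) - 1 = -(1 / (m + 1)) := by field_simp; ring
      rw [h3] at h2
      have h4 : 1 / ((m : ℝ) + 1) ≤ Real.log (m + 1) - Real.log m := by linarith
      rwa [div_le_iff₀ hm1, mul_comm] at h4
    nlinarith

theorem le_log_factorial (l : ℕ) : l * Real.log l - l ≤ Real.log (l.factorial : ℝ) := by
  rcases Nat.eq_zero_or_pos l with rfl | hl
  · simp
  · have hl0 : (0 : ℝ) < l := by exact_mod_cast hl
    have h := Real.pow_div_factorial_le_exp (l : ℝ) hl0.le l
    rw [div_le_iff₀ (by positivity)] at h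
    have h1 := Real.log_le_log (by positivity) h
    rw [Real.log_pow, Real.log_mul (Real.exp_pos _).ne' (by positivity), Real.log_exp] at h1
    linarith

theorem log_factorial_sub_le {m l i : ℕ} (hm : m = l + i) (hm1 : 1 ≤ m) :
    Real.log (m.factorial : ℝ) - Real.log (l.factorial : ℝ) - i * Real.log m ≤
      1 + Real.log m - 5 / 8 * (i - l) := by
  have h1 := log_factorial_le hm1
  have h2 := le_log_factorial l
  have hm' : (m : ℝ) = l + i := by exact_mod_cast hm
  have hm0 : (0 : ℝ) < m := by exact_mod_cast hm1
  have h3 : (l : ℝ) * Real.log m - l * Real.log l ≤ 3 / 8 * m + l / 4 := by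
    rcases Nat.eq_zero_or_pos l with rfl | hl
    · simp
    · have hl0 : (0 : ℝ) < l := by exact_mod_cast hl
      have h4 := mul_le_mul_of_nonneg_left
        (log_le_three_eighths_mul (show 0 < (m : ℝ) / l by positivity)) hl0.le
      rw [Real.log_div hm0.ne' hl0.ne'] at h4
      have h5 : (l : ℝ) * (3 / 8 * (m / l) + 1 / 4) = 3 / 8 * m + l / 4 := by field_simp
      linarith
  have h6 : (m : ℝ) * Real.log m = l * Real.log m + i * Real.log m := by rw [hm']; ring
  linarith

/-- An interpolation inequality: the summand is dominated by the larger of two extreme ones. -/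
theorem factorial_div_mul_pow_le {m l i : ℕ} {P R a : ℝ} (hm : m = l + i) (hP : 1 ≤ P)
    (hmP : (m : ℝ) ≤ P) (hR0 : 0 < R) (hR1 : R ≤ 1) (ha : m / 3 * Real.log R ≤ a)
    (hb : m / 2 * (Real.log (m + 1 : ℕ) - Real.log P - 1) ≤ a) :
    (m.factorial : ℝ) / (l.factorial : ℝ) * (R ^ (5 / 6 : ℝ)) ^ l * (P ^ i)⁻¹ ≤
      Real.exp 1 * (m + 1 : ℕ) * Real.exp (5 / 4 * a) := by
  have hP0 : 0 < P := by linarith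
  have hlR : Real.log R ≤ 0 := Real.log_nonpos hR0.le hR1
  have hlP : 0 ≤ Real.log P := Real.log_nonneg hP
  have hm' : (m : ℝ) = l + i := by exact_mod_cast hm
  have hfm : (0 : ℝ) < m.factorial := by positivity
  have hfl : (0 : ℝ) < l.factorial := by positivity
  have hk0 : (0 : ℝ) < (m + 1 : ℕ) := by positivity
  have hk : (0 : ℝ) ≤ Real.log (m + 1 : ℕ) := Real.log_natCast_nonneg _
  have hl0 : (0 : ℝ) ≤ l := by positivity
  have hi0 : (0 : ℝ) ≤ i := by positivity
  have hpos : 0 < (m.factorial : ℝ) / (l.factorial : ℝ) * (R ^ (5 / 6 : ℝ)) ^ l * (P ^ i)⁻¹ := by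
    positivity
  have hlog : Real.log ((m.factorial : ℝ) / (l.factorial : ℝ) * (R ^ (5 / 6 : ℝ)) ^ l *
      (P ^ i)⁻¹) = Real.log m.factorial - Real.log l.factorial + 5 / 6 * l * Real.log R -
        i * Real.log P := by
    rw [Real.log_mul (by positivity) (by positivity), Real.log_mul (by positivity) (by positivity),
      Real.log_div hfm.ne' hfl.ne', Real.log_inv, Real.log_pow, Real.log_pow, Real.log_rpow hR0]
    ring
  have hkey : Real.log ((m.factorial : ℝ) / (l.factorial : ℝ) * (R ^ (5 / 6 : ℝ)) ^ l *
      (P ^ i)⁻¹) ≤ 1 + Real.log (m + 1 : ℕ) + 5 / 4 * a := by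
    rw [hlog]
    -- If `l ≥ m/2`, the power of `R` alone suffices, since `(5/6)(m/2) = (5/4)(m/3)` and `m!/l! ≤
    -- P^i`.
    rcases le_or_gt i l with hil | hil
    · have hil' : (i : ℝ) ≤ l := by exact_mod_cast hil
      have h1 : Real.log m.factorial - Real.log l.factorial ≤ i * Real.log P := by
        have h2 : (m.factorial : ℝ) ≤ l.factorial * P ^ i := by
          have h3 : m.factorial ≤ l.factorial * m ^ i := by
            rw [← Nat.factorial_mul_descFactorial (show i ≤ m by omega), show m - i = l by omega]
            exact Nat.mul_le_mul_left _ (Nat.descFactorial_le_pow m i)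
          calc (m.factorial : ℝ) ≤ l.factorial * (m : ℝ) ^ i := by exact_mod_cast h3
            _ ≤ _ := by gcongr
        have h6 := Real.log_le_log hfm h2
        rw [Real.log_mul hfl.ne' (by positivity), Real.log_pow] at h6
        linarith
      have h2 : 5 / 6 * l * Real.log R ≤ 5 / 4 * (m / 3 * Real.log R) := by
        have : (m : ℝ) / 2 ≤ l := by linarith
        nlinarith
      linarith
    · have hil' : (l : ℝ) < i := by exact_mod_cast hil
      have hm1 : 1 ≤ m := by omega
      have hm0 : (0 : ℝ) < m := by exact_mod_cast hm1
      have h1 := log_factorial_sub_le hm hm1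
      have hlm : Real.log m ≤ Real.log P := Real.log_le_log hm0 hmP
      have hlk : Real.log m ≤ Real.log (m + 1 : ℕ) := Real.log_le_log hm0 (by push_cast; linarith)
      -- `w` interpolates between `l = m/2`, where the power of `R` carries the bound, and `l = 0`,
      -- where Stirling against `P^{-i}` does.
      set w : ℝ := 2 * l / m with hw
      have hw0 : 0 ≤ w := by positivity
      have hw1 : w ≤ 1 := by rw [hw, div_le_one hm0]; linarith
      have hwm : w * m = 2 * l := by rw [hw]; field_simp
      have h2 : 5 / 6 * l * Real.log R ≤ w * (5 / 4 * a) := by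
        have : 5 / 6 * l * Real.log R = w * (5 / 4 * (m / 3 * Real.log R)) := by
          have : w * (5 / 4 * (m / 3 * Real.log R)) = 5 / 12 * (w * m) * Real.log R := by ring
          rw [this, hwm]; ring
        rw [this]
        gcongr
      have h3 : 5 / 8 * (i - l) * (Real.log m - Real.log P - 1) ≤ (1 - w) * (5 / 4 * a) := by
        have h4 : (1 - w) * m = i - l := by rw [sub_mul, hwm, hm']; ring
        calc 5 / 8 * (i - l) * (Real.log m - Real.log P - 1)
            ≤ 5 / 8 * (i - l) * (Real.log (m + 1 : ℕ) - Real.log P - 1) := by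
              have : 0 ≤ 5 / 8 * ((i : ℝ) - l) := by linarith
              gcongr
          _ = (1 - w) * (5 / 4 * (m / 2 * (Real.log (m + 1 : ℕ) - Real.log P - 1))) := by
              rw [← h4]; ring
          _ ≤ _ := by
              have : 0 ≤ 1 - w := by linarith
              gcongr
      have h5 : 0 ≤ (i - 5 / 8 * (i - l)) * (Real.log P - Real.log m) :=
        mul_nonneg (by linarith) (by linarith)
      nlinarith
  calc _ = Real.exp (Real.log ((m.factorial : ℝ) / (l.factorial : ℝ) *
        (R ^ (5 / 6 : ℝ)) ^ l * (P ^ i)⁻¹)) := (Real.exp_log hpos).symm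
    _ ≤ Real.exp (1 + Real.log (m + 1 : ℕ) + 5 / 4 * a) := Real.exp_le_exp.2 hkey
    _ = _ := by rw [Real.exp_add, Real.exp_add, Real.exp_log hk0]

theorem pow_mul_exp_le (N : ℕ) {t : ℝ} (ht : 0 ≤ t) :
    (16 + t) ^ N * Real.exp (-(t / 4)) ≤ 4 ^ N * N.factorial * Real.exp 4 := by
  have h := Real.pow_div_factorial_le_exp ((16 + t) / 4) (by positivity) N
  rw [div_pow, div_div, div_le_iff₀ (by positivity)] at h
  calc (16 + t) ^ N * Real.exp (-(t / 4))
      ≤ Real.exp ((16 + t) / 4) * (4 ^ N * N.factorial) * Real.exp (-(t / 4)) := by gcongr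
    _ = 4 ^ N * N.factorial * (Real.exp ((16 + t) / 4) * Real.exp (-(t / 4))) := by ring
    _ = _ := by
        rw [← Real.exp_add]
        congr 2
        ring

theorem exp_half_le_two : Real.exp (1 / 2) ≤ 2 := by
  rw [← Real.le_log_iff_exp_le (by norm_num)]
  linarith [Real.log_two_gt_d9]

-- Here `a` is the larger of the two exponents in the target, so `e^a` is the claimed size. The
-- interpolation gives `e^{5a/4}` for each summand, and the spare `e^{a/4}` absorbs the powers of
-- `16 - a` coming from `u` and `v`. As `k ≤ P`, the exponential loss is at most a constant times
-- `k²`, and the sum over `j` costs another `k²`; the total `k⁴` is below `k^{6+n}`.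
set_option maxHeartbeats 1000000 in
theorem le_of_forall_parameters_of_le {n m : ℕ} {P R α avg K C : ℝ} (hK : 0 < K) (hC : 0 < C)
    (hα : 0 < α) (hP : 3 ≤ P) (hRP : 3 ≤ R * P) (hR1 : R ≤ 1) (hkP : ((m + 1 : ℕ) : ℝ) ≤ P)
    (h : ∀ u v : ℝ, 16 ≤ u → u ≤ 100 * ((m + 1 : ℕ) : ℝ) * P → 1 ≤ v →
      avg ≤ K / α * ((Real.exp (m + 1 : ℕ) * P ^ (m + 1))⁻¹ + Real.exp (-v) +
        Real.exp ((C + 33 / 20 * Real.log (m + 1 : ℕ)) * (m + 1 : ℕ) / P) *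
          (Real.exp (-(10 / 3 * u)) + v ^ n * u * Real.exp ((m + 1 : ℕ) / P * (Real.log v / 20)) *
            ∑ j ∈ (Finset.Icc 1 (m + 1)).filter (fun j : ℕ => (j : ℝ) ≤ u),
              (m.factorial : ℝ) / ((m + 1 - j).factorial : ℝ) *
                (R ^ (5 / 6 : ℝ)) ^ (m + 1 - j) * (P ^ (j - 1))⁻¹))) :
    avg ≤ 2 * K * (2 + Real.exp C *
        (1 + 4 ^ (n + 2) * (n + 2).factorial * Real.exp 4 * Real.exp 1)) *
      (((m + 1 : ℕ) : ℝ) ^ (6 + n) / α * (R ^ ((((m + 1 : ℕ) : ℝ) - 1) / 3) +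
        Real.exp (-((m + 1 : ℕ) : ℝ) / 2) *
          (((m + 1 : ℕ) : ℝ) / P) ^ ((((m + 1 : ℕ) : ℝ) - 1) / 2))) := by
  have hP0 : 0 < P := by linarith
  have hR0 : 0 < R := by
    by_contra hR
    nlinarith
  have hlP : 0 ≤ Real.log P := Real.log_nonneg (by linarith)
  have hlP' : Real.log P ≤ P := (Real.log_le_sub_one_of_pos hP0).trans (by linarith)
  have hlR : -Real.log P ≤ Real.log R := by
    have := Real.log_le_log (by norm_num : (0 : ℝ) < 1) (by linarith : 1 ≤ R * P)
    rw [Real.log_one, Real.log_mul hR0.ne' hP0.ne'] at this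
    linarith
  have hlR0 : Real.log R ≤ 0 := Real.log_nonpos hR0.le hR1
  have hm0 : (0 : ℝ) ≤ m := by positivity
  have hk : ((m + 1 : ℕ) : ℝ) = m + 1 := by push_cast; ring
  have hk1 : (1 : ℝ) ≤ ((m + 1 : ℕ) : ℝ) := by rw [hk]; linarith
  have hmP : (m : ℝ) ≤ P := by linarith
  have hfac : ∀ j ∈ Finset.Icc 1 (m + 1), ∃ l i : ℕ, m = l + i ∧ m + 1 - j = l ∧ j - 1 = i := by
    intro j hj
    obtain ⟨h1, h2⟩ := Finset.mem_Icc.1 hj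
    exact ⟨m + 1 - j, j - 1, by omega, rfl, rfl⟩
  set k : ℝ := ((m + 1 : ℕ) : ℝ) with hkdef
  have hlk : 0 ≤ Real.log k := Real.log_nonneg hk1
  have hlkP : Real.log k ≤ Real.log P := Real.log_le_log (by linarith) hkP
  set a := max (m / 3 * Real.log R) (m / 2 * (Real.log k - Real.log P - 1)) with ha
  have ha1 : m / 3 * Real.log R ≤ a := le_max_left _ _
  have ha2 : m / 2 * (Real.log k - Real.log P - 1) ≤ a := le_max_right _ _
  have ha0 : a ≤ 0 :=
    max_le (mul_nonpos_of_nonneg_of_nonpos (by positivity) hlR0)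
      (mul_nonpos_of_nonneg_of_nonpos (by positivity) (by linarith))
  have hkP3 : 3 ≤ k * P := by nlinarith
  have hakP : -(k * P) ≤ a := by
    have h1 : m / 3 * Real.log P ≤ k * P := mul_le_mul (by linarith) hlP' hlP (by linarith)
    have h2 := mul_le_mul_of_nonneg_left hlR (by positivity : 0 ≤ (m : ℝ) / 3)
    linarith
  -- Admissible because `0 ≤ -a ≤ k P` and `k P ≥ 3`.
  have key := h (16 - a) (16 - a) (by linarith) (by linarith) (by linarith)
  have b1 : (Real.exp k * P ^ (m + 1))⁻¹ ≤ Real.exp a := by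
    have h1 : Real.exp k * P ^ (m + 1) = Real.exp (k + (m + 1 : ℕ) * Real.log P) := by
      rw [Real.exp_add, ← Real.log_pow, Real.exp_log (by positivity)]
    rw [h1, ← Real.exp_neg]
    refine Real.exp_le_exp.2 ?_
    rw [← hkdef]
    have h2 := mul_le_mul_of_nonneg_left hlR (by positivity : 0 ≤ (m : ℝ) / 3)
    have h3 : m / 3 * Real.log P ≤ k * Real.log P :=
      mul_le_mul_of_nonneg_right (by linarith) hlP
    linarith
  have b2 : Real.exp (-(16 - a)) ≤ Real.exp a := Real.exp_le_exp.2 (by linarith)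
  have hkP1 : k / P ≤ 1 := (div_le_one hP0).2 hkP
  have b3 : Real.exp ((C + 33 / 20 * Real.log k) * k / P) ≤ Real.exp C * k ^ 2 := by
    have h1 : k ^ 2 = Real.exp (2 * Real.log k) := by
      rw [two_mul, Real.exp_add, Real.exp_log (by linarith), sq]
    rw [h1, ← Real.exp_add]
    refine Real.exp_le_exp.2 ?_
    calc (C + 33 / 20 * Real.log k) * k / P = (C + 33 / 20 * Real.log k) * (k / P) := by ring
      _ ≤ (C + 33 / 20 * Real.log k) * 1 := by gcongr
      _ ≤ _ := by linarith
  have b4 : Real.exp (-(10 / 3 * (16 - a))) ≤ Real.exp a := Real.exp_le_exp.2 (by linarith)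
  have b5 : Real.exp (k / P * (Real.log (16 - a) / 20)) ≤ 16 - a := by
    have h1 : 0 ≤ Real.log (16 - a) := Real.log_nonneg (by linarith)
    have h2 : k / P * (Real.log (16 - a) / 20) ≤ Real.log (16 - a) := by
      calc _ ≤ 1 * (Real.log (16 - a) / 20) := by gcongr
        _ ≤ _ := by linarith
    calc _ ≤ Real.exp (Real.log (16 - a)) := Real.exp_le_exp.2 h2
      _ = _ := Real.exp_log (by linarith)
  have b6 : ∑ j ∈ (Finset.Icc 1 (m + 1)).filter (fun j : ℕ => (j : ℝ) ≤ 16 - a),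
      (m.factorial : ℝ) / ((m + 1 - j).factorial : ℝ) *
        (R ^ (5 / 6 : ℝ)) ^ (m + 1 - j) * (P ^ (j - 1))⁻¹ ≤
          k * (Real.exp 1 * k * Real.exp (5 / 4 * a)) := by
    calc _ ≤ ∑ j ∈ Finset.Icc 1 (m + 1), (m.factorial : ℝ) / ((m + 1 - j).factorial : ℝ) *
          (R ^ (5 / 6 : ℝ)) ^ (m + 1 - j) * (P ^ (j - 1))⁻¹ :=
          Finset.sum_le_sum_of_subset_of_nonneg (Finset.filter_subset _ _)
            fun j _ _ => by positivity
      _ ≤ ∑ j ∈ Finset.Icc 1 (m + 1), Real.exp 1 * k * Real.exp (5 / 4 * a) := by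
          refine Finset.sum_le_sum fun j hj => ?_
          obtain ⟨l, i, hm, h1, h2⟩ := hfac j hj
          rw [h1, h2]
          exact factorial_div_mul_pow_le hm (by linarith) hmP hR0 hR1 ha1 ha2
      _ = _ := by
          rw [Finset.sum_const, Nat.card_Icc, nsmul_eq_mul]
          simp only [Nat.add_sub_cancel, hkdef]
  have b7 := pow_mul_exp_le (n + 2) (show 0 ≤ -a by linarith)
  set c : ℝ := 4 ^ (n + 2) * (n + 2).factorial * Real.exp 4 with hc
  have hc0 : 0 < c := by positivity
  have hu0 : 0 < 16 - a := by linarith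
  set S := ∑ j ∈ (Finset.Icc 1 (m + 1)).filter (fun j : ℕ => (j : ℝ) ≤ 16 - a),
      (m.factorial : ℝ) / ((m + 1 - j).factorial : ℝ) *
        (R ^ (5 / 6 : ℝ)) ^ (m + 1 - j) * (P ^ (j - 1))⁻¹ with hS
  have hS0 : 0 ≤ S := Finset.sum_nonneg fun j _ => by positivity
  have b8 : (16 - a) ^ n * (16 - a) * Real.exp (k / P * (Real.log (16 - a) / 20)) * S ≤
      c * Real.exp 1 * k ^ 2 * Real.exp a := by
    calc _ ≤ (16 - a) ^ n * (16 - a) * (16 - a) * (k * (Real.exp 1 * k * Real.exp (5 / 4 * a))) := by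
          gcongr
      _ = ((16 + -a) ^ (n + 2) * Real.exp (-(-a / 4))) * (Real.exp 1 * k ^ 2 * Real.exp a) := by
          have : Real.exp (5 / 4 * a) = Real.exp (-(-a / 4)) * Real.exp a := by
            rw [← Real.exp_add]; congr 1; ring
          rw [this]
          ring
      _ ≤ c * (Real.exp 1 * k ^ 2 * Real.exp a) := by gcongr
      _ = _ := by ring
  have hea := Real.exp_pos a
  -- The 2 absorbs `e^{1/2}`, which appears because `e^{-m/2}` is rewritten with `k = m + 1`.
  have b9 : Real.exp a ≤ 2 * (R ^ ((k - 1) / 3) + Real.exp (-k / 2) * (k / P) ^ ((k - 1) / 2)) := by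
    have e1 : R ^ ((k - 1) / 3) = Real.exp (m / 3 * Real.log R) := by
      rw [Real.rpow_def_of_pos hR0, hk]; congr 1; ring
    have hkP0 : 0 < k / P := by positivity
    have e2 : Real.exp (1 / 2) * (Real.exp (-k / 2) * (k / P) ^ ((k - 1) / 2)) =
        Real.exp (m / 2 * (Real.log k - Real.log P - 1)) := by
      rw [Real.rpow_def_of_pos hkP0, Real.log_div (by linarith) hP0.ne', ← Real.exp_add,
        ← Real.exp_add, hk]
      congr 1
      ring
    have e3 := exp_half_le_two
    have p1 : 0 < R ^ ((k - 1) / 3) := by positivity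
    have p2 : 0 < Real.exp (-k / 2) * (k / P) ^ ((k - 1) / 2) := by positivity
    rcases max_cases (m / 3 * Real.log R) (m / 2 * (Real.log k - Real.log P - 1)) with hh | hh
    · rw [ha, hh.1, ← e1]
      linarith
    · rw [ha, hh.1, ← e2]
      have := mul_le_mul_of_nonneg_right e3 p2.le
      linarith
  have hk4 : k ^ 4 ≤ k ^ (6 + n) := pow_le_pow_right₀ hk1 (by omega)
  have hk2 : 1 ≤ k ^ 2 := one_le_pow₀ hk1
  have hk24 : 1 ≤ k ^ 4 := one_le_pow₀ hk1
  set W := R ^ ((k - 1) / 3) + Real.exp (-k / 2) * (k / P) ^ ((k - 1) / 2) with hW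
  have hW0 : 0 ≤ W := by positivity
  calc avg ≤ K / α * (Real.exp a + Real.exp a + Real.exp C * k ^ 2 *
        (Real.exp a + c * Real.exp 1 * k ^ 2 * Real.exp a)) := by
        refine key.trans ?_
        gcongr
    _ = K / α * ((2 + Real.exp C * (k ^ 2 + c * Real.exp 1 * k ^ 4)) * Real.exp a) := by ring
    _ ≤ K / α * ((2 * k ^ 4 + Real.exp C * (k ^ 4 + c * Real.exp 1 * k ^ 4)) * (2 * W)) := by
        gcongr
        · linarith
        · norm_num
    _ = 2 * K * (2 + Real.exp C * (1 + c * Real.exp 1)) * (k ^ 4 / α * W) := by ring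
    _ ≤ _ := by gcongr

-- The target is at least `exp(-kθ/3)` times the exponential loss, where `θ` selects the dominant
-- term. For small `kθ` the trivial bound is enough; otherwise the powers of `k` are absorbed by
-- `exp(w)` with `w = k log k / P ≥ log k`.
set_option maxHeartbeats 1000000 in
theorem le_of_forall_parameters_of_lt {n m : ℕ} {P R α avg K C : ℝ} (hK : 0 < K)
    (hα : 0 < α) (hP : 3 ≤ P) (hR0 : 0 < R) (hR1 : R ≤ 1) (hkP : P < ((m + 1 : ℕ) : ℝ))
    (hCP : 20 * C ≤ Real.log P) (havg : avg ≤ 2 / α)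
    (h : ∀ u v : ℝ, 16 ≤ u → u ≤ 100 * ((m + 1 : ℕ) : ℝ) * P → 1 ≤ v →
      avg ≤ K / α * ((Real.exp (m + 1 : ℕ) * P ^ (m + 1))⁻¹ + Real.exp (-v) +
        Real.exp ((C + 33 / 20 * Real.log (m + 1 : ℕ)) * (m + 1 : ℕ) / P) *
          (Real.exp (-(10 / 3 * u)) + v ^ n * u * Real.exp ((m + 1 : ℕ) / P * (Real.log v / 20)) *
            ∑ j ∈ (Finset.Icc 1 (m + 1)).filter (fun j : ℕ => (j : ℝ) ≤ u),
              (m.factorial : ℝ) / ((m + 1 - j).factorial : ℝ) *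
                (R ^ (5 / 6 : ℝ)) ^ (m + 1 - j) * (P ^ (j - 1))⁻¹))) :
    avg ≤ (4 * K + 2 * Real.exp (160 / 3)) * (1 / α *
      Real.exp ((6 + (n : ℝ)) * ((m + 1 : ℕ) : ℝ) * Real.log (m + 1 : ℕ) / P) *
        (Real.exp (-((m + 1 : ℕ) : ℝ) / 3) +
          R ^ (((m + 1 : ℕ) : ℝ) / (3 * (1 + Real.log (((m + 1 : ℕ) : ℝ) / P)))))) := by
  have hP0 : 0 < P := by linarith
  have hk : ((m + 1 : ℕ) : ℝ) = m + 1 := by push_cast; ring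
  have hm0 : (0 : ℝ) ≤ m := by positivity
  have hfac : ∀ j ∈ Finset.Icc 1 (m + 1), ∃ l i : ℕ, m = l + i ∧ m + 1 - j = l ∧ j - 1 = i ∧
      j = i + 1 := by
    intro j hj
    obtain ⟨h1, h2⟩ := Finset.mem_Icc.1 hj
    exact ⟨m + 1 - j, j - 1, by omega, rfl, rfl, by omega⟩
  set k : ℝ := ((m + 1 : ℕ) : ℝ) with hkdef
  have hk0 : 0 < k := by linarith
  have hlk1 : 1 ≤ Real.log k := by
    rw [Real.le_log_iff_exp_le hk0]
    linarith [Real.exp_one_lt_d9]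
  have hlPk : Real.log P ≤ Real.log k := Real.log_le_log hP0 hkP.le
  have hkP1 : 1 < k / P := (one_lt_div hP0).2 hkP
  set b := Real.log (k / P) with hb
  have hb0 : 0 < b := Real.log_pos hkP1
  set g := -Real.log R with hg
  have hg0 : 0 ≤ g := by
    have := Real.log_nonpos hR0.le hR1
    linarith
  set θ := min 1 (g / (1 + b)) with hθ
  have hθ0 : 0 ≤ θ := le_min zero_le_one (by positivity)
  have hθ1 : θ ≤ 1 := min_le_left _ _
  have hθg : θ * (1 + b) ≤ g := (le_div_iff₀ (by positivity)).1 (min_le_right _ _)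
  have hθg' : θ ≤ g := by nlinarith
  set w := k * Real.log k / P with hw
  have hwk : Real.log k ≤ w := by
    have : w = k / P * Real.log k := by rw [hw]; ring
    rw [this]
    exact le_mul_of_one_le_left (by linarith) hkP1.le
  have hE : Real.exp ((6 + (n : ℝ)) * k * Real.log k / P) = Real.exp ((6 + n) * w) := by
    congr 1; rw [hw]; ring
  rw [hE]
  have hw0 : 0 ≤ w := by linarith
  have hsum : Real.exp (-(k * θ / 3)) ≤ Real.exp (-k / 3) + R ^ (k / (3 * (1 + b))) := by
    have e1 : R ^ (k / (3 * (1 + b))) = Real.exp (-(k * (g / (1 + b)) / 3)) := by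
      rw [Real.rpow_def_of_pos hR0]
      congr 1
      rw [hg]
      field_simp
    have p1 := Real.exp_pos (-k / 3)
    have p2 : 0 < R ^ (k / (3 * (1 + b))) := by positivity
    rcases min_cases 1 (g / (1 + b)) with hh | hh
    · rw [hθ, hh.1, mul_one, ← neg_div]
      linarith
    · rw [hθ, hh.1, ← e1]
      linarith
  set V := Real.exp (-k / 3) + R ^ (k / (3 * (1 + b)))
  have hEw : 1 ≤ Real.exp ((6 + n) * w) := Real.one_le_exp (by positivity)
  -- 160 is the point at which `u = kθ/10` reaches the minimal admissible value 16.
  rcases lt_or_ge (k * θ) 160 with hsmall | hlarge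
  · have h1 : 1 ≤ Real.exp (160 / 3) * V := by
      calc (1 : ℝ) = Real.exp (160 / 3) * Real.exp (-(160 / 3)) := by
            rw [← Real.exp_add]; simp
        _ ≤ Real.exp (160 / 3) * Real.exp (-(k * θ / 3)) := by
            gcongr
        _ ≤ _ := by gcongr
    have hV : 0 ≤ V := le_trans (Real.exp_pos _).le hsum
    calc avg ≤ 2 / α * (1 * 1) := by linarith
      _ ≤ 2 / α * (Real.exp ((6 + n) * w) * (Real.exp (160 / 3) * V)) := by gcongr
      _ = 2 * Real.exp (160 / 3) * (1 / α * Real.exp ((6 + n) * w) * V) := by ring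
      _ ≤ _ := by
          gcongr
          linarith
  · have hk160 : 160 ≤ k := hlarge.trans (mul_le_of_le_one_right hk0.le hθ1)
    have hkθ : k * θ ≤ k := mul_le_of_le_one_right hk0.le hθ1
    have hu100 : k * θ / 10 ≤ 100 * k * P := by nlinarith
    -- With `u = kθ/10` the Rankin term is exactly `exp(-kθ/3)`; `v = k` makes the smoothing term at
    -- most that.
    have key := h (k * θ / 10) k (by linarith) hu100 (by linarith)
    set D := Real.exp (-(k * θ / 3)) with hD
    have hD0 : 0 < D := Real.exp_pos _
    have b1 : (Real.exp k * P ^ (m + 1))⁻¹ ≤ D := by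
      rw [hD, Real.exp_neg]
      refine inv_anti₀ (Real.exp_pos _) ?_
      calc Real.exp (k * θ / 3) ≤ Real.exp k := Real.exp_le_exp.2 (by linarith)
        _ ≤ _ := le_mul_of_one_le_right (Real.exp_pos _).le (one_le_pow₀ (by linarith))
    have b2 : Real.exp (-k) ≤ D := Real.exp_le_exp.2 (by linarith)
    have b3 : Real.exp ((C + 33 / 20 * Real.log k) * k / P) ≤ Real.exp (17 / 10 * w) := by
      refine Real.exp_le_exp.2 ?_
      calc (C + 33 / 20 * Real.log k) * k / P ≤ (17 / 10 * Real.log k) * k / P := by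
            gcongr
            linarith
        _ = _ := by rw [hw]; ring
    have b4 : Real.exp (-(10 / 3 * (k * θ / 10))) = D := by
      rw [hD]; congr 1; ring
    have b5 : k ≤ Real.exp w := by
      calc k = Real.exp (Real.log k) := (Real.exp_log hk0).symm
        _ ≤ _ := Real.exp_le_exp.2 hwk
    have b6 : Real.exp (k / P * (Real.log k / 20)) = Real.exp (w / 20) := by
      congr 1; rw [hw]; ring
    have b7 : ∑ j ∈ (Finset.Icc 1 (m + 1)).filter (fun j : ℕ => (j : ℝ) ≤ k * θ / 10),
        (m.factorial : ℝ) / ((m + 1 - j).factorial : ℝ) *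
          (R ^ (5 / 6 : ℝ)) ^ (m + 1 - j) * (P ^ (j - 1))⁻¹ ≤ k * D := by
      calc _ ≤ ∑ j ∈ (Finset.Icc 1 (m + 1)).filter (fun j : ℕ => (j : ℝ) ≤ k * θ / 10), D := by
            refine Finset.sum_le_sum fun j hj => ?_
            obtain ⟨hj1, hj2⟩ := Finset.mem_filter.1 hj
            obtain ⟨l, i, hm, h1, h2, h3⟩ := hfac j hj1
            rw [h1, h2]
            have hiu : (i : ℝ) ≤ k * θ / 10 := by
              rw [h3] at hj2
              push_cast at hj2
              linarith
            have hm' : (m : ℝ) = l + i := by exact_mod_cast hm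
            have f1 : (m.factorial : ℝ) / l.factorial ≤ k ^ i := by
              rw [div_le_iff₀' (by positivity)]
              have : m.factorial ≤ l.factorial * (m + 1) ^ i := by
                rw [← Nat.factorial_mul_descFactorial (show i ≤ m by omega),
                  show m - i = l by omega]
                exact Nat.mul_le_mul_left _ ((Nat.descFactorial_le_pow m i).trans
                  (Nat.pow_le_pow_left (Nat.le_succ m) i))
              rw [hkdef]
              exact_mod_cast this
            calc (m.factorial : ℝ) / l.factorial * (R ^ (5 / 6 : ℝ)) ^ l * (P ^ i)⁻¹
                ≤ k ^ i * (R ^ (5 / 6 : ℝ)) ^ l * (P ^ i)⁻¹ := by gcongr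
              _ = (k / P) ^ i * (R ^ (5 / 6 : ℝ)) ^ l := by rw [div_pow]; ring
              _ = Real.exp (i * b - 5 / 6 * l * g) := by
                  rw [← Real.exp_log (show 0 < k / P by positivity), ← hb,
                    Real.rpow_def_of_pos hR0, ← Real.exp_nat_mul, ← Real.exp_nat_mul,
                    ← Real.exp_add]
                  congr 1
                  rw [hg]
                  ring
              -- Few primes lie in the rough part: `i ≤ kθ/10`, so the growth `i b` is at most `(k g
              -- - k θ)/10` by the choice of `θ`, while `l ≥ 4k/5` gives decay at least `(2/3) k g ≥
              -- (2/3) k θ`.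
              _ ≤ D := by
                  refine Real.exp_le_exp.2 ?_
                  have g1 : i * b ≤ k * θ / 10 * b := by gcongr
                  have g2 : k * (θ * (1 + b)) ≤ k * g := by gcongr
                  have g3 : 4 / 5 * k * g ≤ l * g := by
                    gcongr
                    linarith
                  have g4 : k * θ ≤ k * g := by gcongr
                  have g5 : 0 ≤ k * θ := by positivity
                  linarith
        _ ≤ ∑ j ∈ Finset.Icc 1 (m + 1), D :=
            Finset.sum_le_sum_of_subset_of_nonneg (Finset.filter_subset _ _)
              fun j _ _ => hD0.le
        _ = _ := by
            rw [Finset.sum_const, Nat.card_Icc, nsmul_eq_mul]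
            simp only [Nat.add_sub_cancel, hkdef]
    set S := ∑ j ∈ (Finset.Icc 1 (m + 1)).filter (fun j : ℕ => (j : ℝ) ≤ k * θ / 10),
        (m.factorial : ℝ) / ((m + 1 - j).factorial : ℝ) *
          (R ^ (5 / 6 : ℝ)) ^ (m + 1 - j) * (P ^ (j - 1))⁻¹ with hS
    have hS0 : 0 ≤ S := Finset.sum_nonneg fun j _ => by positivity
    rw [b4, b6] at key
    have hu0 : 0 ≤ k * θ / 10 := by positivity
    have b8 : k ^ n * (k * θ / 10) * Real.exp (w / 20) * S ≤
        Real.exp ((n + 41 / 20) * w) * D := by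
      calc _ ≤ Real.exp w ^ n * Real.exp w * Real.exp (w / 20) * (Real.exp w * D) := by
            have : k * θ / 10 ≤ Real.exp w := by linarith
            have : k * D ≤ Real.exp w * D := by gcongr
            have := b7.trans this
            gcongr
        _ = _ := by
            rw [← Real.exp_nat_mul, ← Real.exp_add, ← Real.exp_add, ← mul_assoc, ← Real.exp_add]
            congr 2
            ring
    have b9 : Real.exp (17 / 10 * w) * (D + Real.exp ((n + 41 / 20) * w) * D) ≤
        2 * (Real.exp ((6 + n) * w) * D) := by
      have hn0 : (0 : ℝ) ≤ n := by positivity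
      have hnw : 0 ≤ n * w := by positivity
      have f1 : Real.exp (17 / 10 * w) ≤ Real.exp ((6 + n) * w) :=
        Real.exp_le_exp.2 (by linarith)
      have f2 : Real.exp (17 / 10 * w) * Real.exp ((n + 41 / 20) * w) ≤
          Real.exp ((6 + n) * w) := by
        rw [← Real.exp_add]
        exact Real.exp_le_exp.2 (by linarith)
      calc _ = Real.exp (17 / 10 * w) * D +
            Real.exp (17 / 10 * w) * Real.exp ((n + 41 / 20) * w) * D := by ring
        _ ≤ Real.exp ((6 + n) * w) * D + Real.exp ((6 + n) * w) * D := by gcongr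
        _ = _ := by ring
    have b10 : D ≤ Real.exp ((6 + n) * w) * D := le_mul_of_one_le_left hD0.le hEw
    set E := Real.exp ((6 + n) * w)
    calc avg ≤ K / α * (D + D + Real.exp (17 / 10 * w) *
          (D + Real.exp ((n + 41 / 20) * w) * D)) := by
          refine key.trans ?_
          gcongr
      _ ≤ K / α * (E * D + E * D + 2 * (E * D)) := by gcongr
      _ = 4 * K * (1 / α * E * D) := by ring
      _ ≤ (4 * K + 2 * Real.exp (160 / 3)) * (1 / α * E * V) := by
          gcongr
          linarith [Real.exp_pos (160 / 3)]

/-! ### From integers to real `x`, and the conclusion. -/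

theorem avgDisc_le_one (A : Family n) (k : ℕ) (x : ℝ) : avgDisc A k x ≤ 1 := by
  refine div_le_one_of_le₀ ?_ (by positivity)
  calc ∑ q ∈ Qk A k x, disc (Delta A q) ≤ ∑ q ∈ Qk A k x, (1 : ℝ) := by
        refine Finset.sum_le_sum fun q hq => ?_
        obtain ⟨h1, h2⟩ := Finset.mem_filter.1 hq
        have : NeZero q := ⟨by have := (Finset.mem_Icc.1 h1).1; omega⟩
        exact disc_Delta_le_one A q h2.1
    _ = _ := by simp

theorem le_exp_two_mul_sqrt {L : ℝ} (hL : 0 ≤ L) : 2 * L ≤ Real.exp (2 * Real.sqrt L) := by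
  have h1 := Real.pow_div_factorial_le_exp (2 * Real.sqrt L) (by positivity) 2
  rw [mul_pow, Real.sq_sqrt hL] at h1
  norm_num [Nat.factorial] at h1
  linarith

theorem le_log_log_floor {M x : ℝ} (hx : Real.exp (Real.exp M) + 1 ≤ x) :
    M ≤ Real.log (Real.log (⌊x⌋₊ : ℕ)) := by
  have h1 : Real.exp (Real.exp M) ≤ (⌊x⌋₊ : ℕ) := by
    have := (Nat.sub_one_lt_floor x).le
    linarith
  have h0 : (0 : ℝ) < (⌊x⌋₊ : ℕ) := lt_of_lt_of_le (Real.exp_pos _) h1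
  have h2 : Real.exp M ≤ Real.log (⌊x⌋₊ : ℕ) := (Real.le_log_iff_exp_le h0).2 h1
  exact (Real.le_log_iff_exp_le (lt_of_lt_of_le (Real.exp_pos _) h2)).2 h2

/-- Passing to the integer part costs a factor 4 under the square root, hence 2 outside; this is why
the admissible range was taken as `k ≤ exp(2 √(log log X))`. -/
theorem log_log_le_four_mul {x : ℝ} (hx : 1 ≤ Real.log (Real.log (⌊x⌋₊ : ℕ))) :
    Real.log (Real.log x) ≤ 4 * Real.log (Real.log (⌊x⌋₊ : ℕ)) := by
  set X : ℝ := ((⌊x⌋₊ : ℕ) : ℝ) with hX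
  have hX2 : 2 ≤ X := by
    rw [hX]
    by_contra h
    have h1 : ⌊x⌋₊ < 2 := by
      by_contra h2
      exact h (by exact_mod_cast not_lt.1 h2)
    interval_cases hf : ⌊x⌋₊ <;> simp [hX] at hx <;> linarith
  have hxX : x ≤ X ^ 2 := by
    have := Nat.lt_floor_add_one x
    nlinarith
  have hx0 : X ≤ x := by
    refine Nat.floor_le ?_
    by_contra h
    have : ⌊x⌋₊ = 0 := Nat.floor_of_nonpos (not_le.1 h).le
    rw [hX, this] at hX2
    norm_num at hX2
  have hlX : 0 < Real.log X := Real.log_pos (by linarith)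
  have h1 : Real.log x ≤ 2 * Real.log X := by
    have := Real.log_le_log (by linarith) hxX
    rwa [Real.log_pow] at this
  have hlx : 0 < Real.log x := Real.log_pos (by linarith)
  have h2 := Real.log_le_log hlx h1
  rw [Real.log_mul (by norm_num) hlX.ne'] at h2
  linarith [Real.log_two_lt_d9]

end CRTSets

end

theorem proposition5p1 :
    ∃ C : ℕ → ℝ, ∀ α x₀ : ℝ, 0 < α → 2 ≤ x₀ → ∃ X : ℝ,
      ∀ (n : ℕ) (A : CRTSets.Family n), 1 ≤ n → CRTSets.DensityAssumption A α x₀ →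
        ∀ x : ℝ, X ≤ x → ∀ k : ℕ, 1 ≤ k →
          ((k : ℝ) ≤ CRTSets.calP A x →
            (CRTSets.Qk A k x).Nonempty ∧
            CRTSets.avgDisc A k x ≤
              C n * ((k : ℝ) ^ (6 + n) / α *
                ((CRTSets.calPtilde A x / CRTSets.calP A x) ^ (((k : ℝ) - 1) / 3) +
                  Real.exp (-(k : ℝ) / 2) *
                    ((k : ℝ) / CRTSets.calP A x) ^ (((k : ℝ) - 1) / 2)))) ∧
          (CRTSets.calP A x < (k : ℝ) →
            (k : ℝ) ≤ Real.exp (Real.sqrt (Real.log (Real.log x))) →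
            (CRTSets.Qk A k x).Nonempty ∧
            CRTSets.avgDisc A k x ≤
              C n * (1 / α *
                Real.exp ((6 + (n : ℝ)) * (k : ℝ) * Real.log k / CRTSets.calP A x) *
                (Real.exp (-(k : ℝ) / 3) +
                  (CRTSets.calPtilde A x / CRTSets.calP A x) ^
                    ((k : ℝ) / (3 * (1 + Real.log ((k : ℝ) / CRTSets.calP A x))))))) := by
  obtain ⟨K, C, hK, hC, hmaster⟩ := CRTSets.exists_avgDisc_le
  obtain ⟨CP, -, hCP⟩ := CRTSets.exists_calP_le
  set c₁ : ℕ → ℝ := fun n => 2 * K n * (2 + Real.exp C *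
        (1 + 4 ^ (n + 2) * (n + 2).factorial * Real.exp 4 * Real.exp 1)) with hc₁
  set c₂ : ℕ → ℝ := fun n => 4 * K n + 2 * Real.exp (160 / 3) with hc₂
  have hc₁0 : ∀ n, 0 ≤ c₁ n := fun n => by have := hK n; positivity
  have hc₂0 : ∀ n, 0 ≤ c₂ n := fun n => by have := hK n; positivity
  refine ⟨fun n => c₁ n + c₂ n, fun α x₀ hα hx₀ => ?_⟩
  obtain ⟨L₀, hL₀⟩ := hmaster α x₀ hα hx₀
  -- This makes `L = log log ⌊x⌋` at least `1 + |L₀| + 2|CP|`; the last summand gives `𝒫 ≤ (3/2) L +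
  -- CP ≤ 2 L`, so that `k ≤ 𝒫` lies in the admissible range.
  refine ⟨Real.exp (Real.exp (1 + |L₀| + 2 * |CP|)) + 1, fun n A _ hA x hx k hk => ?_⟩
  have hL := CRTSets.le_log_log_floor hx
  have aL := abs_nonneg L₀
  have aC := abs_nonneg CP
  obtain ⟨m, rfl⟩ := Nat.exists_eq_add_of_le' hk
  have eP : CRTSets.calP A x = CRTSets.calP A (⌊x⌋₊ : ℕ) := by
    simp [CRTSets.calP, CRTSets.primesQ]
  have ePt : CRTSets.calPtilde A x = CRTSets.calPtilde A (⌊x⌋₊ : ℕ) := by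
    simp [CRTSets.calPtilde, CRTSets.primesQ]
  have eQ : CRTSets.Qk A (m + 1) x = CRTSets.Qk A (m + 1) (⌊x⌋₊ : ℕ) := by
    simp [CRTSets.Qk]
  have eA : CRTSets.avgDisc A (m + 1) x = CRTSets.avgDisc A (m + 1) (⌊x⌋₊ : ℕ) := by
    simp only [CRTSets.avgDisc, eQ]
  rw [eP, ePt, eQ, eA]
  have hll := CRTSets.log_log_le_four_mul (x := x) (by linarith)
  set X := ⌊x⌋₊
  set L := Real.log (Real.log (X : ℝ)) with hLdef
  have hPt3 := CRTSets.three_le_calPtilde A X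
  have hPtP := CRTSets.calPtilde_le_calP A X
  have hP3 := hPt3.trans hPtP
  have hR1 := (div_le_one (by linarith)).2 hPtP
  have hR0 : 0 < CRTSets.calPtilde A X / CRTSets.calP A X := div_pos (by linarith) (by linarith)
  have hRP : 3 ≤ CRTSets.calPtilde A X / CRTSets.calP A X * CRTSets.calP A X := by
    rwa [div_mul_cancel₀ _ (by linarith)]
  have hX2 : (2 : ℝ) ≤ X := by
    by_contra h
    have h1 : X < 2 := by
      by_contra h2
      exact h (by exact_mod_cast not_lt.1 h2)
    have h3 : (X : ℝ) = 0 ∨ (X : ℝ) = 1 := by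
      have : X = 0 ∨ X = 1 := by omega
      rcases this with h | h <;> simp [h]
    rcases h3 with h | h <;> rw [hLdef, h] at hL <;> simp at hL <;> linarith
  refine ⟨fun hkP => ?_, fun hkP hkx => ?_⟩
  · have hk2 : ((m + 1 : ℕ) : ℝ) ≤ Real.exp (2 * Real.sqrt L) := by
      have h1 := hCP X hX2 n A
      have h2 : Real.log 4 ≤ 3 / 2 := by
        rw [show (4 : ℝ) = 2 ^ 2 by norm_num, Real.log_pow]
        have := Real.log_two_lt_d9
        push_cast
        linarith
      have h3 : Real.log 4 * L ≤ 3 / 2 * L := mul_le_mul_of_nonneg_right h2 (by linarith)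
      have h4 := CRTSets.le_exp_two_mul_sqrt (by linarith : 0 ≤ L)
      linarith [le_abs_self CP]
    obtain ⟨hne, -, h⟩ := hL₀ n A hA X m (by linarith [le_abs_self L₀]) hk2
    refine ⟨hne, (CRTSets.le_of_forall_parameters_of_le (hK n) hC hα hP3 hRP hR1 hkP h).trans ?_⟩
    refine mul_le_mul_of_nonneg_right (le_add_of_nonneg_right (hc₂0 n)) ?_
    positivity
  · have hk2 : ((m + 1 : ℕ) : ℝ) ≤ Real.exp (2 * Real.sqrt L) := by
      refine hkx.trans (Real.exp_le_exp.2 ?_)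
      rw [Real.sqrt_le_left (by positivity), mul_pow, Real.sq_sqrt (by linarith)]
      linarith
    obtain ⟨hne, hCl, h⟩ := hL₀ n A hA X m (by linarith [le_abs_self L₀]) hk2
    -- The density hypothesis forces `α ≤ log 4 < 2`, so the trivial bound 1 is of the required
    -- shape.
    have havg : CRTSets.avgDisc A (m + 1) X ≤ 2 / α := by
      refine (CRTSets.avgDisc_le_one A (m + 1) X).trans ?_
      have h1 := hA.le_log_four hx₀
      rw [show (4 : ℝ) = 2 ^ 2 by norm_num, Real.log_pow] at h1
      rw [le_div_iff₀ hα]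
      have := Real.log_two_lt_d9
      push_cast at h1
      linarith
    refine ⟨hne, (CRTSets.le_of_forall_parameters_of_lt (hK n) hα hP3 hR0 hR1 hkP hCl havg
      h).trans ?_⟩
    refine mul_le_mul_of_nonneg_right (le_add_of_nonneg_left (hc₁0 n)) ?_
    positivity
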